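/- **Conventions.** A quadrilateral creased paper has vertices $P_{i,j}\in\mathbb R^2$ ($0\le i\le n+1$, $0\le j\le m+1$), inner vertices for $1\le i\le n$, $1\le j\le m$ ($i$ numbers columns, $j$ rows), and strictly convex quadrilateral panels, any two of which meet exactly in the face spanned by their common corners. It is of the (developable) *parallel repeating type* with sector angles $\alpha_1,\dots,\alpha_{4n}\in(0,\pi)$, $\alpha_{4i-3}+\alpha_{4i-2}+\alpha_{4i-1}+\alpha_{4i}=2\pi$ (not forming a cross), and datum row $j_0$, if at the vertices $(i,j)$, $j\equiv j_0 \pmod 2$, the angles right–up, up–left, left–down, down–right between creases are $\alpha_{4i-3},\alpha_{4i-2},\alpha_{4i-1},\alpha_{4i}$, and in the other rows they are $\pi-\alpha_{4i},\pi-\alpha_{4i-1},\pi-\alpha_{4i-2},\pi-\alpha_{4i-3}$. A *folded state* places the vertices in $\mathbb R^3$ so that each panel is moved rigidly. A folded state $q$ is a *final rigidly folded state* if there is a continuous path of folded states from the planar state to $q$ such that no two panels adjacent along an inner crease clash (dihedral angle $0$) before the end, two such panels clash at $q$, and the path has one degree of freedom: each folded state near an intermediate state of the path is congruent to an intermediate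 state of the path. (Contact of non-adjacent panels is not considered.) A *datum row* consists of points $A_0,\dots,A_{n+1}\in\mathbb R^3$ ($n\ge1$), no three consecutive ones collinear, and unit vectors $u_i,d_i$ (upper and lower column crease at $A_i$, $1\le i\le n$), such that, with $e_i=A_{i+1}-A_i$, the angles $\alpha_{4i-3}=\angle(e_i,u_i)$, $\alpha_{4i-2}=\angle(-e_{i-1},u_i)$, $\alpha_{4i-1}=\angle(-e_{i-1},d_i)$, $\alpha_{4i}=\angle(e_i,d_i)$ lie in $(0,\pi)$; $u_{i+1}$ lies in the open half-plane bounded by $\mathbb Re_i$ through $u_i$, and $d_{i+1}$ in the one through $d_i$ ($1\le i\le n-1$); the first vertex is straight-line, $\alpha_1+\alpha_4=\alpha_2+\alpha_3=\pi$, with left row crease completely folded (dihedral angle $0$ at $e_0$) and right row crease having folding angle $\rho_4\in(0,\pi)$; the other vertices are flat-foldable, $\alpha_{4i-3}+\alpha_{4i-1}=\alpha_{4i-2}+\alpha_{4i}=\pi$ ($2\le i\le n$). For such angles put $\xi_1=|2\alpha_2-\pi|$ and let $\xi_{i+1}\in[0,\pi]$ be given by $$\cos \xi_{i+1}=\cos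 \alpha_{4i+2}\cos \alpha_{4i+3}+\frac{\sin \alpha_{4i+2}\sin \alpha_{4i+3}}{\sin \alpha_{4i-3}\sin \alpha_{4i}}(\cos \xi_i - \cos \alpha_{4i-3}\cos \alpha_{4i}),$$ $$A(\xi,\theta)=\begin{pmatrix}1&-1/\tan\xi\\0&1/\sin\xi\end{pmatrix}\begin{pmatrix}\cos\theta&\sin\theta\\-\sin\theta&\cos\theta\end{pmatrix},\qquad K_j=\begin{pmatrix}\frac{\sin\alpha_{4j-3}}{\sin\alpha_{4j+2}}&0\\0&\frac{\sin\alpha_{4j}}{\sin\alpha_{4j+3}}\end{pmatrix},$$ $$f_{i+1}(t)=A^{-1}(\xi_{i+1},\theta)\Big(\prod_{j=1}^{i}K_j\Big)A(\xi_1,\theta)f_1(t),$$ $$\eta_1=\arccos\frac{\cos \alpha_{4i}-\cos \alpha_{4i-3} \cos \xi_i}{\sin \alpha_{4i-3} \sin \xi_i},\quad \eta_2=\arccos\frac{\cos \alpha_{4i+3}-\cos \alpha_{4i+2} \cos \xi_{i+1}}{\sin \alpha_{4i+2} \sin \xi_{i+1}},$$ $$\cos\phi_i=-\cos\eta_1\cos\eta_2-\sin\eta_1\sin\eta_2\cos(\alpha_{4i-3}+\alpha_{4i+2}).$$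 Let $E_i:\mathbb R^2\to\mathbb R^3$ be the linear map $E_i(v)=x\,u_i+y\,d_i$ with $(x,y)^T=A(\xi_i,\theta)v$. (The first coordinate is along the upper creases; the alternative with the two diagonal entries of $K_j$ interchanged is obtained by exchanging up and down.) Let $\Gamma:[a,b]\to\mathbb R^3$ (datum curve) and $f_1:[c,d]\to\mathbb R^2$ (target curve) be continuous, $t_0\in[c,d]$ (the parameter at which the columns cross the datum row) and $\theta\in\mathbb R$. A *design with accuracy $\epsilon_1$* is a datum row together with a partition of $[a,b]$ into $n$ consecutive nonempty intervals $J_1,\dots,J_n$ such that: * $\|\Gamma(u)-A_i\|\le\epsilon_1$ for $u\in J_i$, and $\|\Gamma(a)-A_0\|,\|\Gamma(b)-A_{n+1}\|\le\epsilon_1$; * $\overline f=A(\xi_1,\theta)f_1$ is (weakly) monotone decreasing, i.e. $(\overline x(s)-\overline x(t))(\overline y(s)-\overline y(t))\le 0$ for all $s,t$; * the design can be drawn: unfold the datum row into the plane with its sector angles and edge lengths, let $g_i(t)$ ($1\le i\le n$) be the planar point with oblique coordinates $\prod_{j<i}K_j(\overline f(t)-\overline f(t_0))$ along the unfolded upper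 and lower creases based at the unfolded $A_i$, and let $g_0,g_{n+1}$ be the translates of $g_1,g_n$ by the unfolded $-e_0$ and $e_n$. Then for $1\le i\le n-1$ and all $t$ the vector $g_{i+1}(t)-g_i(t)$ has positive inner product with the unfolded $e_i$, and the strips $\bigcup_t[g_i(t),g_{i+1}(t)]$ and $\bigcup_t[g_{i'}(t),g_{i'+1}(t)]$ are disjoint whenever $0\le i$, $i+2\le i'\le n$. For a design put $\widetilde f_u(t)=E_i(f_i(t)-f_i(t_0))$ for $u\in J_i$. We say that a paper $P$ with a folded state $q$ *realizes the design with accuracy $\epsilon$* if $P$ is a parallel repeating creased paper with the sector angles of the datum row, $q$ is a final rigidly folded state of it, and * $q_{i,j_0}=A_i$ for $0\le i\le n+1$, and the inner vertices of row $j_0$ have Hausdorff distance $\le\epsilon$ from $\Gamma([a,b])$; * each $E_i$ is isometric, $\angle(u_i,d_i)=\xi_i$, the formula for $f_i$ at $i=1$ returns the given $f_1$, the inner vertices of column $i$ lie in the plane $A_i+\operatorname{span}(u_i,d_i)$ and have Hausdorff distance $\le\epsilon$ from $A_i+E_i(f_i-f_i(t_0))([c,d])$; * the angle between the normals $u_i\times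 d_i$ and $u_{i+1}\times d_{i+1}$ of the planes of columns $i$ and $i+1$ has cosine $\cos\phi_i$ ($1\le i\le n-1$). **Proposition.** (1) For every design with accuracy $\epsilon_1<\epsilon$ there is a creased paper with a folded state that realizes it with accuracy $\epsilon$ and whose folded inner vertices have Hausdorff distance $\le\epsilon$ from the surface $\{\Gamma(u)+\widetilde f_u(t): u\in[a,b],\,t\in[c,d]\}$. (2) Let $S=\{\Gamma(u)+\widetilde f_u(t)\}$, where now $(u,t)\mapsto\widetilde f_u(t)\in\mathbb R^3$ is a continuous map on $[a,b]\times[c,d]$ that is a limit of the maps in (1): for every $\delta>0$ some design with accuracy $\delta$ has its map uniformly within $\delta$ of it. Then for every $\epsilon>0$ there are a design with accuracy $\epsilon$, whose map is uniformly within $\epsilon$ of $\widetilde f$, and a creased paper with a folded state realizing it with accuracy $\epsilon$, such that both the set of the folded inner vertices and the whole folded paper have Hausdorff distance $\le\epsilon$ from $S$. -/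

import Mathlib

/-- The Euclidean plane, in which a creased paper is drawn. -/
abbrev Plane : Type := EuclideanSpace ℝ (Fin 2)

/-- Euclidean space, in which a creased paper is folded. -/
abbrev Space : Type := EuclideanSpace ℝ (Fin 3)

noncomputable section

namespace ParallelRepeating

/-! ### Creased papers and their rigid foldings

A quadrilateral creased paper with `n` columns and `m` rows of inner vertices is given by its vertices
`P i j`, `0 ≤ i ≤ n + 1`, `0 ≤ j ≤ m + 1`. The inner vertices are those with `1 ≤ i ≤ n`,
`1 ≤ j ≤ m`. The panel `(i, j)`, `0 ≤ i ≤ n`, `0 ≤ j ≤ m`, has the four corners below. Values of `P`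
outside these ranges are irrelevant. -/

/-- The indices of the corners of the panel `(i, j)`. -/
def corners (i j : ℕ) : Set (ℕ × ℕ) := {(i, j), (i + 1, j), (i + 1, j + 1), (i, j + 1)}

/-- The panel `(i, j)` of a mesh of points. -/
def panel {E : Type*} [AddCommGroup E] [Module ℝ E] (p : ℕ → ℕ → E) (i j : ℕ) : Set E :=
  convexHull ℝ ((fun k : ℕ × ℕ => p k.1 k.2) '' corners i j)

/-- The union of all panels. -/
def region {E : Type*} [AddCommGroup E] [Module ℝ E] (n m : ℕ) (p : ℕ → ℕ → E) : Set E :=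
  {x | ∃ i ≤ n, ∃ j ≤ m, x ∈ panel p i j}

/-- The set of the inner vertices. -/
def innerVertices (n m : ℕ) (q : ℕ → ℕ → Space) : Set Space :=
  {x | ∃ i ∈ Set.Icc 1 n, ∃ j ∈ Set.Icc 1 m, x = q i j}

/-- The set of the inner vertices of the column `i`. -/
def columnVertices (m : ℕ) (q : ℕ → ℕ → Space) (i : ℕ) : Set Space :=
  {x | ∃ j ∈ Set.Icc 1 m, x = q i j}

/-- The set of the inner vertices of the row `j`. -/
def rowVertices (n : ℕ) (q : ℕ → ℕ → Space) (j : ℕ) : Set Space :=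
  {x | ∃ i ∈ Set.Icc 1 n, x = q i j}

/-- A planar creased paper: all panels are strictly convex quadrilaterals (their open diagonals cross),
and any two panels meet exactly in the face spanned by their common corners. -/
structure IsCreasedPaper (n m : ℕ) (P : ℕ → ℕ → Plane) : Prop where
  noncollinear : ∀ i ≤ n, ∀ j ≤ m, ¬ Collinear ℝ {P i j, P (i + 1) j, P (i + 1) (j + 1)}
  diagonals_cross : ∀ i ≤ n, ∀ j ≤ m,
    (openSegment ℝ (P i j) (P (i + 1) (j + 1)) ∩
      openSegment ℝ (P (i + 1) j) (P i (j + 1))).Nonempty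
  embedded : ∀ i ≤ n, ∀ j ≤ m, ∀ i' ≤ n, ∀ j' ≤ m,
    panel P i j ∩ panel P i' j' =
      convexHull ℝ ((fun k : ℕ × ℕ => P k.1 k.2) '' (corners i j ∩ corners i' j'))

/-- Sector angles of a row of vertices. At the `i`-th vertex the four angles, in this order around the
vertex, are `ne i` (between the row crease to the next vertex and the upper column crease), `nw i`
(upper column crease, row crease to the previous vertex), `sw i` (row crease to the previous vertex,
lower column crease) and `se i` (lower column crease, row crease to the next vertex). They are
`α_{4i-3}`, `α_{4i-2}`, `α_{4i-1}`, `α_{4i}`. -/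
structure SectorAngles where
  ne : ℕ → ℝ
  nw : ℕ → ℝ
  sw : ℕ → ℝ
  se : ℕ → ℝ

/-- The developable parallel repeating type: the rows `j₀, j₀ ± 2, …` carry the given sector angles,
and the rows `j₀ ± 1, j₀ ± 3, …` carry their supplements (with up and down exchanged, so that the row
creases between two neighbouring columns are parallel). -/
structure IsParallelRepeating (n m : ℕ) (P : ℕ → ℕ → Plane) (σ : SectorAngles) (j₀ : ℕ) :
    Prop where
  mem_Ioo : ∀ i ∈ Set.Icc 1 n, σ.ne i ∈ Set.Ioo 0 Real.pi ∧ σ.nw i ∈ Set.Ioo 0 Real.pi ∧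
    σ.sw i ∈ Set.Ioo 0 Real.pi ∧ σ.se i ∈ Set.Ioo 0 Real.pi
  developable : ∀ i ∈ Set.Icc 1 n, σ.ne i + σ.nw i + σ.sw i + σ.se i = 2 * Real.pi
  not_cross : ∀ i ∈ Set.Icc 1 n,
    ¬ (σ.ne i + σ.nw i = Real.pi ∧ σ.ne i + σ.se i = Real.pi)
  angle_ne : ∀ i ∈ Set.Icc 1 n, ∀ j ∈ Set.Icc 1 m,
    EuclideanGeometry.angle (P (i + 1) j) (P i j) (P i (j + 1)) =
      if Even (j + j₀) then σ.ne i else Real.pi - σ.se i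
  angle_nw : ∀ i ∈ Set.Icc 1 n, ∀ j ∈ Set.Icc 1 m,
    EuclideanGeometry.angle (P (i - 1) j) (P i j) (P i (j + 1)) =
      if Even (j + j₀) then σ.nw i else Real.pi - σ.sw i
  angle_sw : ∀ i ∈ Set.Icc 1 n, ∀ j ∈ Set.Icc 1 m,
    EuclideanGeometry.angle (P (i - 1) j) (P i j) (P i (j - 1)) =
      if Even (j + j₀) then σ.sw i else Real.pi - σ.nw i
  angle_se : ∀ i ∈ Set.Icc 1 n, ∀ j ∈ Set.Icc 1 m,
    EuclideanGeometry.angle (P (i + 1) j) (P i j) (P i (j - 1)) =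
      if Even (j + j₀) then σ.se i else Real.pi - σ.ne i

/-- A rigidly folded state: every panel is moved rigidly, i.e. the mutual distances of its four
corners are those in the plane. -/
def IsFoldedState (n m : ℕ) (P : ℕ → ℕ → Plane) (q : ℕ → ℕ → Space) : Prop :=
  ∀ i ≤ n, ∀ j ≤ m, ∀ k ∈ corners i j, ∀ l ∈ corners i j,
    dist (q k.1 k.2) (q l.1 l.2) = dist (P k.1 k.2) (P l.1 l.2)

/-- The component of `v` orthogonal to `w`. -/
def orthPart (w v : Space) : Space := v - (inner ℝ v w / inner ℝ w w) • w

/-- The dihedral angle, at the line through `p` and `p'`, between the half-planes bounded by that line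
through `x` and through `y`. The folding angle has magnitude `π - dihedral`. -/
def dihedral (p p' x y : Space) : ℝ :=
  InnerProductGeometry.angle (orthPart (p' - p) (x - p)) (orthPart (p' - p) (y - p))

/-- Dihedral angle at the inner row crease from `(i, j)` to `(i + 1, j)`, `i ≤ n`, `1 ≤ j ≤ m`. -/
def rowDihedral (q : ℕ → ℕ → Space) (i j : ℕ) : ℝ :=
  dihedral (q i j) (q (i + 1) j) (q i (j + 1)) (q i (j - 1))

/-- Dihedral angle at the inner column crease from `(i, j)` to `(i, j + 1)`, `1 ≤ i ≤ n`, `j ≤ m`. -/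
def columnDihedral (q : ℕ → ℕ → Space) (i j : ℕ) : ℝ :=
  dihedral (q i j) (q i (j + 1)) (q (i + 1) j) (q (i - 1) j)

/-- Two panels adjacent along an inner crease clash: some dihedral angle is zero (some folding angle
has magnitude `π`). -/
def Clash (n m : ℕ) (q : ℕ → ℕ → Space) : Prop :=
  (∃ i ≤ n, ∃ j ∈ Set.Icc 1 m, rowDihedral q i j = 0) ∨
    (∃ i ∈ Set.Icc 1 n, ∃ j ≤ m, columnDihedral q i j = 0)

/-- A rigid folding motion of the paper `P`, over the time interval `[0, 1]`, from the planar state to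
the final rigidly folded state `q`: no adjacent panels clash before time `1`, the motion halts at time
`1` because adjacent panels clash, and the motion has one degree of freedom, i.e. every folded state
near a state of the motion (at a time `0 < τ < 1`) is congruent to a state of the motion. -/
structure IsFoldingMotion (n m : ℕ) (P : ℕ → ℕ → Plane) (q : ℕ → ℕ → Space)
    (ψ : ℝ → ℕ → ℕ → Space) : Prop where
  continuous : ∀ i ≤ n + 1, ∀ j ≤ m + 1, ContinuousOn (fun τ => ψ τ i j) (Set.Icc 0 1)
  folded : ∀ τ ∈ Set.Icc (0 : ℝ) 1, IsFoldedState n m P (ψ τ)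
  planar : ∃ g : Plane →ᵃⁱ[ℝ] Space, ∀ i ≤ n + 1, ∀ j ≤ m + 1, ψ 0 i j = g (P i j)
  final : ∀ i ≤ n + 1, ∀ j ≤ m + 1, ψ 1 i j = q i j
  no_clash : ∀ τ ∈ Set.Ico (0 : ℝ) 1, ¬ Clash n m (ψ τ)
  clash : Clash n m q
  one_dof : ∀ τ ∈ Set.Ioo (0 : ℝ) 1, ∃ δ > 0, ∀ q' : ℕ → ℕ → Space, IsFoldedState n m P q' →
    (∀ i ≤ n + 1, ∀ j ≤ m + 1, dist (q' i j) (ψ τ i j) < δ) →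
    ∃ τ' ∈ Set.Ioo (0 : ℝ) 1, ∃ g : Space ≃ᵃⁱ[ℝ] Space,
      ∀ i ≤ n + 1, ∀ j ≤ m + 1, q' i j = g (ψ τ' i j)

/-! ### The datum row -/

/-- The datum row at the final state: the polyline `A 0, …, A (n + 1)`, and at the vertices
`A 1, …, A n` the directions `u i` of the upper and `d i` of the lower column creases. -/
structure Row where
  A : ℕ → Space
  u : ℕ → Space
  d : ℕ → Space

/-- The edge `A i A (i + 1)` of the polyline. -/
def Row.edge (R : Row) (i : ℕ) : Space := R.A (i + 1) - R.A i

/-- The sector angles of the row. -/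
def Row.angles (R : Row) : SectorAngles where
  ne i := InnerProductGeometry.angle (R.edge i) (R.u i)
  nw i := InnerProductGeometry.angle (-R.edge (i - 1)) (R.u i)
  sw i := InnerProductGeometry.angle (-R.edge (i - 1)) (R.d i)
  se i := InnerProductGeometry.angle (R.edge i) (R.d i)

/-- The row is a row of `n` inner vertices of a developable paper in its final rigidly folded state. The
first vertex is of the "straight-line" type, its left row crease is completely folded and the
folding angle of its right row crease lies strictly between `0` and `π`. The other vertices are flat-foldable.
In every panel between two neighbouring columns the column creases leave to the same side of the
row crease. -/
structure IsDatumRow (n : ℕ) (R : Row) : Prop where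
  unit_u : ∀ i ∈ Set.Icc 1 n, ‖R.u i‖ = 1
  unit_d : ∀ i ∈ Set.Icc 1 n, ‖R.d i‖ = 1
  noncollinear : ∀ i ∈ Set.Icc 1 n, ¬ Collinear ℝ {R.A (i - 1), R.A i, R.A (i + 1)}
  mem_Ioo : ∀ i ∈ Set.Icc 1 n,
    R.angles.ne i ∈ Set.Ioo 0 Real.pi ∧ R.angles.nw i ∈ Set.Ioo 0 Real.pi ∧
    R.angles.sw i ∈ Set.Ioo 0 Real.pi ∧ R.angles.se i ∈ Set.Ioo 0 Real.pi
  upper_panel : ∀ i, 1 ≤ i → i + 1 ≤ n →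
    ∃ x y : ℝ, 0 < y ∧ R.u (i + 1) = x • R.edge i + y • R.u i
  lower_panel : ∀ i, 1 ≤ i → i + 1 ≤ n →
    ∃ x y : ℝ, 0 < y ∧ R.d (i + 1) = x • R.edge i + y • R.d i
  straight : R.angles.ne 1 + R.angles.se 1 = Real.pi ∧ R.angles.nw 1 + R.angles.sw 1 = Real.pi
  left_clash : dihedral (R.A 0) (R.A 1) (R.A 1 + R.u 1) (R.A 1 + R.d 1) = 0
  right_fold : dihedral (R.A 1) (R.A 2) (R.A 1 + R.u 1) (R.A 1 + R.d 1) ∈ Set.Ioo 0 Real.pi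
  flat_foldable : ∀ i ∈ Set.Icc 2 n,
    R.angles.ne i + R.angles.sw i = Real.pi ∧ R.angles.nw i + R.angles.se i = Real.pi

/-- The row approximates the datum curve `Γ : [a, b] → ℝ³` with accuracy `ε₁`: the interval is
partitioned into `n` consecutive nonempty cells, `idx u` being the index of the cell of `u`, and the
part of `Γ` over the `i`-th cell stays within `ε₁` of `A i`; the end points are also within `ε₁`. -/
structure ApproximatesDatum (Γ : ℝ → Space) (a b : ℝ) (n : ℕ) (R : Row) (idx : ℝ → ℕ) (ε₁ : ℝ) :
    Prop where
  monotone : MonotoneOn idx (Set.Icc a b)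
  image_eq : idx '' Set.Icc a b = Set.Icc 1 n
  dist_le : ∀ u ∈ Set.Icc a b, dist (Γ u) (R.A (idx u)) ≤ ε₁
  dist_left : dist (Γ a) (R.A 0) ≤ ε₁
  dist_right : dist (Γ b) (R.A (n + 1)) ≤ ε₁

/-! ### The explicit formulas -/

open Matrix in
/-- The affine matrix `A(ξ, θ)`. -/
def affineMatrix (ξ θ : ℝ) : Matrix (Fin 2) (Fin 2) ℝ :=
  !![1, -(1 / Real.tan ξ); 0, 1 / Real.sin ξ] *
    !![Real.cos θ, Real.sin θ; -Real.sin θ, Real.cos θ]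

namespace SectorAngles

variable (σ : SectorAngles)

/-- The angles `ξ_i`, `i ≥ 1`, from the recursion (the value at `0` is not used). -/
def xi : ℕ → ℝ
  | 0 => 0
  | 1 => |2 * σ.nw 1 - Real.pi|
  | (i + 2) => Real.arccos
      (Real.cos (σ.nw (i + 2)) * Real.cos (σ.sw (i + 2)) +
        Real.sin (σ.nw (i + 2)) * Real.sin (σ.sw (i + 2)) /
          (Real.sin (σ.ne (i + 1)) * Real.sin (σ.se (i + 1))) *
          (Real.cos (xi (i + 1)) - Real.cos (σ.ne (i + 1)) * Real.cos (σ.se (i + 1))))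

/-- `k₁`, with index `j`. -/
def k₁ (j : ℕ) : ℝ := Real.sin (σ.ne j) / Real.sin (σ.nw (j + 1))

/-- `k₂`, with index `j`. -/
def k₂ (j : ℕ) : ℝ := Real.sin (σ.se j) / Real.sin (σ.sw (j + 1))

/-- The product of the matrices `diag(k₁, k₂)` over `j = 1, …, i`. -/
def diagProd : ℕ → Matrix (Fin 2) (Fin 2) ℝ
  | 0 => 1
  | (i + 1) => diagProd i * Matrix.diagonal ![σ.k₁ (i + 1), σ.k₂ (i + 1)]

/-- The linear map `A⁻¹(ξ_i, θ) ∏_{j < i} diag(k₁, k₂) A(ξ₁, θ)`, for `i ≥ 1`. -/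
def columnMatrix (θ : ℝ) (i : ℕ) : Matrix (Fin 2) (Fin 2) ℝ :=
  (affineMatrix (σ.xi i) θ)⁻¹ * σ.diagProd (i - 1) * affineMatrix (σ.xi 1) θ

/-- The target curve `f_i` of the column `i ≥ 1`, when the first one is `f`. -/
def targetCurve (θ : ℝ) (f : ℝ → Plane) (i : ℕ) (t : ℝ) : Plane :=
  WithLp.toLp 2 ((σ.columnMatrix θ i).mulVec (f t).ofLp)

def eta₁ (i : ℕ) : ℝ := Real.arccos
  ((Real.cos (σ.se i) - Real.cos (σ.ne i) * Real.cos (σ.xi i)) /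
    (Real.sin (σ.ne i) * Real.sin (σ.xi i)))

def eta₂ (i : ℕ) : ℝ := Real.arccos
  ((Real.cos (σ.sw (i + 1)) - Real.cos (σ.nw (i + 1)) * Real.cos (σ.xi (i + 1))) /
    (Real.sin (σ.nw (i + 1)) * Real.sin (σ.xi (i + 1))))

/-- The expression for `cos φ_i`. -/
def cosPhi (i : ℕ) : ℝ :=
  -(Real.cos (σ.eta₁ i) * Real.cos (σ.eta₂ i)) -
    Real.sin (σ.eta₁ i) * Real.sin (σ.eta₂ i) * Real.cos (σ.ne i + σ.nw (i + 1))

end SectorAngles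

/-- The coordinates `f̄ = A(ξ₁, θ) f` of the target curve, along the upper and the lower crease of the
first column. -/
def sheared (R : Row) (θ : ℝ) (f : ℝ → Plane) (t : ℝ) : Fin 2 → ℝ :=
  (affineMatrix (R.angles.xi 1) θ).mulVec (f t).ofLp

/-- The curve `f̄` is monotone decreasing: along it, the second coordinate is a (weakly) decreasing
relation of the first one. -/
def IsDecreasing (R : Row) (θ : ℝ) (f : ℝ → Plane) (c d : ℝ) : Prop :=
  ∀ s ∈ Set.Icc c d, ∀ t ∈ Set.Icc c d,
    (sheared R θ f s 0 - sheared R θ f t 0) * (sheared R θ f s 1 - sheared R θ f t 1) ≤ 0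

/-- The placement in space of the plane of `f_i`: the oblique crease coordinates `A(ξ_i, θ) v` of a
vector `v` are taken along the creases `u i` and `d i`. -/
def place (R : Row) (θ : ℝ) (i : ℕ) (v : Plane) : Space :=
  ((affineMatrix (R.angles.xi i) θ).mulVec v.ofLp 0) • R.u i +
    ((affineMatrix (R.angles.xi i) θ).mulVec v.ofLp 1) • R.d i

/-- The curve `f_i` placed in space, based at its point on the datum row, which has parameter `t₀`. -/
def placedCurve (R : Row) (θ : ℝ) (f : ℝ → Plane) (t₀ : ℝ) (i : ℕ) (t : ℝ) : Space :=
  place R θ i (R.angles.targetCurve θ f i t - R.angles.targetCurve θ f i t₀)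

/-- The normal of the plane of the column `i`. -/
def columnNormal (R : Row) (i : ℕ) : Space :=
  WithLp.toLp 2 (crossProduct (R.u i).ofLp (R.d i).ofLp)

/-! ### The planar drawing -/

/-- The unit vector of direction `x`. -/
def unitVec (x : ℝ) : Plane := !₂[Real.cos x, Real.sin x]

/-- Direction of the unfolded row crease `A i A (i + 1)`. -/
def drawnRowAngle (σ : SectorAngles) : ℕ → ℝ
  | 0 => 0
  | (i + 1) => drawnRowAngle σ i + Real.pi - σ.ne (i + 1) - σ.nw (i + 1)

/-- The vertices of the unfolded datum row. -/
def drawnVertex (R : Row) : ℕ → Plane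
  | 0 => 0
  | (i + 1) => drawnVertex R i + dist (R.A i) (R.A (i + 1)) • unitVec (drawnRowAngle R.angles i)

/-- The planar curve that the unfolded column `i`, `1 ≤ i ≤ n`, follows: its crease coordinates are
`∏_{j < i} diag(k₁, k₂) (f̄(t) - f̄(t₀))`. -/
def innerColumn (R : Row) (θ : ℝ) (f : ℝ → Plane) (t₀ : ℝ) (i : ℕ) (t : ℝ) : Plane :=
  drawnVertex R i +
    ((R.angles.diagProd (i - 1)).mulVec (sheared R θ f t - sheared R θ f t₀) 0) •
      unitVec (drawnRowAngle R.angles i + R.angles.ne i) +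
    ((R.angles.diagProd (i - 1)).mulVec (sheared R θ f t - sheared R θ f t₀) 1) •
      unitVec (drawnRowAngle R.angles i - R.angles.se i)

/-- The same, together with the two border columns `0` and `n + 1`, which are translates of the
columns `1` and `n` in the directions of the first and the last row crease. -/
def drawnColumn (n : ℕ) (R : Row) (θ : ℝ) (f : ℝ → Plane) (t₀ : ℝ) (i : ℕ) (t : ℝ) : Plane :=
  if i = 0 then innerColumn R θ f t₀ 1 t - (drawnVertex R 1 - drawnVertex R 0)
  else if i = n + 1 then innerColumn R θ f t₀ n t + (drawnVertex R (n + 1) - drawnVertex R n)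
  else innerColumn R θ f t₀ i t

/-- The strip of the plane between the unfolded columns `i` and `i + 1`. -/
def drawnStrip (n : ℕ) (R : Row) (θ : ℝ) (f : ℝ → Plane) (c d t₀ : ℝ) (i : ℕ) : Set Plane :=
  {x | ∃ t ∈ Set.Icc c d,
    x ∈ segment ℝ (drawnColumn n R θ f t₀ i t) (drawnColumn n R θ f t₀ (i + 1) t)}

/-- The design can be drawn in the plane: neighbouring columns do not meet (the row crease from one to
the next keeps its direction) and strips that are not neighbours do not overlap. -/
structure IsDrawable (n : ℕ) (R : Row) (θ : ℝ) (f : ℝ → Plane) (c d t₀ : ℝ) : Prop where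
  columns : ∀ i, 1 ≤ i → i + 1 ≤ n → ∀ t ∈ Set.Icc c d,
    0 < inner ℝ (drawnColumn n R θ f t₀ (i + 1) t - drawnColumn n R θ f t₀ i t)
      (unitVec (drawnRowAngle R.angles i))
  strips : ∀ i i', i + 2 ≤ i' → i' ≤ n →
    Disjoint (drawnStrip n R θ f c d t₀ i) (drawnStrip n R θ f c d t₀ i')

/-! ### The design and what it realizes -/

/-- The choices made in the design, with accuracy `ε₁` for the datum curve: a datum row that
approximates `Γ`, for which the target curve `f` is admissible, and which can be drawn. -/
structure IsDesign (Γ : ℝ → Space) (a b : ℝ) (f : ℝ → Plane) (c d t₀ θ : ℝ)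
    (n : ℕ) (R : Row) (idx : ℝ → ℕ) (ε₁ : ℝ) : Prop where
  datumRow : IsDatumRow n R
  approximates : ApproximatesDatum Γ a b n R idx ε₁
  decreasing : IsDecreasing R θ f c d
  drawable : IsDrawable n R θ f c d t₀

/-- The paper `P` with final folded state `q` realizes the design with accuracy `ε`. -/
structure Realizes (Γ : ℝ → Space) (a b : ℝ) (f : ℝ → Plane) (c d t₀ θ : ℝ) (n : ℕ) (R : Row)
    (m j₀ : ℕ) (P : ℕ → ℕ → Plane) (q : ℕ → ℕ → Space) (ε : ℝ) : Prop where
  /-- `P` is a creased paper of the parallel repeating type with the sector angles of the datum row. -/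
  paper : IsCreasedPaper n m P
  datum_index : j₀ ∈ Set.Icc 1 m
  parallelRepeating : IsParallelRepeating n m P R.angles j₀
  /-- `q` is its final rigidly folded state. -/
  motion : ∃ ψ : ℝ → ℕ → ℕ → Space, IsFoldingMotion n m P q ψ
  /-- The row `j₀` is the datum row and approximates `Γ`. -/
  row : ∀ i ≤ n + 1, q i j₀ = R.A i
  row_close : Metric.hausdorffEDist (rowVertices n q j₀) (Γ '' Set.Icc a b) ≤ ENNReal.ofReal ε
  /-- The planes of the target curves are placed isometrically, the creases of the column `i`
  enclosing the angle `ξ_i`, and `f_1` is the given target curve. -/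
  place_norm : ∀ i ∈ Set.Icc 1 n, ∀ v : Plane, ‖place R θ i v‖ = ‖v‖
  crease_angle : ∀ i ∈ Set.Icc 1 n, InnerProductGeometry.angle (R.u i) (R.d i) = R.angles.xi i
  first_curve : R.angles.targetCurve θ f 1 = f
  /-- The inner vertices of each column lie in the plane of that column and approximate `f_i`. -/
  column_planar : ∀ i ∈ Set.Icc 1 n, ∀ j ∈ Set.Icc 1 m,
    q i j - R.A i ∈ Submodule.span ℝ {R.u i, R.d i}
  column_close : ∀ i ∈ Set.Icc 1 n,
    Metric.hausdorffEDist (columnVertices m q i)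
      ((fun t => R.A i + placedCurve R θ f t₀ i t) '' Set.Icc c d) ≤ ENNReal.ofReal ε
  /-- The planes of consecutive columns enclose the angle `φ_i`. -/
  plane_angle : ∀ i, 1 ≤ i → i + 1 ≤ n →
    Real.cos (InnerProductGeometry.angle (columnNormal R i) (columnNormal R (i + 1))) =
      R.angles.cosPhi i

/-- The surface `r(u, t) = Γ(u) + F(u, t)`, `(u, t) ∈ [a, b] × [c, d]`. -/
def surface (Γ : ℝ → Space) (F : ℝ → ℝ → Space) (a b c d : ℝ) : Set Space :=
  {x | ∃ u ∈ Set.Icc a b, ∃ t ∈ Set.Icc c d, x = Γ u + F u t}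

end ParallelRepeating

end

/-!
The paper is drawn, and folded, as a mesh generated by one row. In the drawing, and in every folded
state that matters, the vertices are `A i + x j • U i + y j • D i`, where `A` is the datum row, `U i`
and `D i` are the upper and lower creases of column `i`, scaled so that neighbouring ones differ by a
multiple of the row crease between them, and `(x j, y j)` is a staircase, the same for all columns
(`IsRowModel`, `mesh`, `IsStaircase`). All panels are trapezoids whose shape depends only on the sector
angles, the edge lengths and the staircase; hence any two placements of a row with the same sector
angles give meshes with congruent panels (`IsRowModel.dist_corners`). A staircase can follow a
decreasing target curve as closely as desired (`exists_staircase`), and a fine one keeps the drawing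
embedded (`exists_accuracy_isCreasedPaper`): the panels of a strip are separated by their height above
the row, neighbouring strips by the staircase between them, on whose two sides certain determinants
have opposite signs, and strips that are not neighbours have positive distance by compactness.

The geometry of the final state follows from the spherical law of cosines at each vertex: the dihedral
angle is the same at all row creases right of the straight-line vertex (`IsDatumRow.inner_ud`), which
gives the angles `ξ i` and `φ i` and the planes of the columns.

For the folding motion, an orthonormal frame is carried along the row. At the straight-line vertex the
parameter is half the length `h` of the sum of its two unit column creases, from `0` in the plane to
`sin (nw 1)`, when the left row crease is closed; at a flat-foldable vertex the next frame is a rational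
function (`Frame.step`) of the sine and the cosine of half the dihedral angle, with a sign for the two
ways of folding the vertex. Since `sin (nw 1) < sin (ne 1)`, nothing else closes before the end
(`IsFoldable.not_clash`). At `h = 0` this is the drawing (`IsDatumRow.foldMesh_flat`), and at the end
it is the datum row, since a row is determined by its first vertex and these signs, a unit vector being
determined by two inner products and the sign of a determinant (`eq_of_inner_eq`,
`IsFoldable.rowModel_eq`).

The same principle gives the single degree of freedom. In a rigidly folded state the row creases of a
strip stay parallel, and near the motion all edges of the first column take one of two directions;
hence the state is again generated by a row (`IsFoldedState.exists_rowModel`), and so it is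
congruent to a state of the motion (`IsNear.exists_foldMesh`). The distance estimates follow by
comparing the vertices with the placed curves (`IsDesign.exists_realizes`); for the whole paper,
two consecutive cells of the partition contain nearly equal parameters
(`ApproximatesDatum.exists_adjacent`), so that both sides of a panel are close to one point of the surface.
-/

noncomputable section

namespace ParallelRepeating

/-! ### Row models and the meshes they generate -/

section RowModel

variable {V W : Type*} [NormedAddCommGroup V] [InnerProductSpace ℝ V]
  [NormedAddCommGroup W] [InnerProductSpace ℝ W]

/-- The factor by which the steps along the creases of column `1` are multiplied in column `i`;
`al` and `be` are the sector angles on the right and on the left of the creases considered. -/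
def scale (al be : ℕ → ℝ) (i : ℕ) : ℝ :=
  ∏ k ∈ Finset.range (i - 1), (Real.sin (al (k + 1)) / Real.sin (be (k + 2)))

/-- The change of the length of the row crease `i` per unit step along the crease of column `1`. It
vanishes for the two border strips, whose sides are parallel. -/
def shear (n : ℕ) (al be : ℕ → ℝ) (i : ℕ) : ℝ :=
  if 1 ≤ i ∧ i < n then
    scale al be i * (Real.sin (al i + be (i + 1)) / Real.sin (be (i + 1)))
  else 0

/-- The angle between the row crease `i` and the column crease at its left end. The border column `0`
is parallel to the column `1`. -/
def startAngle (al be : ℕ → ℝ) (i : ℕ) : ℝ := if i = 0 then Real.pi - be 1 else al i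

/-- The scaled column creases `U i` on one side of a row with unit directions `e i`: consecutive ones
differ by a multiple of the row direction, and their inclination to the row is prescribed. -/
structure IsCreaseChain (n : ℕ) (al be : ℕ → ℝ) (e U : ℕ → V) : Prop where
  succ : ∀ i ≤ n, U (i + 1) = U i - shear n al be i • e i
  norm_eq : ∀ i ≤ n, ‖U i‖ = scale al be i
  inner_eq : ∀ i ≤ n, inner ℝ (e i) (U i) = scale al be i * Real.cos (startAngle al be i)

/-- A placement, in any inner product space, of a row of vertices `A i` with edge lengths `L i`, unit
edge directions `e i` and scaled upper and lower creases `U i`, `D i`, with the sector angles `σ`. -/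
structure IsRowModel (n : ℕ) (σ : SectorAngles) (L : ℕ → ℝ) (A e U D : ℕ → V) : Prop where
  succ : ∀ i ≤ n, A (i + 1) = A i + L i • e i
  unit : ∀ i ≤ n, ‖e i‖ = 1
  upper : IsCreaseChain n σ.ne σ.nw e U
  lower : IsCreaseChain n σ.se σ.sw e D

/-- The mesh obtained by translating the row along its creases by the coordinates `(x j, y j)`. -/
def mesh (A U D : ℕ → V) (x y : ℕ → ℝ) (i j : ℕ) : V := A i + x j • U i + y j • D i

/-- The length of the row crease from `(i, j)` to `(i + 1, j)` of a mesh. -/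
def rung (n : ℕ) (σ : SectorAngles) (L x y : ℕ → ℝ) (i j : ℕ) : ℝ :=
  L i - x j * shear n σ.ne σ.nw i - y j * shear n σ.se σ.sw i

/-- Crease coordinates of the vertices of a column: starting from the row `j₀`, the upper coordinate
increases and the lower one decreases, in turn. -/
structure IsStaircase (j₀ : ℕ) (x y : ℕ → ℝ) : Prop where
  x_zero : x j₀ = 0
  y_zero : y j₀ = 0
  even_step : ∀ j, Even (j + j₀) → x j < x (j + 1) ∧ y (j + 1) = y j
  odd_step : ∀ j, ¬ Even (j + j₀) → x (j + 1) = x j ∧ y (j + 1) < y j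

variable {n : ℕ} {σ : SectorAngles} {L x y : ℕ → ℝ} {j₀ : ℕ}
  {A e U D : ℕ → V} {A' e' U' D' : ℕ → W}

theorem scale_zero (al be : ℕ → ℝ) : scale al be 0 = 1 := by simp [scale]

theorem scale_one (al be : ℕ → ℝ) : scale al be 1 = 1 := by simp [scale]

theorem scale_succ (al be : ℕ → ℝ) {i : ℕ} (hi : 1 ≤ i) :
    scale al be (i + 1) = scale al be i * (Real.sin (al i) / Real.sin (be (i + 1))) := by
  obtain ⟨k, rfl⟩ : ∃ k, i = k + 1 := ⟨i - 1, by omega⟩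
  exact Finset.prod_range_succ _ _

theorem scale_pos {al be : ℕ → ℝ}
    (hal : ∀ i ∈ Set.Icc 1 n, al i ∈ Set.Ioo 0 Real.pi)
    (hbe : ∀ i ∈ Set.Icc 1 n, be i ∈ Set.Ioo 0 Real.pi) {i : ℕ} (hi : i ≤ n) :
    0 < scale al be i := by
  refine Finset.prod_pos fun k hk => ?_
  rw [Finset.mem_range] at hk
  exact div_pos (Real.sin_pos_of_mem_Ioo (hal _ ⟨by omega, by omega⟩))
    (Real.sin_pos_of_mem_Ioo (hbe _ ⟨by omega, by omega⟩))

theorem shear_zero (n : ℕ) (al be : ℕ → ℝ) : shear n al be 0 = 0 := by simp [shear]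

theorem shear_last (n : ℕ) (al be : ℕ → ℝ) : shear n al be n = 0 := by simp [shear]

theorem rung_zero (n : ℕ) (σ : SectorAngles) (L x y : ℕ → ℝ) (j : ℕ) :
    rung n σ L x y 0 j = L 0 := by simp [rung, shear_zero]

theorem IsStaircase.rung_base (h : IsStaircase j₀ x y) (i : ℕ) :
    rung n σ L x y i j₀ = L i := by simp [rung, h.x_zero, h.y_zero]

theorem IsStaircase.mesh_base (h : IsStaircase j₀ x y) (i : ℕ) :
    mesh A U D x y i j₀ = A i := by simp [mesh, h.x_zero, h.y_zero]

theorem IsStaircase.x_mono (h : IsStaircase j₀ x y) : Monotone x :=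
  monotone_nat_of_le_succ fun j => by
    by_cases hj : Even (j + j₀)
    · exact (h.even_step j hj).1.le
    · exact (h.odd_step j hj).1.ge

theorem IsStaircase.y_anti (h : IsStaircase j₀ x y) : Antitone y :=
  antitone_nat_of_succ_le fun j => by
    by_cases hj : Even (j + j₀)
    · exact (h.even_step j hj).2.le
    · exact (h.odd_step j hj).2.le

theorem IsRowModel.mesh_succ (h : IsRowModel n σ L A e U D) {i : ℕ} (hi : i ≤ n) (j : ℕ) :
    mesh A U D x y (i + 1) j = mesh A U D x y i j + rung n σ L x y i j • e i := by
  simp only [mesh, rung, h.succ i hi, h.upper.succ i hi, h.lower.succ i hi]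
  module

/-- Unit creases with the right sector angles, such that in every panel neighbouring ones differ by a
vector of the row direction, become a crease chain after scaling. -/
theorem IsCreaseChain.of_unit {al be : ℕ → ℝ} {e u : ℕ → V} (hn : 1 ≤ n)
    (hal : ∀ i ∈ Set.Icc 1 n, al i ∈ Set.Ioo 0 Real.pi)
    (hbe : ∀ i ∈ Set.Icc 1 n, be i ∈ Set.Ioo 0 Real.pi)
    (hu : ∀ i ∈ Set.Icc 1 n, ‖u i‖ = 1)
    (hl : inner ℝ (e 0) (u 1) = - Real.cos (be 1))
    (hr : ∀ i ∈ Set.Icc 1 n, inner ℝ (e i) (u i) = Real.cos (al i))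
    (hp : ∀ i, 1 ≤ i → i + 1 ≤ n →
      Real.sin (be (i + 1)) • u i - Real.sin (al i) • u (i + 1) =
        Real.sin (al i + be (i + 1)) • e i) :
    IsCreaseChain n al be e
      (fun i => scale al be (max 1 (min i n)) • u (max 1 (min i n))) where
  succ i hi := by
    rcases Nat.eq_zero_or_pos i with rfl | h0
    · have h1 : min 1 n = 1 := by omega
      simp [shear_zero, h1]
    rcases eq_or_lt_of_le hi with rfl | h1
    · have h1 : max 1 i = i := by omega
      simp [shear_last, h1]
    have h2 : max 1 (min i n) = i := by omega
    have h3 : max 1 (min (i + 1) n) = i + 1 := by omega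
    have hs : Real.sin (be (i + 1)) ≠ 0 :=
      (Real.sin_pos_of_mem_Ioo (hbe (i + 1) ⟨by omega, by omega⟩)).ne'
    simp only [h2, h3, scale_succ al be h0, shear, if_pos (show 1 ≤ i ∧ i < n from ⟨h0, h1⟩)]
    have := congrArg (fun v => (scale al be i / Real.sin (be (i + 1))) • v) (hp i h0 h1)
    simp only [smul_sub, smul_smul] at this
    rw [div_mul_cancel₀ _ hs] at this
    rw [mul_div_assoc', mul_div_assoc', ← div_mul_eq_mul_div, ← div_mul_eq_mul_div, ← this]
    abel
  norm_eq i hi := by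
    have h2 : max 1 (min i n) ∈ Set.Icc 1 n := ⟨by omega, by omega⟩
    rw [norm_smul, hu _ h2, mul_one, Real.norm_of_nonneg (scale_pos hal hbe h2.2).le]
    rcases Nat.eq_zero_or_pos i with rfl | h0
    · simp [scale_zero, scale_one]
    · rw [show max 1 (min i n) = i by omega]
  inner_eq i hi := by
    rcases Nat.eq_zero_or_pos i with rfl | h0
    · simp [scale_zero, scale_one, hl, startAngle, Real.cos_pi_sub]
    · rw [show max 1 (min i n) = i by omega, real_inner_smul_right, hr i ⟨h0, hi⟩, startAngle,
        if_neg h0.ne']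

theorem norm_combination_eq {v e : V} {v' e' : W} (he : ‖e‖ = ‖e'‖) (hv : ‖v‖ = ‖v'‖)
    (hev : inner ℝ e v = inner ℝ e' v') (s t : ℝ) : ‖s • e + t • v‖ = ‖s • e' + t • v'‖ := by
  have h : ‖s • e + t • v‖ ^ 2 = ‖s • e' + t • v'‖ ^ 2 := by
    rw [norm_add_sq_real, norm_add_sq_real]
    simp only [norm_smul, real_inner_smul_left, real_inner_smul_right, he, hv, hev]
  exact (sq_eq_sq₀ (norm_nonneg _) (norm_nonneg _)).1 h

/-- The edge of a mesh along the column `i`, above the row `j`. -/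
def rail (U D : ℕ → V) (x y : ℕ → ℝ) (i j : ℕ) : V :=
  (x (j + 1) - x j) • U i + (y (j + 1) - y j) • D i

theorem mesh_rail (A U D : ℕ → V) (x y : ℕ → ℝ) (i j : ℕ) :
    mesh A U D x y i (j + 1) = mesh A U D x y i j + rail U D x y i j := by
  simp only [mesh, rail]; module

theorem rail_even (h : IsStaircase j₀ x y) (U D : ℕ → V) (i : ℕ) {j : ℕ} (hj : Even (j + j₀)) :
    rail U D x y i j = (x (j + 1) - x j) • U i := by
  simp [rail, (h.even_step j hj).2]

theorem rail_odd (h : IsStaircase j₀ x y) (U D : ℕ → V) (i : ℕ) {j : ℕ} (hj : ¬ Even (j + j₀)) :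
    rail U D x y i j = (y (j + 1) - y j) • D i := by
  simp [rail, (h.odd_step j hj).1]

/-- The corners of a panel in terms of its lower left corner, its row direction and its left edge. -/
theorem IsRowModel.mesh_corner (h : IsRowModel n σ L A e U D) {i j : ℕ} (hi : i ≤ n)
    {k : ℕ × ℕ} (hk : k ∈ corners i j) :
    mesh A U D x y k.1 k.2 = mesh A U D x y i j +
      ((if k.1 = i then 0 else rung n σ L x y i k.2) • e i +
        (if k.2 = j then (0 : ℝ) else 1) • rail U D x y i j) := by
  simp only [corners, Set.mem_insert_iff, Set.mem_singleton_iff] at hk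
  rcases hk with rfl | rfl | rfl | rfl
  · simp
  · simp [h.mesh_succ hi]
  · simp [h.mesh_succ hi, mesh_rail]
    abel
  · simp [mesh_rail]

/-- Two row models with the same sector angles and edge lengths generate meshes with congruent
panels. -/
theorem IsRowModel.dist_corners (h : IsRowModel n σ L A e U D) (h' : IsRowModel n σ L A' e' U' D')
    (hxy : IsStaircase j₀ x y) {i j : ℕ} (hi : i ≤ n)
    {k l : ℕ × ℕ} (hk : k ∈ corners i j) (hl : l ∈ corners i j) :
    dist (mesh A U D x y k.1 k.2) (mesh A U D x y l.1 l.2) =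
      dist (mesh A' U' D' x y k.1 k.2) (mesh A' U' D' x y l.1 l.2) := by
  have key : ‖rail U D x y i j‖ = ‖rail U' D' x y i j‖ ∧
      inner ℝ (e i) (rail U D x y i j) = inner ℝ (e' i) (rail U' D' x y i j) := by
    by_cases hj : Even (j + j₀)
    · rw [rail_even hxy _ _ _ hj, rail_even hxy _ _ _ hj]
      simp only [norm_smul, real_inner_smul_right, h.upper.norm_eq i hi, h'.upper.norm_eq i hi,
        h.upper.inner_eq i hi, h'.upper.inner_eq i hi, and_self]
    · rw [rail_odd hxy _ _ _ hj, rail_odd hxy _ _ _ hj]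
      simp only [norm_smul, real_inner_smul_right, h.lower.norm_eq i hi, h'.lower.norm_eq i hi,
        h.lower.inner_eq i hi, h'.lower.inner_eq i hi, and_self]
  rw [h.mesh_corner hi hk, h.mesh_corner hi hl, h'.mesh_corner hi hk, h'.mesh_corner hi hl]
  simp only [dist_eq_norm, add_sub_add_left_eq_sub]
  have := norm_combination_eq ((h.unit i hi).trans (h'.unit i hi).symm) key.1 key.2
    ((if k.1 = i then 0 else rung n σ L x y i k.2) - (if l.1 = i then 0 else rung n σ L x y i l.2))
    ((if k.2 = j then 0 else 1) - (if l.2 = j then 0 else 1))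
  convert this using 1 <;> refine congrArg norm ?_ <;> module

/-- A linear map that matches the directions of two row models matches their scaled creases. -/
theorem IsRowModel.map_eq (h : IsRowModel n σ L A e U D) (h' : IsRowModel n σ L A' e' U' D')
    (g : V →ₗ[ℝ] W) (he : ∀ i ≤ n, e' i = g (e i)) (hU : U' 1 = g (U 1)) (hD : D' 1 = g (D 1))
    {i : ℕ} (hi : i ≤ n + 1) :
    U' i = g (U i) ∧ D' i = g (D i) ∧ A' i - A' 1 = g (A i - A 1) := by
  have h0 := h.succ 0 (Nat.zero_le n)
  have h0' := h'.succ 0 (Nat.zero_le n)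
  have hu0 := h.upper.succ 0 (Nat.zero_le n)
  have hu0' := h'.upper.succ 0 (Nat.zero_le n)
  have hd0 := h.lower.succ 0 (Nat.zero_le n)
  have hd0' := h'.lower.succ 0 (Nat.zero_le n)
  simp only [shear_zero, zero_smul, sub_zero, zero_add] at h0 h0' hu0 hu0' hd0 hd0'
  induction i with
  | zero =>
    refine ⟨by rw [← hu0, ← hu0', hU], by rw [← hd0, ← hd0', hD], ?_⟩
    rw [h0, h0', he 0 (Nat.zero_le n)]
    simp
  | succ i ih =>
    obtain ⟨h1, h2, h3⟩ := ih (by omega)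
    have hi' : i ≤ n := by omega
    rw [h.upper.succ i hi', h'.upper.succ i hi', h.lower.succ i hi', h'.lower.succ i hi',
      h.succ i hi', h'.succ i hi', add_sub_right_comm, add_sub_right_comm, h1, h2, h3, he i hi']
    simp

theorem IsRowModel.mesh_map_eq (h : IsRowModel n σ L A e U D)
    (h' : IsRowModel n σ L A' e' U' D')
    (g : V →ₗ[ℝ] W) (he : ∀ i ≤ n, e' i = g (e i)) (hU : U' 1 = g (U 1)) (hD : D' 1 = g (D 1))
    {i : ℕ} (hi : i ≤ n + 1) (j : ℕ) :
    mesh A' U' D' x y i j = g (mesh A U D x y i j - A 1) + A' 1 := by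
  obtain ⟨h1, h2, h3⟩ := h.map_eq h' g he hU hD hi
  rw [eq_comm, ← eq_sub_iff_add_eq]
  simp only [mesh, add_sub_right_comm _ _ (A 1), add_sub_right_comm _ _ (A' 1), map_add, map_smul,
    h1, h2, h3]

end RowModel

/-! ### Staircases along a decreasing curve -/

/-- A continuous curve whose coordinates are decreasing functions of each other is approximated by the
vertices of a staircase through its point `(0, 0)`. The difference `X - Y` serves as the parameter:
both coordinates are monotone `1`-Lipschitz functions of it. -/
theorem exists_staircase {c d t₀ : ℝ} (ht₀ : t₀ ∈ Set.Icc c d) {X Y : ℝ → ℝ}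
    (hX : ContinuousOn X (Set.Icc c d)) (hY : ContinuousOn Y (Set.Icc c d))
    (hX0 : X t₀ = 0) (hY0 : Y t₀ = 0)
    (hdec : ∀ s ∈ Set.Icc c d, ∀ t ∈ Set.Icc c d, (X s - X t) * (Y s - Y t) ≤ 0)
    {η : ℝ} (hη : 0 < η) :
    ∃ (m j₀ : ℕ) (x y : ℕ → ℝ), j₀ ∈ Set.Icc 1 m ∧ IsStaircase j₀ x y ∧
      (∀ j ≤ m, ∃ t ∈ Set.Icc c d, |x j - X t| ≤ η ∧ |y j - Y t| ≤ η ∧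
        |x (j + 1) - X t| ≤ η ∧ |y (j + 1) - Y t| ≤ η) ∧
      (∀ t ∈ Set.Icc c d, ∃ j ∈ Set.Icc 1 m, |x j - X t| ≤ η ∧ |y j - Y t| ≤ η) := by
  set S : ℝ → ℝ := fun t => X t - Y t with hS
  have hSc : ContinuousOn S (Set.Icc c d) := hX.sub hY
  have hle : ∀ s ∈ Set.Icc c d, ∀ t ∈ Set.Icc c d, S s ≤ S t → X s ≤ X t ∧ Y t ≤ Y s := by
    intro s hs t ht hst
    have h1 := hdec s hs t ht
    simp only [hS] at hst
    constructor
    · by_contra! h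
      nlinarith [sq_nonneg (X s - X t)]
    · by_contra! h
      nlinarith [sq_nonneg (Y s - Y t)]
  have hlip : ∀ s ∈ Set.Icc c d, ∀ t ∈ Set.Icc c d,
      |X s - X t| ≤ |S s - S t| ∧ |Y s - Y t| ≤ |S s - S t| := by
    have key : ∀ s ∈ Set.Icc c d, ∀ t ∈ Set.Icc c d, S s ≤ S t →
        |X s - X t| ≤ |S s - S t| ∧ |Y s - Y t| ≤ |S s - S t| := by
      intro s hs t ht hst
      obtain ⟨h1, h2⟩ := hle s hs t ht hst
      rw [abs_sub_comm (S s), abs_of_nonneg (sub_nonneg.2 hst), abs_sub_comm (X s),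
        abs_of_nonneg (sub_nonneg.2 h1), abs_of_nonneg (sub_nonneg.2 h2)]
      simp only [hS]
      constructor <;> linarith
    intro s hs t ht
    rcases le_total (S s) (S t) with h | h
    · exact key s hs t ht h
    · have := key t ht s hs h
      rwa [abs_sub_comm (X t), abs_sub_comm (Y t), abs_sub_comm (S t)] at this
  obtain ⟨t₁, ht₁, hmin⟩ := isCompact_Icc.exists_isMinOn ⟨t₀, ht₀⟩ hSc
  obtain ⟨t₂, ht₂, hmax⟩ := isCompact_Icc.exists_isMaxOn ⟨t₀, ht₀⟩ hSc
  have hmin' : ∀ t ∈ Set.Icc c d, S t₁ ≤ S t := fun t ht => hmin ht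
  have hmax' : ∀ t ∈ Set.Icc c d, S t ≤ S t₂ := fun t ht => hmax ht
  set cl : ℝ → ℝ := fun s => max (S t₁) (min (S t₂) s) with hcl
  have hclmono : Monotone cl := fun s s' h => max_le_max le_rfl (min_le_min le_rfl h)
  have hcllip : ∀ s s', |cl s - cl s'| ≤ |s - s'| := by
    intro s s'
    refine (abs_max_sub_max_le_max _ _ _ _).trans ?_
    rw [sub_self, abs_zero, max_eq_right (abs_nonneg _)]
    refine (abs_min_sub_min_le_max _ _ _ _).trans ?_
    rw [sub_self, abs_zero, max_eq_right (abs_nonneg _)]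
  have hclS : ∀ t ∈ Set.Icc c d, cl (S t) = S t := by
    intro t ht
    simp only [hcl]
    rw [min_eq_right (hmax' t ht), max_eq_right (hmin' t ht)]
  have hex : ∀ s, ∃ t ∈ Set.Icc c d, S t = cl s := by
    intro s
    have hord : (S '' Set.Icc c d).OrdConnected :=
      (isPreconnected_Icc.image S hSc).ordConnected
    exact hord.out (Set.mem_image_of_mem S ht₁) (Set.mem_image_of_mem S ht₂)
      ⟨le_max_left _ _, max_le (hmin' t₂ ht₂) (min_le_left _ _)⟩
  choose τ hτ hSτ using hex
  have hS0 : S t₀ = 0 := by simp [hS, hX0, hY0]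
  have hτ0 : X (τ 0) = 0 ∧ Y (τ 0) = 0 := by
    have h1 : S (τ 0) = S t₀ := by rw [hSτ, ← hclS t₀ ht₀, hS0]
    have h2 := hlip (τ 0) (hτ 0) t₀ ht₀
    rw [h1, sub_self, abs_zero, hX0, hY0, sub_zero, sub_zero] at h2
    exact ⟨abs_nonpos_iff.1 h2.1, abs_nonpos_iff.1 h2.2⟩
  obtain ⟨N, hN⟩ := exists_nat_ge (max |S t₁| |S t₂| / (η / 4))
  rw [div_le_iff₀ (by positivity)] at hN
  -- `h` is the mesh width in the parameter `X - Y`; the drift `κ` makes all steps strict.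
  set h : ℝ := η / 4 with hh
  set κ : ℝ := η / (4 * (N + 1)) with hκ
  have hhpos : 0 < h := by positivity
  have hκpos : 0 < κ := by positivity
  have hκN : κ * (N + 1) = η / 4 := by rw [hκ]; field_simp
  set G : ℝ → ℝ := fun s => X (τ (h * s)) + κ * s with hG
  set H : ℝ → ℝ := fun s => Y (τ (h * s)) - κ * s with hH
  have hGH : ∀ s s', s < s' → G s < G s' ∧ H s' < H s := by
    intro s s' hs
    have h1 : S (τ (h * s)) ≤ S (τ (h * s')) := by
      rw [hSτ, hSτ]; exact hclmono (mul_le_mul_of_nonneg_left hs.le hhpos.le)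
    have h2 := hle _ (hτ _) _ (hτ _) h1
    have h3 : κ * s < κ * s' := mul_lt_mul_of_pos_left hs hκpos
    simp only [hG, hH]
    constructor <;> linarith [h2.1, h2.2]
  have hnear : ∀ s s₁ : ℝ, ∀ t ∈ Set.Icc c d, S t = cl (h * s₁) → |s - s₁| ≤ 1 → |s| ≤ N + 1 →
      |G s - X t| ≤ η ∧ |H s - Y t| ≤ η := by
    intro s s₁ t ht hst hss hsN
    have h1 := hlip _ (hτ (h * s)) t ht
    rw [hSτ, hst] at h1
    have h2 : |cl (h * s) - cl (h * s₁)| ≤ h := by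
      refine (hcllip _ _).trans ?_
      rw [← mul_sub, abs_mul, abs_of_pos hhpos]
      exact mul_le_of_le_one_right hhpos.le hss
    have h3 : |κ * s| ≤ η / 4 := by
      rw [abs_mul, abs_of_pos hκpos, ← hκN]
      exact mul_le_mul_of_nonneg_left hsN hκpos.le
    have h4 := abs_le.1 h3
    have h5 := abs_le.1 (h1.1.trans h2)
    have h6 := abs_le.1 (h1.2.trans h2)
    simp only [hG, hH]
    constructor <;> rw [abs_le] <;> constructor <;> linarith
  refine ⟨4 * N + 1, 2 * N + 1, fun j => G ((j / 2 : ℕ) - N),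
    fun j => H (((j + 1) / 2 : ℕ) - 1 - N), ⟨by omega, by omega⟩, ⟨?_, ?_, ?_, ?_⟩, ?_, ?_⟩
  · simp only [show (2 * N + 1) / 2 = N by omega, sub_self, hG, mul_zero, hτ0.1, add_zero]
  · simp only [show (2 * N + 1 + 1) / 2 = N + 1 by omega, hH]
    push_cast
    simp [hτ0.2]
  · intro j hj
    obtain ⟨p, rfl⟩ : ∃ p, j = 2 * p + 1 := by
      obtain ⟨r, hr⟩ := hj
      exact ⟨j / 2, by omega⟩
    simp only [show (2 * p + 1) / 2 = p by omega, show (2 * p + 1 + 1) / 2 = p + 1 by omega,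
      show (2 * p + 1 + 1 + 1) / 2 = p + 1 by omega, and_true]
    refine (hGH _ _ ?_).1
    push_cast
    linarith
  · intro j hj
    obtain ⟨p, rfl⟩ : ∃ p, j = 2 * p := by
      rw [Nat.not_even_iff_odd] at hj
      obtain ⟨r, hr⟩ := hj
      exact ⟨j / 2, by omega⟩
    simp only [show (2 * p) / 2 = p by omega, show (2 * p + 1) / 2 = p by omega,
      show (2 * p + 1 + 1) / 2 = p + 1 by omega, true_and]
    refine (hGH _ _ ?_).2
    push_cast
    linarith
  · intro j hj
    have hp : ((j / 2 : ℕ) : ℝ) ≤ 2 * N := by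
      have : j / 2 ≤ 2 * N := by omega
      exact_mod_cast this
    have hp0 : (0 : ℝ) ≤ ((j / 2 : ℕ) : ℝ) := Nat.cast_nonneg _
    have hcase : ∀ k : ℕ, (k = j / 2 ∨ k = j / 2 + 1) →
        |((k : ℝ) - N) - ((j / 2 : ℕ) - N)| ≤ 1 ∧ |(k : ℝ) - N| ≤ N + 1 := by
      rintro k (rfl | rfl) <;> push_cast <;> constructor <;> rw [abs_le] <;> constructor <;>
        linarith
    have hcase' : ∀ k : ℕ, (k = j / 2 ∨ k = j / 2 + 1) →
        |((k : ℝ) - 1 - N) - ((j / 2 : ℕ) - N)| ≤ 1 ∧ |(k : ℝ) - 1 - N| ≤ N + 1 := by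
      rintro k (rfl | rfl) <;> push_cast <;> constructor <;> rw [abs_le] <;> constructor <;>
        linarith
    refine ⟨τ (h * ((j / 2 : ℕ) - N)), hτ _, ?_, ?_, ?_, ?_⟩
    · obtain ⟨h1, h2⟩ := hcase (j / 2) (Or.inl rfl)
      exact (hnear _ _ _ (hτ _) (hSτ _) h1 h2).1
    · obtain ⟨h1, h2⟩ := hcase' ((j + 1) / 2) (by omega)
      exact (hnear _ _ _ (hτ _) (hSτ _) h1 h2).2
    · obtain ⟨h1, h2⟩ := hcase ((j + 1) / 2) (by omega)
      exact (hnear _ _ _ (hτ _) (hSτ _) h1 h2).1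
    · obtain ⟨h1, h2⟩ := hcase' ((j + 1 + 1) / 2) (by omega)
      exact (hnear _ _ _ (hτ _) (hSτ _) h1 h2).2
  · intro t ht
    have hSt : |S t| ≤ N * h := by
      refine le_trans ?_ hN
      exact abs_le_max_abs_abs (hmin' t ht) (hmax' t ht)
    set z : ℤ := ⌊S t / h⌋ with hz
    have hz1 : (z : ℝ) ≤ S t / h := Int.floor_le _
    have hz2 : S t / h < z + 1 := Int.lt_floor_add_one _
    have hb : |S t / h| ≤ N := by
      rw [abs_div, abs_of_pos hhpos, div_le_iff₀ hhpos]; exact hSt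
    rw [abs_le] at hb
    have hzN : -(N : ℤ) ≤ z := by
      rw [hz, Int.le_floor]; push_cast; exact hb.1
    have hzN' : z ≤ N := by
      have : (z : ℝ) ≤ N := hz1.trans hb.2
      exact_mod_cast this
    obtain ⟨p, hp⟩ : ∃ p : ℕ, (p : ℤ) = z + N := ⟨(z + N).toNat, by omega⟩
    have hpz : (p : ℝ) - N = z := by
      have : (p : ℝ) = z + N := by exact_mod_cast hp
      linarith
    have hnn : |(z : ℝ) - S t / h| ≤ 1 ∧ |(z : ℝ)| ≤ N + 1 := by
      have h1 : -(N : ℝ) ≤ z := by exact_mod_cast hzN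
      have h2 : (z : ℝ) ≤ N := by exact_mod_cast hzN'
      constructor <;> rw [abs_le] <;> constructor <;> linarith
    have hst : S t = cl (h * (S t / h)) := by
      rw [mul_div_cancel₀ _ hhpos.ne', hclS t ht]
    refine ⟨2 * p + 1, ⟨by omega, by omega⟩, ?_⟩
    simp only [show (2 * p + 1) / 2 = p by omega, show (2 * p + 1 + 1) / 2 = p + 1 by omega]
    push_cast
    rw [add_sub_cancel_right, hpz]
    exact hnear _ _ t ht hst hnn.1 hnn.2

/-! ### Sector angles of a mesh -/

section Angles

variable {V : Type*} [NormedAddCommGroup V] [InnerProductSpace ℝ V]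
variable {n m : ℕ} {σ : SectorAngles} {L x y : ℕ → ℝ} {j₀ : ℕ} {al be : ℕ → ℝ}
  {A e U D : ℕ → V}

/-- The four sector angles of the inner vertices lie strictly between `0` and `π`. -/
def AnglesMem (n : ℕ) (σ : SectorAngles) : Prop :=
  ∀ i ∈ Set.Icc 1 n, σ.ne i ∈ Set.Ioo 0 Real.pi ∧ σ.nw i ∈ Set.Ioo 0 Real.pi ∧
    σ.sw i ∈ Set.Ioo 0 Real.pi ∧ σ.se i ∈ Set.Ioo 0 Real.pi

theorem AnglesMem.ne (h : AnglesMem n σ) : ∀ i ∈ Set.Icc 1 n, σ.ne i ∈ Set.Ioo 0 Real.pi :=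
  fun i hi => (h i hi).1
theorem AnglesMem.nw (h : AnglesMem n σ) : ∀ i ∈ Set.Icc 1 n, σ.nw i ∈ Set.Ioo 0 Real.pi :=
  fun i hi => (h i hi).2.1
theorem AnglesMem.sw (h : AnglesMem n σ) : ∀ i ∈ Set.Icc 1 n, σ.sw i ∈ Set.Ioo 0 Real.pi :=
  fun i hi => (h i hi).2.2.1
theorem AnglesMem.se (h : AnglesMem n σ) : ∀ i ∈ Set.Icc 1 n, σ.se i ∈ Set.Ioo 0 Real.pi :=
  fun i hi => (h i hi).2.2.2

theorem AnglesMem.scale_upper_pos (h : AnglesMem n σ) {i : ℕ} (hi : i ≤ n) :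
    0 < scale σ.ne σ.nw i := scale_pos h.ne h.nw hi

theorem AnglesMem.scale_lower_pos (h : AnglesMem n σ) {i : ℕ} (hi : i ≤ n) :
    0 < scale σ.se σ.sw i := scale_pos h.se h.sw hi

theorem IsCreaseChain.inner_left (h : IsCreaseChain n al be e U) (he : ∀ i ≤ n, ‖e i‖ = 1)
    (hbe : ∀ i ∈ Set.Icc 1 n, be i ∈ Set.Ioo 0 Real.pi) {i : ℕ} (hi : i < n) :
    inner ℝ (e i) (U (i + 1)) = -(scale al be (i + 1) * Real.cos (be (i + 1))) := by
  have hs : Real.sin (be (i + 1)) ≠ 0 :=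
    (Real.sin_pos_of_mem_Ioo (hbe (i + 1) ⟨by omega, by omega⟩)).ne'
  rw [h.succ i hi.le, inner_sub_right, h.inner_eq i hi.le, real_inner_smul_right,
    real_inner_self_eq_norm_sq, he i hi.le]
  rcases Nat.eq_zero_or_pos i with rfl | h0
  · simp [shear_zero, startAngle, scale_zero, scale_one, Real.cos_pi_sub]
  · rw [scale_succ al be h0, startAngle, if_neg h0.ne', shear, if_pos ⟨h0, hi⟩, Real.sin_add]
    field_simp
    ring

theorem angle_eq_of_inner {v w : V} {r φ : ℝ} (hv : ‖v‖ = 1) (hw : ‖w‖ = r) (hr : 0 < r)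
    (hφ : φ ∈ Set.Ioo 0 Real.pi) (h : inner ℝ v w = r * Real.cos φ) :
    InnerProductGeometry.angle v w = φ := by
  rw [InnerProductGeometry.angle, hv, hw, h, one_mul, mul_div_cancel_left₀ _ hr.ne',
    Real.arccos_cos hφ.1.le hφ.2.le]

theorem IsCreaseChain.angle_right (h : IsCreaseChain n al be e U) (he : ∀ i ≤ n, ‖e i‖ = 1)
    (hal : ∀ i ∈ Set.Icc 1 n, al i ∈ Set.Ioo 0 Real.pi)
    (hbe : ∀ i ∈ Set.Icc 1 n, be i ∈ Set.Ioo 0 Real.pi) {i : ℕ} (hi : i ∈ Set.Icc 1 n) :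
    InnerProductGeometry.angle (e i) (U i) = al i := by
  refine angle_eq_of_inner (he i hi.2) (h.norm_eq i hi.2) (scale_pos hal hbe hi.2) (hal i hi) ?_
  have h1 := hi.1
  rw [h.inner_eq i hi.2, startAngle, if_neg (by omega)]

theorem IsCreaseChain.angle_left (h : IsCreaseChain n al be e U) (he : ∀ i ≤ n, ‖e i‖ = 1)
    (hal : ∀ i ∈ Set.Icc 1 n, al i ∈ Set.Ioo 0 Real.pi)
    (hbe : ∀ i ∈ Set.Icc 1 n, be i ∈ Set.Ioo 0 Real.pi) {i : ℕ} (hi : i ∈ Set.Icc 1 n) :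
    InnerProductGeometry.angle (-e (i - 1)) (U i) = be i := by
  obtain ⟨k, rfl⟩ : ∃ k, i = k + 1 := ⟨i - 1, by have := hi.1; omega⟩
  have hk : k < n := hi.2
  refine angle_eq_of_inner (by rw [norm_neg]; exact he k hk.le) (h.norm_eq _ hi.2)
    (scale_pos hal hbe hi.2) (hbe _ hi) ?_
  rw [inner_neg_left, Nat.add_sub_cancel, h.inner_left he hbe hk, neg_neg]

theorem IsRowModel.mesh_sub_right (h : IsRowModel n σ L A e U D) {i : ℕ} (hi : i ≤ n) (j : ℕ) :
    mesh A U D x y (i + 1) j - mesh A U D x y i j = rung n σ L x y i j • e i := by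
  rw [h.mesh_succ hi, add_sub_cancel_left]

theorem IsRowModel.mesh_sub_left (h : IsRowModel n σ L A e U D) {i : ℕ} (hi : i ∈ Set.Icc 1 n)
    (j : ℕ) :
    mesh A U D x y (i - 1) j - mesh A U D x y i j = rung n σ L x y (i - 1) j • -e (i - 1) := by
  have h1 := h.mesh_succ (x := x) (y := y) (i := i - 1) (by have := hi.2; omega) j
  rw [Nat.sub_add_cancel hi.1] at h1
  rw [h1, smul_neg]
  abel

theorem mesh_sub_up (A U D : ℕ → V) (x y : ℕ → ℝ) (i j : ℕ) :
    mesh A U D x y i (j + 1) - mesh A U D x y i j = rail U D x y i j := by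
  rw [mesh_rail, add_sub_cancel_left]

/-- The creases at a vertex of an even row, and at one of an odd row, where they have the opposite
directions with up and down exchanged. -/
theorem IsStaircase.mesh_creases (h : IsStaircase j₀ x y) (A U D : ℕ → V) (i : ℕ) {j : ℕ}
    (hj : 1 ≤ j) :
    ∃ r r' : ℝ, 0 < r ∧ 0 < r' ∧
      mesh A U D x y i (j + 1) - mesh A U D x y i j =
        r • (if Even (j + j₀) then U i else -D i) ∧
      mesh A U D x y i (j - 1) - mesh A U D x y i j =
        r' • (if Even (j + j₀) then D i else -U i) := by
  obtain ⟨k, rfl⟩ : ∃ k, j = k + 1 := ⟨j - 1, by omega⟩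
  have hk : Even (k + 1 + j₀) ↔ ¬ Even (k + j₀) := by
    rw [show k + 1 + j₀ = k + j₀ + 1 by ring, Nat.even_add_one]
  have h2 : mesh A U D x y i k - mesh A U D x y i (k + 1) = -rail U D x y i k := by
    rw [mesh_rail]; abel
  rw [mesh_sub_up, Nat.add_sub_cancel, h2]
  by_cases hj : Even (k + j₀)
  · have hj' : ¬ Even (k + 1 + j₀) := by rw [hk, not_not]; exact hj
    rw [rail_odd h _ _ _ hj', rail_even h _ _ _ hj, if_neg hj', if_neg hj']
    refine ⟨y (k + 1) - y (k + 1 + 1), x (k + 1) - x k,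
      sub_pos.2 (h.odd_step _ hj').2, sub_pos.2 (h.even_step _ hj).1, ?_, ?_⟩ <;> module
  · have hj' : Even (k + 1 + j₀) := hk.2 hj
    rw [rail_even h _ _ _ hj', rail_odd h _ _ _ hj, if_pos hj', if_pos hj']
    refine ⟨x (k + 1 + 1) - x (k + 1), y k - y (k + 1),
      sub_pos.2 (h.even_step _ hj').1, sub_pos.2 (h.odd_step _ hj).2, ?_, ?_⟩ <;> module

theorem IsRowModel.isParallelRepeating {A e U D : ℕ → Plane} (h : IsRowModel n σ L A e U D)
    (hσ : AnglesMem n σ)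
    (hdev : ∀ i ∈ Set.Icc 1 n, σ.ne i + σ.nw i + σ.sw i + σ.se i = 2 * Real.pi)
    (hcross : ∀ i ∈ Set.Icc 1 n, ¬ (σ.ne i + σ.nw i = Real.pi ∧ σ.ne i + σ.se i = Real.pi))
    (hxy : IsStaircase j₀ x y)
    (hrung : ∀ i ≤ n, ∀ j ≤ m + 1, 0 < rung n σ L x y i j) :
    IsParallelRepeating n m (mesh A U D x y) σ j₀ := by
  have hright : ∀ i ∈ Set.Icc 1 n, ∀ j ∈ Set.Icc 1 m, ∀ v : Plane, ∀ r : ℝ, 0 < r →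
      InnerProductGeometry.angle (mesh A U D x y (i + 1) j - mesh A U D x y i j) (r • v) =
        InnerProductGeometry.angle (e i) v := by
    intro i hi j hj v r hr
    rw [h.mesh_sub_right hi.2, InnerProductGeometry.angle_smul_right_of_pos _ _ hr,
      InnerProductGeometry.angle_smul_left_of_pos _ _
        (hrung i hi.2 j (by have := hj.2; omega))]
  have hleft : ∀ i ∈ Set.Icc 1 n, ∀ j ∈ Set.Icc 1 m, ∀ v : Plane, ∀ r : ℝ, 0 < r →
      InnerProductGeometry.angle (mesh A U D x y (i - 1) j - mesh A U D x y i j) (r • v) =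
        InnerProductGeometry.angle (-e (i - 1)) v := by
    intro i hi j hj v r hr
    rw [h.mesh_sub_left hi, InnerProductGeometry.angle_smul_right_of_pos _ _ hr,
      InnerProductGeometry.angle_smul_left_of_pos _ _
        (hrung (i - 1) (by have := hi.2; omega) j (by have := hj.2; omega))]
  refine ⟨hσ, hdev, hcross, ?_, ?_, ?_, ?_⟩ <;> intro i hi j hj <;>
    obtain ⟨r, r', hr, hr', h1, h2⟩ := hxy.mesh_creases A U D i hj.1 <;>
    rw [EuclideanGeometry.angle, vsub_eq_sub, vsub_eq_sub]
  · rw [h1, hright i hi j hj _ r hr]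
    split_ifs
    · exact h.upper.angle_right h.unit hσ.ne hσ.nw hi
    · rw [InnerProductGeometry.angle_neg_right, h.lower.angle_right h.unit hσ.se hσ.sw hi]
  · rw [h1, hleft i hi j hj _ r hr]
    split_ifs
    · exact h.upper.angle_left h.unit hσ.ne hσ.nw hi
    · rw [InnerProductGeometry.angle_neg_right, h.lower.angle_left h.unit hσ.se hσ.sw hi]
  · rw [h2, hleft i hi j hj _ r' hr']
    split_ifs
    · exact h.lower.angle_left h.unit hσ.se hσ.sw hi
    · rw [InnerProductGeometry.angle_neg_right, h.upper.angle_left h.unit hσ.ne hσ.nw hi]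
  · rw [h2, hright i hi j hj _ r' hr']
    split_ifs
    · exact h.lower.angle_right h.unit hσ.se hσ.sw hi
    · rw [InnerProductGeometry.angle_neg_right, h.upper.angle_right h.unit hσ.ne hσ.nw hi]

end Angles

/-! ### Planar meshes are creased papers -/

/-- The determinant of two vectors of the plane. -/
def planeDet (v w : Plane) : ℝ := v 0 * w 1 - v 1 * w 0

theorem planeDet_smul_left (r : ℝ) (v w : Plane) : planeDet (r • v) w = r * planeDet v w := by
  simp [planeDet]; ring

theorem planeDet_smul_right (r : ℝ) (v w : Plane) : planeDet v (r • w) = r * planeDet v w := by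
  simp [planeDet]; ring

theorem planeDet_add_right (v w w' : Plane) :
    planeDet v (w + w') = planeDet v w + planeDet v w' := by
  simp [planeDet]; ring

theorem planeDet_sub_right (v w w' : Plane) :
    planeDet v (w - w') = planeDet v w - planeDet v w' := by
  simp [planeDet]; ring

theorem planeDet_self (v : Plane) : planeDet v v = 0 := by
  simp [planeDet]; ring

theorem planeDet_swap (v w : Plane) : planeDet v w = -planeDet w v := by
  simp [planeDet]; ring

/-- A step of a staircase with creases `U`, `-D` on the same sides of the two row directions `e`, `e'`
is never a combination of `e` and `e'` with coefficients of equal sign. -/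
theorem staircase_step_eq_zero {e e' U D : Plane} (hU : 0 < planeDet e U)
    (hD : planeDet e D < 0) (hU' : 0 < planeDet e' U) (hD' : planeDet e' D < 0)
    {dx dy s s' : ℝ} (hdx : 0 ≤ dx) (hdy : dy ≤ 0) (hs : 0 ≤ s * s')
    (heq : dx • U + dy • D = s • e + s' • e') : dx = 0 ∧ dy = 0 := by
  have h1 := congrArg (planeDet e) heq
  have h2 := congrArg (planeDet e') heq
  simp only [planeDet_add_right, planeDet_smul_right, planeDet_self, mul_zero, zero_add,
    add_zero] at h1 h2
  rw [planeDet_swap e' e] at h2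
  by_contra! hne
  have hpos : 0 < dx ∨ dy < 0 := by
    rcases hdx.eq_or_lt with h | h
    · exact Or.inr (lt_of_le_of_ne hdy (hne h.symm))
    · exact Or.inl h
  have p1 : 0 < dx * planeDet e U + dy * planeDet e D := by
    rcases hpos with h | h
    · nlinarith [mul_pos h hU, mul_nonneg_of_nonpos_of_nonpos hdy hD.le]
    · nlinarith [mul_nonneg hdx hU.le, mul_pos_of_neg_of_neg h hD]
  have p2 : 0 < dx * planeDet e' U + dy * planeDet e' D := by
    rcases hpos with h | h
    · nlinarith [mul_pos h hU', mul_nonneg_of_nonpos_of_nonpos hdy hD'.le]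
    · nlinarith [mul_nonneg hdx hU'.le, mul_pos_of_neg_of_neg h hD']
  rw [h1] at p1
  rw [h2] at p2
  nlinarith [mul_pos p1 p2, mul_nonneg hs (sq_nonneg (planeDet e e'))]

section Panels

variable {n m : ℕ} {σ : SectorAngles} {L x y : ℕ → ℝ} {j₀ : ℕ}

/-- The pairs of crease coordinates on the edge from the row `j` to the row `j + 1` of a staircase; one
of the two intervals is a single point. -/
def stepBox (x y : ℕ → ℝ) (j : ℕ) (p : ℝ × ℝ) : Prop :=
  p.1 ∈ Set.Icc (x j) (x (j + 1)) ∧ p.2 ∈ Set.Icc (y (j + 1)) (y j)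

theorem IsStaircase.stepBox_compare (h : IsStaircase j₀ x y) {j j' : ℕ} (hjj : j ≤ j')
    {p p' : ℝ × ℝ} (hp : stepBox x y j p) (hp' : stepBox x y j' p') :
    (p.1 ≤ p'.1 ∧ p'.2 ≤ p.2) ∨ (p'.1 ≤ p.1 ∧ p.2 ≤ p'.2) := by
  obtain ⟨⟨h1, h2⟩, h3, h4⟩ := hp
  obtain ⟨⟨h1', h2'⟩, h3', h4'⟩ := hp'
  rcases hjj.eq_or_lt with rfl | hlt
  · by_cases hj : Even (j + j₀)
    · have := (h.even_step j hj).2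
      rcases le_total p.1 p'.1 with h' | h'
      · exact Or.inl ⟨h', by linarith⟩
      · exact Or.inr ⟨h', by linarith⟩
    · have := (h.odd_step j hj).1
      rcases le_total p.2 p'.2 with h' | h'
      · exact Or.inr ⟨by linarith, h'⟩
      · exact Or.inl ⟨by linarith, h'⟩
  · exact Or.inl ⟨h2.trans ((h.x_mono hlt).trans h1'), h4'.trans ((h.y_anti hlt).trans h3)⟩

theorem IsStaircase.stepBox_common (h : IsStaircase j₀ x y) {j j' : ℕ} (hjj : j < j')
    {p : ℝ × ℝ} (hp : stepBox x y j p) (hp' : stepBox x y j' p) :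
    j' = j + 1 ∧ p = (x (j + 1), y (j + 1)) := by
  obtain ⟨⟨h1, h2⟩, h3, h4⟩ := hp
  obtain ⟨⟨h1', h2'⟩, h3', h4'⟩ := hp'
  have hx := h.x_mono (Nat.succ_le_of_lt hjj)
  have hy := h.y_anti (Nat.succ_le_of_lt hjj)
  simp only [Nat.succ_eq_add_one] at hx hy
  refine ⟨?_, Prod.ext (by simp only; linarith) (by simp only; linarith)⟩
  by_contra hne
  have hlt : j + 1 + 1 ≤ j' := by omega
  have hx' := h.x_mono hlt
  have hy' := h.y_anti hlt
  by_cases hj : Even (j + 1 + j₀)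
  · have := (h.even_step _ hj).1
    linarith
  · have := (h.odd_step _ hj).2
    linarith

variable {V : Type*} [NormedAddCommGroup V] [InnerProductSpace ℝ V] {A e U D : ℕ → V}

theorem IsStaircase.mem_segment_of_stepBox (h : IsStaircase j₀ x y) (A U D : ℕ → V) (i : ℕ)
    {j : ℕ} {p : ℝ × ℝ} (hp : stepBox x y j p) :
    A i + p.1 • U i + p.2 • D i ∈
      segment ℝ (mesh A U D x y i j) (mesh A U D x y i (j + 1)) := by
  obtain ⟨⟨h1, h2⟩, h3, h4⟩ := hp
  rw [segment_eq_image']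
  rw [mesh_sub_up]
  by_cases hj : Even (j + j₀)
  · obtain ⟨h5, h6⟩ := h.even_step j hj
    have hx : x (j + 1) - x j ≠ 0 := (sub_pos.2 h5).ne'
    refine ⟨(p.1 - x j) / (x (j + 1) - x j), ⟨div_nonneg (by linarith) (by linarith),
      (div_le_one (by linarith)).2 (by linarith)⟩, ?_⟩
    rw [rail_even h _ _ _ hj]
    simp only [smul_smul, mesh]
    rw [div_mul_cancel₀ _ hx, show p.2 = y j by linarith]
    module
  · obtain ⟨h5, h6⟩ := h.odd_step j hj
    have hx : y (j + 1) - y j ≠ 0 := (sub_neg.2 h6).ne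
    refine ⟨(p.2 - y j) / (y (j + 1) - y j), ⟨div_nonneg_of_nonpos (by linarith) (by linarith),
      (div_le_one_of_neg (by linarith)).2 (by linarith)⟩, ?_⟩
    rw [rail_odd h _ _ _ hj]
    simp only [smul_smul, mesh]
    rw [div_mul_cancel₀ _ hx, show p.1 = x j by linarith]
    module

/-- Every point of a panel lies on a segment of the row direction that starts on its left edge and ends
on its right edge. -/
theorem IsRowModel.exists_of_mem_panel (h : IsRowModel n σ L A e U D) (hxy : IsStaircase j₀ x y)
    {i j : ℕ} (hi : i ≤ n) (hr : 0 ≤ rung n σ L x y i j) (hr' : 0 ≤ rung n σ L x y i (j + 1))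
    {z : V} (hz : z ∈ panel (mesh A U D x y) i j) :
    ∃ (p : ℝ × ℝ) (s s' : ℝ), stepBox x y j p ∧ 0 ≤ s ∧ 0 ≤ s' ∧
      z = A i + p.1 • U i + p.2 • D i + s • e i ∧
      z = A (i + 1) + p.1 • U (i + 1) + p.2 • D (i + 1) - s' • e i := by
  set S : Set V := {z | ∃ p : ℝ × ℝ, ∃ s : ℝ, stepBox x y j p ∧ 0 ≤ s ∧
      s ≤ L i - p.1 * shear n σ.ne σ.nw i - p.2 * shear n σ.se σ.sw i ∧
      z = A i + p.1 • U i + p.2 • D i + s • e i} with hS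
  have hx := hxy.x_mono (Nat.le_succ j)
  have hy := hxy.y_anti (Nat.le_succ j)
  have hsub : panel (mesh A U D x y) i j ⊆ S := by
    refine convexHull_min ?_ ?_
    · rintro _ ⟨k, hk, rfl⟩
      simp only [corners, Set.mem_insert_iff, Set.mem_singleton_iff] at hk
      rcases hk with rfl | rfl | rfl | rfl
      · exact ⟨(x j, y j), 0, ⟨⟨le_rfl, hx⟩, hy, le_rfl⟩, le_rfl, hr, by simp [mesh]⟩
      · exact ⟨(x j, y j), _, ⟨⟨le_rfl, hx⟩, hy, le_rfl⟩, hr, le_rfl,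
          h.mesh_succ hi _⟩
      · exact ⟨(x (j + 1), y (j + 1)), _, ⟨⟨hx, le_rfl⟩, le_rfl, hy⟩, hr', le_rfl,
          h.mesh_succ hi _⟩
      · exact ⟨(x (j + 1), y (j + 1)), 0, ⟨⟨hx, le_rfl⟩, le_rfl, hy⟩, le_rfl, hr', by
          simp [mesh]⟩
    · rintro _ ⟨p, s, ⟨hp1, hp2⟩, h0, h1, rfl⟩ _ ⟨p', s', ⟨hp1', hp2'⟩, h0', h1', rfl⟩ a b
        ha hb hab
      refine ⟨(a * p.1 + b * p'.1, a * p.2 + b * p'.2), a * s + b * s',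
        ⟨convex_Icc _ _ hp1 hp1' ha hb hab, convex_Icc _ _ hp2 hp2' ha hb hab⟩,
        by positivity, ?_, ?_⟩
      · have e1 := mul_le_mul_of_nonneg_left h1 ha
        have e2 := mul_le_mul_of_nonneg_left h1' hb
        have e3 : L i = a * L i + b * L i := by rw [← add_mul, hab, one_mul]
        rw [e3]
        linarith
      · have e3 : A i = a • A i + b • A i := by rw [← add_smul, hab, one_smul]
        nth_rw 3 [e3]
        module
  obtain ⟨p, s, hp, h0, h1, hz'⟩ := hsub hz
  refine ⟨p, s, _, hp, h0, sub_nonneg.2 h1, hz', ?_⟩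
  rw [hz', h.succ i hi, h.upper.succ i hi, h.lower.succ i hi]
  module

end Panels

theorem convexHull_corner_mem {E : Type*} [AddCommGroup E] [Module ℝ E] (P : ℕ → ℕ → E)
    {S : Set (ℕ × ℕ)} {i j : ℕ} (h : (i, j) ∈ S) :
    P i j ∈ convexHull ℝ ((fun k : ℕ × ℕ => P k.1 k.2) '' S) :=
  subset_convexHull ℝ _ ⟨(i, j), h, rfl⟩

theorem segment_subset_convexHull_corners {E : Type*} [AddCommGroup E] [Module ℝ E]
    (P : ℕ → ℕ → E) {S : Set (ℕ × ℕ)} {i j i' j' : ℕ} (h : (i, j) ∈ S) (h' : (i', j') ∈ S) :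
    segment ℝ (P i j) (P i' j') ⊆ convexHull ℝ ((fun k : ℕ × ℕ => P k.1 k.2) '' S) :=
  (convex_convexHull ℝ _).segment_subset (convexHull_corner_mem P h) (convexHull_corner_mem P h')

/-- A planar mesh with positive row creases, whose column creases leave the row creases to the proper
sides, is a creased paper as soon as panels of strips that are not neighbours are disjoint: panels of
one strip are separated by their height above the row, panels of neighbouring strips by the staircase
between them. -/
theorem IsRowModel.isCreasedPaper {n m j₀ : ℕ} {σ : SectorAngles} {L x y : ℕ → ℝ}
    {A e U D : ℕ → Plane} (h : IsRowModel n σ L A e U D) (hxy : IsStaircase j₀ x y)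
    (hrung : ∀ i ≤ n, ∀ j ≤ m + 1, 0 < rung n σ L x y i j)
    (hU : ∀ i ≤ n, 0 < planeDet (e i) (U i)) (hD : ∀ i ≤ n, planeDet (e i) (D i) < 0)
    (hE : ∀ i < n, e (i + 1) ≠ -e i)
    (hfar : ∀ i i', i + 2 ≤ i' → i' ≤ n → ∀ j ≤ m, ∀ j' ≤ m,
      Disjoint (panel (mesh A U D x y) i j) (panel (mesh A U D x y) i' j')) :
    IsCreasedPaper n m (mesh A U D x y) := by
  set P := mesh A U D x y with hP
  have hU1 : ∀ i ≤ n, planeDet (e i) (U (i + 1)) = planeDet (e i) (U i) := fun i hi => by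
    rw [h.upper.succ i hi, planeDet_sub_right, planeDet_smul_right, planeDet_self]; ring
  have hD1 : ∀ i ≤ n, planeDet (e i) (D (i + 1)) = planeDet (e i) (D i) := fun i hi => by
    rw [h.lower.succ i hi, planeDet_sub_right, planeDet_smul_right, planeDet_self]; ring
  have hrail : ∀ i ≤ n, ∀ j, 0 < planeDet (e i) (rail U D x y i j) := by
    intro i hi j
    by_cases hj : Even (j + j₀)
    · rw [rail_even hxy _ _ _ hj, planeDet_smul_right]
      exact mul_pos (sub_pos.2 (hxy.even_step j hj).1) (hU i hi)
    · rw [rail_odd hxy _ _ _ hj, planeDet_smul_right]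
      exact mul_pos_of_neg_of_neg (sub_neg.2 (hxy.odd_step j hj).2) (hD i hi)
  -- panels of one strip
  have hsame : ∀ i ≤ n, ∀ j ≤ m, ∀ j' ≤ m, j < j' →
      panel P i j ∩ panel P i j' ⊆
        convexHull ℝ ((fun k : ℕ × ℕ => P k.1 k.2) '' (corners i j ∩ corners i j')) := by
    rintro i hi j hj j' hj' hjj z ⟨hz, hz'⟩
    obtain ⟨p, s, t, hp, hs, ht, hzs, hzt⟩ := h.exists_of_mem_panel hxy hi
      (hrung i hi j (by omega)).le (hrung i hi (j + 1) (by omega)).le hz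
    obtain ⟨p', s', t', hp', hs', ht', hzs', hzt'⟩ := h.exists_of_mem_panel hxy hi
      (hrung i hi j' (by omega)).le (hrung i hi (j' + 1) (by omega)).le hz'
    have hpp : p = p' := by
      have heq : (p'.1 - p.1) • U i + (p'.2 - p.2) • D i = (s - s') • e i + (0 : ℝ) • e i := by
        have := hzs.symm.trans hzs'
        rw [← sub_eq_zero] at this ⊢
        rw [← neg_eq_zero, ← this]
        module
      rcases hxy.stepBox_compare hjj.le hp hp' with ⟨h1, h2⟩ | ⟨h1, h2⟩
      · obtain ⟨h3, h4⟩ := staircase_step_eq_zero (hU i hi) (hD i hi) (hU i hi) (hD i hi)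
          (sub_nonneg.2 h1) (sub_nonpos.2 h2) (by simp) heq
        exact Prod.ext (by linarith) (by linarith)
      · have heq' : (p.1 - p'.1) • U i + (p.2 - p'.2) • D i =
            (s' - s) • e i + (0 : ℝ) • e i := by
          rw [← neg_inj]
          have e1 : -((p.1 - p'.1) • U i + (p.2 - p'.2) • D i) =
            (p'.1 - p.1) • U i + (p'.2 - p.2) • D i := by module
          rw [e1, heq]
          module
        obtain ⟨h3, h4⟩ := staircase_step_eq_zero (hU i hi) (hD i hi) (hU i hi) (hD i hi)
          (sub_nonneg.2 h1) (sub_nonpos.2 h2) (by simp) heq'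
        exact Prod.ext (by linarith) (by linarith)
    subst hpp
    obtain ⟨rfl, hpv⟩ := hxy.stepBox_common hjj hp hp'
    refine segment_subset_convexHull_corners P (i := i) (j := j + 1) (i' := i + 1) (j' := j + 1)
      (by simp [corners]) (by simp [corners]) ?_
    have hl : rung n σ L x y i (j + 1) = s + t := by
      have e1 : P (i + 1) (j + 1) - P i (j + 1) = (s + t) • e i := by
        have e2 := hzs.symm.trans hzt
        rw [hpv] at e2
        simp only [hP, mesh]
        rw [← sub_eq_zero] at e2 ⊢
        rw [← neg_eq_zero, ← e2]
        module
      rw [hP, h.mesh_sub_right hi, ← sub_eq_zero, ← sub_smul, smul_eq_zero] at e1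
      rcases e1 with e1 | e1
      · linarith
      · have := h.unit i hi
        rw [e1, norm_zero] at this
        exact absurd this zero_ne_one
    have hlpos := hrung i hi (j + 1) (by omega)
    rw [segment_eq_image']
    refine ⟨s / rung n σ L x y i (j + 1), ⟨div_nonneg hs hlpos.le,
      (div_le_one hlpos).2 (by linarith)⟩, ?_⟩
    simp only [hP]
    rw [h.mesh_sub_right hi, smul_smul, div_mul_cancel₀ _ hlpos.ne', hzs, hpv]
    rfl
  -- panels of neighbouring strips
  have hnext : ∀ i < n, ∀ j ≤ m, ∀ j' ≤ m,
      panel P i j ∩ panel P (i + 1) j' ⊆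
        convexHull ℝ ((fun k : ℕ × ℕ => P k.1 k.2) '' (corners i j ∩ corners (i + 1) j')) := by
    rintro i hi j hj j' hj' z ⟨hz, hz'⟩
    obtain ⟨p, s, t, hp, hs, ht, hzs, hzt⟩ := h.exists_of_mem_panel hxy hi.le
      (hrung i hi.le j (by omega)).le (hrung i hi.le (j + 1) (by omega)).le hz
    obtain ⟨p', s', t', hp', hs', ht', hzs', hzt'⟩ := h.exists_of_mem_panel hxy hi
      (hrung _ hi j' (by omega)).le (hrung _ hi (j' + 1) (by omega)).le hz'
    have heq : (p'.1 - p.1) • U (i + 1) + (p'.2 - p.2) • D (i + 1) =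
        (-t) • e i + (-s') • e (i + 1) := by
      have := hzt.symm.trans hzs'
      rw [← sub_eq_zero] at this ⊢
      rw [← neg_eq_zero, ← this]
      module
    have a1 : 0 < planeDet (e i) (U (i + 1)) := (hU1 i hi.le).symm ▸ hU i hi.le
    have a2 : planeDet (e i) (D (i + 1)) < 0 := (hD1 i hi.le).symm ▸ hD i hi.le
    have hpp : p = p' := by
      have hcomp : (p.1 ≤ p'.1 ∧ p'.2 ≤ p.2) ∨ (p'.1 ≤ p.1 ∧ p.2 ≤ p'.2) := by
        rcases le_total j j' with hjj | hjj
        · exact hxy.stepBox_compare hjj hp hp'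
        · exact (hxy.stepBox_compare hjj hp' hp).symm
      rcases hcomp with ⟨h1, h2⟩ | ⟨h1, h2⟩
      · obtain ⟨h3, h4⟩ := staircase_step_eq_zero a1 a2 (hU _ hi) (hD _ hi)
          (sub_nonneg.2 h1) (sub_nonpos.2 h2) (by nlinarith [mul_nonneg ht hs']) heq
        exact Prod.ext (by linarith) (by linarith)
      · have heq' : (p.1 - p'.1) • U (i + 1) + (p.2 - p'.2) • D (i + 1) =
            t • e i + s' • e (i + 1) := by
          rw [← neg_inj]
          have e1 : -((p.1 - p'.1) • U (i + 1) + (p.2 - p'.2) • D (i + 1)) =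
            (p'.1 - p.1) • U (i + 1) + (p'.2 - p.2) • D (i + 1) := by module
          rw [e1, heq]
          module
        obtain ⟨h3, h4⟩ := staircase_step_eq_zero a1 a2 (hU _ hi) (hD _ hi)
          (sub_nonneg.2 h1) (sub_nonpos.2 h2) (mul_nonneg ht hs') heq'
        exact Prod.ext (by linarith) (by linarith)
    subst hpp
    have hs0 : s' = 0 := by
      by_contra hne
      rw [sub_self, sub_self, zero_smul, zero_smul, add_zero] at heq
      have e1 : s' • e (i + 1) = -(t • e i) := by
        rw [← sub_eq_zero, ← neg_eq_zero, heq]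
        module
      have e2 := congrArg norm e1
      rw [norm_neg, norm_smul, norm_smul, h.unit _ hi, h.unit _ hi.le, mul_one, mul_one,
        Real.norm_of_nonneg hs', Real.norm_of_nonneg ht] at e2
      rw [← e2, ← smul_neg] at e1
      exact hE i hi (smul_right_injective _ hne e1)
    have hzv : z = A (i + 1) + p.1 • U (i + 1) + p.2 • D (i + 1) := by
      rw [hzs', hs0, zero_smul, add_zero]
    rcases lt_trichotomy j j' with hjj | rfl | hjj
    · obtain ⟨rfl, hpv⟩ := hxy.stepBox_common hjj hp hp'
      rw [hzv, hpv]
      exact convexHull_corner_mem P (i := i + 1) (j := j + 1) (by simp [corners])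
    · rw [hzv]
      exact segment_subset_convexHull_corners P (i := i + 1) (j := j) (i' := i + 1) (j' := j + 1)
        (by simp [corners]) (by simp [corners]) (hxy.mem_segment_of_stepBox A U D (i + 1) hp)
    · obtain ⟨rfl, hpv⟩ := hxy.stepBox_common hjj hp' hp
      rw [hzv, hpv]
      exact convexHull_corner_mem P (i := i + 1) (j := j' + 1) (by simp [corners])
  have hle : ∀ i ≤ n, ∀ j ≤ m, ∀ i' ≤ n, ∀ j' ≤ m, i ≤ i' →
      panel P i j ∩ panel P i' j' ⊆
        convexHull ℝ ((fun k : ℕ × ℕ => P k.1 k.2) '' (corners i j ∩ corners i' j')) := by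
    intro i hi j hj i' hi' j' hj' hii
    rcases hii.eq_or_lt with rfl | hlt
    · rcases lt_trichotomy j j' with hjj | rfl | hjj
      · exact hsame i hi j hj j' hj' hjj
      · rw [Set.inter_self, Set.inter_self]; rfl
      · rw [Set.inter_comm, Set.inter_comm (corners i j)]
        exact hsame i hi j' hj' j hj hjj
    · rcases (Nat.succ_le_of_lt hlt).eq_or_lt with rfl | hlt'
      · exact hnext i hi' j hj j' hj'
      · rw [(hfar i i' hlt' hi' j hj j' hj').inter_eq]
        exact Set.empty_subset _
  refine ⟨?_, ?_, ?_⟩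
  · intro i hi j hj hcol
    rw [collinear_iff_of_mem (p₀ := P (i + 1) j) (by simp)] at hcol
    obtain ⟨v, hv⟩ := hcol
    obtain ⟨r, hr⟩ := hv (P i j) (by simp)
    obtain ⟨r', hr'⟩ := hv (P (i + 1) (j + 1)) (by simp)
    simp only [vadd_eq_add] at hr hr'
    have e1 : P (i + 1) j - P i j = (-r) • v := by rw [hr]; module
    have e2 : P (i + 1) (j + 1) - P (i + 1) j = r' • v := by rw [hr']; module
    have e3 : planeDet (P (i + 1) j - P i j) (P (i + 1) (j + 1) - P (i + 1) j) = 0 := by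
      rw [e1, e2, planeDet_smul_left, planeDet_smul_right, planeDet_self]; ring
    have e4 : 0 < planeDet (e i) (rail U D x y (i + 1) j) := by
      have : planeDet (e i) (rail U D x y (i + 1) j) = planeDet (e i) (rail U D x y i j) := by
        simp only [rail, planeDet_add_right, planeDet_smul_right, hU1 i hi, hD1 i hi]
      rw [this]
      exact hrail i hi j
    rw [hP, h.mesh_sub_right hi, mesh_sub_up, planeDet_smul_left] at e3
    exact (mul_pos (hrung i hi j (by omega)) e4).ne' e3
  · intro i hi j hj
    have h1 := hrung i hi j (by omega)
    have h2 := hrung i hi (j + 1) (by omega)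
    set l := rung n σ L x y i j with hl
    set l' := rung n σ L x y i (j + 1) with hl'
    have hsum : 0 < l + l' := by positivity
    -- the parallel sides divide the diagonals in the ratio of their lengths
    have hpt : ∀ p q : Plane, AffineMap.lineMap p q (l / (l + l')) ∈ openSegment ℝ p q := by
      intro p q
      rw [openSegment_eq_image_lineMap]
      exact ⟨_, ⟨by positivity, (div_lt_one hsum).2 (by linarith)⟩, rfl⟩
    refine ⟨_, hpt _ _, ?_⟩
    convert hpt _ _ using 1
    have e1 : P (i + 1) j = P i j + l • e i := h.mesh_succ hi j
    have e2 : P (i + 1) (j + 1) = P i (j + 1) + l' • e i := h.mesh_succ hi (j + 1)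
    rw [AffineMap.lineMap_apply_module', AffineMap.lineMap_apply_module', e1, e2]
    have e3 : l / (l + l') * l' = l - l / (l + l') * l := by field_simp; ring
    have e4 : (l / (l + l')) • (l' • e i) = l • e i - (l / (l + l')) • (l • e i) := by
      rw [smul_smul, smul_smul, e3, sub_smul]
    simp only [smul_sub, smul_add, e4]
    module
  · intro i hi j hj i' hi' j' hj'
    refine Set.Subset.antisymm ?_ ?_
    · rcases le_total i i' with hii | hii
      · exact hle i hi j hj i' hi' j' hj' hii
      · rw [Set.inter_comm, Set.inter_comm (corners i j)]
        exact hle i' hi' j' hj' i hi j hj hii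
    · exact Set.subset_inter (convexHull_mono (Set.image_mono Set.inter_subset_left))
        (convexHull_mono (Set.image_mono Set.inter_subset_right))

/-! ### The planar drawing of a row -/

theorem unitVec_zero (a : ℝ) : unitVec a 0 = Real.cos a := rfl

theorem unitVec_one (a : ℝ) : unitVec a 1 = Real.sin a := rfl

theorem inner_unitVec (a b : ℝ) : inner ℝ (unitVec a) (unitVec b) = Real.cos (a - b) := by
  rw [Real.cos_sub]
  simp [PiLp.inner_apply, Fin.sum_univ_two, unitVec_zero, unitVec_one, mul_comm]

theorem norm_unitVec (a : ℝ) : ‖unitVec a‖ = 1 := by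
  have h := inner_unitVec a a
  rw [real_inner_self_eq_norm_sq, sub_self, Real.cos_zero] at h
  exact (pow_eq_one_iff_of_nonneg (norm_nonneg _) two_ne_zero).1 h

theorem planeDet_unitVec (a b : ℝ) : planeDet (unitVec a) (unitVec b) = Real.sin (b - a) := by
  rw [Real.sin_sub, planeDet]
  simp only [unitVec_zero, unitVec_one]
  ring

theorem unitVec_combination_upper (φ a b : ℝ) :
    Real.sin b • unitVec (φ + a) - Real.sin a • unitVec (φ + Real.pi - b) =
      Real.sin (a + b) • unitVec φ := by
  ext k
  fin_cases k <;>
    simp only [Fin.zero_eta, Fin.mk_one, PiLp.sub_apply, PiLp.smul_apply, smul_eq_mul,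
      unitVec_zero, unitVec_one, Real.sin_add, Real.cos_add, Real.sin_sub, Real.cos_sub,
      Real.cos_pi, Real.sin_pi] <;> ring

theorem unitVec_combination_lower (φ a b : ℝ) :
    Real.sin b • unitVec (φ - a) - Real.sin a • unitVec (φ - Real.pi + b) =
      Real.sin (a + b) • unitVec φ := by
  ext k
  fin_cases k <;>
    simp only [Fin.zero_eta, Fin.mk_one, PiLp.sub_apply, PiLp.smul_apply, smul_eq_mul,
      unitVec_zero, unitVec_one, Real.sin_add, Real.cos_add, Real.sin_sub, Real.cos_sub,
      Real.cos_pi, Real.sin_pi] <;> ring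

/-- The column whose creases the border column next to it copies. -/
def clampIdx (n i : ℕ) : ℕ := max 1 (min i n)

theorem clampIdx_of_mem {n i : ℕ} (hi : i ∈ Set.Icc 1 n) : clampIdx n i = i := by
  have := hi.1; have := hi.2
  unfold clampIdx; omega

theorem clampIdx_zero {n : ℕ} : clampIdx n 0 = 1 := by
  unfold clampIdx; omega

theorem clampIdx_succ {n : ℕ} (hn : 1 ≤ n) : clampIdx n (n + 1) = n := by
  unfold clampIdx; omega

theorem clampIdx_mem {n : ℕ} (hn : 1 ≤ n) (i : ℕ) : clampIdx n i ∈ Set.Icc 1 n := by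
  unfold clampIdx
  constructor <;> omega

/-- The scaled upper creases of the drawing. -/
def drawnUpper (n : ℕ) (σ : SectorAngles) (i : ℕ) : Plane :=
  scale σ.ne σ.nw (clampIdx n i) •
    unitVec (drawnRowAngle σ (clampIdx n i) + σ.ne (clampIdx n i))

/-- The scaled lower creases of the drawing. -/
def drawnLower (n : ℕ) (σ : SectorAngles) (i : ℕ) : Plane :=
  scale σ.se σ.sw (clampIdx n i) •
    unitVec (drawnRowAngle σ (clampIdx n i) - σ.se (clampIdx n i))

/-- The lengths of the edges of the row. -/
def Row.len (R : Row) (i : ℕ) : ℝ := dist (R.A i) (R.A (i + 1))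

theorem isRowModel_drawn {n : ℕ} (hn : 1 ≤ n) (R : Row) (hσ : AnglesMem n R.angles)
    (hdev : ∀ i ∈ Set.Icc 1 n, R.angles.ne i + R.angles.nw i + R.angles.sw i + R.angles.se i =
      2 * Real.pi) :
    IsRowModel n R.angles R.len (drawnVertex R) (fun i => unitVec (drawnRowAngle R.angles i))
      (drawnUpper n R.angles) (drawnLower n R.angles) where
  succ i _ := rfl
  unit i _ := norm_unitVec _
  upper := by
    refine IsCreaseChain.of_unit (u := fun i => unitVec (drawnRowAngle R.angles i + R.angles.ne i))
      hn hσ.ne hσ.nw (fun i _ => norm_unitVec _) ?_ ?_ ?_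
    · rw [inner_unitVec, ← Real.cos_pi_sub, ← Real.cos_neg]
      congr 1
      simp only [drawnRowAngle]; ring
    · intro i hi
      rw [inner_unitVec, ← Real.cos_neg]
      congr 1; ring
    · intro i h1 h2
      rw [← unitVec_combination_upper (drawnRowAngle R.angles i)]
      congr 3
      simp only [drawnRowAngle]; ring
  lower := by
    refine IsCreaseChain.of_unit (u := fun i => unitVec (drawnRowAngle R.angles i - R.angles.se i))
      hn hσ.se hσ.sw (fun i _ => norm_unitVec _) ?_ ?_ ?_
    · rw [inner_unitVec, ← Real.cos_pi_sub]
      congr 1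
      have := hdev 1 ⟨le_rfl, hn⟩
      simp only [drawnRowAngle]; linarith
    · intro i hi
      rw [inner_unitVec]
      congr 1; ring
    · intro i h1 h2
      rw [← unitVec_combination_lower (drawnRowAngle R.angles i)]
      congr 3
      have := hdev (i + 1) ⟨by omega, h2⟩
      simp only [drawnRowAngle]; linarith

theorem diagProd_eq (σ : SectorAngles) (i : ℕ) :
    σ.diagProd i = Matrix.diagonal ![scale σ.ne σ.nw (i + 1), scale σ.se σ.sw (i + 1)] := by
  induction i with
  | zero =>
    rw [SectorAngles.diagProd, scale_one, scale_one]
    ext a b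
    fin_cases a <;> fin_cases b <;> simp
  | succ i ih =>
    rw [SectorAngles.diagProd, ih, Matrix.diagonal_mul_diagonal,
      scale_succ σ.ne σ.nw (i := i + 1) (by omega),
      scale_succ σ.se σ.sw (i := i + 1) (by omega)]
    congr 1
    ext a
    fin_cases a <;> rfl

/-- The oblique coordinates of the target curve, relative to its point on the datum row. -/
def offset (R : Row) (θ : ℝ) (f : ℝ → Plane) (t₀ t : ℝ) : Fin 2 → ℝ :=
  sheared R θ f t - sheared R θ f t₀

theorem diagProd_mulVec (σ : SectorAngles) (i : ℕ) (v : Fin 2 → ℝ) :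
    (σ.diagProd i).mulVec v 0 = scale σ.ne σ.nw (i + 1) * v 0 ∧
      (σ.diagProd i).mulVec v 1 = scale σ.se σ.sw (i + 1) * v 1 := by
  rw [diagProd_eq, Matrix.mulVec_diagonal, Matrix.mulVec_diagonal]
  exact ⟨rfl, rfl⟩

theorem innerColumn_eq {n : ℕ} (R : Row) (θ : ℝ) (f : ℝ → Plane) (t₀ t : ℝ) {i : ℕ}
    (hi : i ∈ Set.Icc 1 n) :
    innerColumn R θ f t₀ i t = drawnVertex R i + offset R θ f t₀ t 0 • drawnUpper n R.angles i +
      offset R θ f t₀ t 1 • drawnLower n R.angles i := by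
  have h1 : i - 1 + 1 = i := Nat.sub_add_cancel hi.1
  obtain ⟨h2, h3⟩ := diagProd_mulVec R.angles (i - 1) (offset R θ f t₀ t)
  rw [h1] at h2 h3
  simp only [innerColumn, drawnUpper, drawnLower, clampIdx_of_mem hi]
  rw [offset] at h2 h3 ⊢
  rw [h2, h3, mul_comm, mul_smul, mul_comm (scale _ _ _), mul_smul]

theorem drawnColumn_eq {n : ℕ} (hn : 1 ≤ n) (R : Row) (θ : ℝ) (f : ℝ → Plane) (t₀ t : ℝ) {i : ℕ}
    (hi : i ≤ n + 1) :
    drawnColumn n R θ f t₀ i t = drawnVertex R i + offset R θ f t₀ t 0 • drawnUpper n R.angles i +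
      offset R θ f t₀ t 1 • drawnLower n R.angles i := by
  unfold drawnColumn
  split_ifs with h1 h2
  · subst h1
    rw [innerColumn_eq R θ f t₀ t (n := n) ⟨le_rfl, hn⟩]
    simp only [drawnUpper, drawnLower, clampIdx_of_mem (show 1 ∈ Set.Icc 1 n from ⟨le_rfl, hn⟩),
      clampIdx_zero]
    abel
  · subst h2
    rw [innerColumn_eq R θ f t₀ t (n := n) ⟨hn, le_rfl⟩]
    simp only [drawnUpper, drawnLower, clampIdx_of_mem (show n ∈ Set.Icc 1 n from ⟨hn, le_rfl⟩),
      clampIdx_succ hn]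
    abel
  · exact innerColumn_eq R θ f t₀ t ⟨by omega, by omega⟩

theorem continuousOn_offset {R : Row} {θ : ℝ} {f : ℝ → Plane} {c d : ℝ}
    (hf : ContinuousOn f (Set.Icc c d)) (t₀ : ℝ) (k : Fin 2) :
    ContinuousOn (fun t => offset R θ f t₀ t k) (Set.Icc c d) := by
  have h1 : ∀ l : Fin 2, ContinuousOn (fun t => f t l) (Set.Icc c d) := fun l =>
    (EuclideanSpace.proj l).continuous.comp_continuousOn hf
  simp only [offset, sheared, Pi.sub_apply, Matrix.mulVec, dotProduct, Fin.sum_univ_two]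
  exact (((continuousOn_const.mul (h1 0)).add (continuousOn_const.mul (h1 1))).sub
    continuousOn_const)

theorem exists_pos_le_of_forall {n : ℕ} {p : ℕ → ℝ → Prop}
    (hp : ∀ i, ∀ r s, p i r → s ≤ r → p i s) (h : ∀ i < n, ∃ r > 0, p i r) :
    ∃ r > 0, ∀ i < n, p i r := by
  induction n with
  | zero => exact ⟨1, one_pos, fun i hi => absurd hi (Nat.not_lt_zero i)⟩
  | succ n ih =>
    obtain ⟨r, hr, h1⟩ := ih fun i hi => h i (by omega)
    obtain ⟨r', hr', h2⟩ := h n (by omega)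
    refine ⟨min r r', lt_min hr hr', fun i hi => ?_⟩
    rcases Nat.lt_succ_iff_lt_or_eq.1 hi with h3 | rfl
    · exact hp _ _ _ (h1 i h3) (min_le_left _ _)
    · exact hp _ _ _ h2 (min_le_right _ _)

theorem abs_sub_smul_le {V : Type*} [NormedAddCommGroup V] [NormedSpace ℝ V] (p u d : V)
    {x y X Y η : ℝ} (hx : |x - X| ≤ η) (hy : |y - Y| ≤ η) :
    dist (p + x • u + y • d) (p + X • u + Y • d) ≤ η * (‖u‖ + ‖d‖) := by
  have h : p + x • u + y • d - (p + X • u + Y • d) = (x - X) • u + (y - Y) • d := by module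
  rw [dist_eq_norm, h, mul_add]
  refine (norm_add_le _ _).trans ?_
  rw [norm_smul, norm_smul, Real.norm_eq_abs, Real.norm_eq_abs]
  exact add_le_add (mul_le_mul_of_nonneg_right hx (norm_nonneg _))
    (mul_le_mul_of_nonneg_right hy (norm_nonneg _))

/-- If a design can be drawn, then the mesh over every sufficiently fine staircase along its target
curve is a creased paper, with row creases of positive length. -/
theorem exists_accuracy_isCreasedPaper {n : ℕ} (hn : 1 ≤ n) {R : Row} (hσ : AnglesMem n R.angles)
    (hdev : ∀ i ∈ Set.Icc 1 n, R.angles.ne i + R.angles.nw i + R.angles.sw i + R.angles.se i =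
      2 * Real.pi)
    (hL : ∀ i ≤ n, 0 < R.len i) {θ : ℝ} {f : ℝ → Plane} {c d t₀ : ℝ}
    (hf : ContinuousOn f (Set.Icc c d)) (hcd : c ≤ d)
    (hdraw : IsDrawable n R θ f c d t₀) :
    ∃ η₀ > 0, ∀ (m j₀ : ℕ) (x y : ℕ → ℝ), IsStaircase j₀ x y →
      (∀ j ≤ m, ∃ t ∈ Set.Icc c d,
        |x j - offset R θ f t₀ t 0| ≤ η₀ ∧ |y j - offset R θ f t₀ t 1| ≤ η₀ ∧
        |x (j + 1) - offset R θ f t₀ t 0| ≤ η₀ ∧ |y (j + 1) - offset R θ f t₀ t 1| ≤ η₀) →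
      IsCreasedPaper n m (mesh (drawnVertex R) (drawnUpper n R.angles)
        (drawnLower n R.angles) x y) ∧
      ∀ i ≤ n, ∀ j ≤ m + 1, 0 < rung n R.angles R.len x y i j := by
  set X : ℝ → ℝ := fun t => offset R θ f t₀ t 0 with hX
  set Y : ℝ → ℝ := fun t => offset R θ f t₀ t 1 with hY
  have hXc : ContinuousOn X (Set.Icc c d) := continuousOn_offset hf t₀ 0
  have hYc : ContinuousOn Y (Set.Icc c d) := continuousOn_offset hf t₀ 1
  have hM := isRowModel_drawn hn R hσ hdev
  set U := drawnUpper n R.angles with hU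
  set D := drawnLower n R.angles with hD
  have hcol : ∀ i ≤ n + 1, ∀ t, drawnColumn n R θ f t₀ i t =
      drawnVertex R i + X t • U i + Y t • D i := fun i hi t => drawnColumn_eq hn R θ f t₀ t hi
  set a : ℕ → ℝ := shear n R.angles.ne R.angles.nw with ha
  set b : ℕ → ℝ := shear n R.angles.se R.angles.sw with hb
  have hlen : ∀ i ≤ n, ∀ t ∈ Set.Icc c d, 0 < R.len i - X t * a i - Y t * b i := by
    intro i hi t ht
    rcases Nat.eq_zero_or_pos i with rfl | h0
    · simpa [ha, hb, shear_zero] using hL 0 hi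
    rcases hi.eq_or_lt with rfl | h1
    · simpa [ha, hb, shear_last] using hL i le_rfl
    have h2 := hdraw.columns i h0 h1 t ht
    rw [hcol _ (by omega), hcol _ (by omega), hM.succ i hi, hM.upper.succ i hi,
      hM.lower.succ i hi] at h2
    have h3 : drawnVertex R i + R.len i • unitVec (drawnRowAngle R.angles i) +
        X t • (U i - a i • unitVec (drawnRowAngle R.angles i)) +
        Y t • (D i - b i • unitVec (drawnRowAngle R.angles i)) -
        (drawnVertex R i + X t • U i + Y t • D i) =
        (R.len i - X t * a i - Y t * b i) • unitVec (drawnRowAngle R.angles i) := by module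
    rw [h3, real_inner_smul_left, inner_unitVec, sub_self, Real.cos_zero, mul_one] at h2
    exact h2
  have hne : (Set.Icc c d).Nonempty := Set.nonempty_Icc.2 hcd
  -- an accuracy at which the row creases stay positive
  obtain ⟨η₁, hη₁, h1⟩ : ∃ r > 0, ∀ i < n + 1, ∀ t ∈ Set.Icc c d, ∀ x' y' : ℝ,
      |x' - X t| ≤ r → |y' - Y t| ≤ r → 0 < R.len i - x' * a i - y' * b i := by
    refine exists_pos_le_of_forall
      (fun i r s h hs t ht x' y' hx hy => h t ht x' y' (hx.trans hs) (hy.trans hs)) ?_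
    intro i hi
    obtain ⟨t₁, ht₁, hmin⟩ := isCompact_Icc.exists_isMinOn hne
      (((continuousOn_const (c := R.len i)).sub (hXc.mul_const (a i))).sub (hYc.mul_const (b i)))
    have hpos := hlen i (by omega) t₁ ht₁
    set μ := R.len i - X t₁ * a i - Y t₁ * b i with hμ
    refine ⟨μ / (2 * (|a i| + |b i| + 1)), by positivity, ?_⟩
    intro t ht x' y' hx hy
    have h2 : μ ≤ R.len i - X t * a i - Y t * b i := hmin ht
    have h3 : (x' - X t) * a i ≤ μ / (2 * (|a i| + |b i| + 1)) * |a i| := by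
      refine (le_abs_self _).trans ?_
      rw [abs_mul]
      exact mul_le_mul_of_nonneg_right hx (abs_nonneg _)
    have h4 : (y' - Y t) * b i ≤ μ / (2 * (|a i| + |b i| + 1)) * |b i| := by
      refine (le_abs_self _).trans ?_
      rw [abs_mul]
      exact mul_le_mul_of_nonneg_right hy (abs_nonneg _)
    have h5 : μ / (2 * (|a i| + |b i| + 1)) * |a i| + μ / (2 * (|a i| + |b i| + 1)) * |b i| +
        μ / (2 * (|a i| + |b i| + 1)) = μ / 2 := by field_simp
    have h6 : 0 < μ / (2 * (|a i| + |b i| + 1)) := by positivity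
    linarith
  -- an accuracy at which strips that are not neighbours stay disjoint
  have hcompact : ∀ i ≤ n, IsCompact (drawnStrip n R θ f c d t₀ i) := by
    intro i hi
    have hS : drawnStrip n R θ f c d t₀ i = (fun p : ℝ × ℝ =>
        AffineMap.lineMap (drawnColumn n R θ f t₀ i p.1) (drawnColumn n R θ f t₀ (i + 1) p.1) p.2)
          '' (Set.Icc c d ×ˢ Set.Icc 0 1) := by
      ext z
      simp only [drawnStrip, Set.mem_ofPred_eq, segment_eq_image_lineMap, Set.mem_image,
        Set.mem_prod, Prod.exists]
      constructor
      · rintro ⟨t, ht, s, hs, rfl⟩; exact ⟨t, s, ⟨ht, hs⟩, rfl⟩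
      · rintro ⟨t, s, ⟨ht, hs⟩, rfl⟩; exact ⟨t, ht, s, hs, rfl⟩
    rw [hS]
    refine (isCompact_Icc.prod isCompact_Icc).image_of_continuousOn ?_
    have hc : ∀ i ≤ n + 1, ContinuousOn (fun p : ℝ × ℝ => drawnColumn n R θ f t₀ i p.1)
        (Set.Icc c d ×ˢ Set.Icc 0 1) := by
      intro i hi
      have : ContinuousOn (fun t => drawnColumn n R θ f t₀ i t) (Set.Icc c d) := by
        simp only [hcol i hi]
        exact (continuousOn_const.add (hXc.smul continuousOn_const)).add
          (hYc.smul continuousOn_const)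
      exact this.comp continuousOn_fst fun p hp => hp.1
    simp only [AffineMap.lineMap_apply_module']
    exact (continuousOn_snd.smul ((hc _ (by omega)).sub (hc _ (by omega)))).add (hc _ (by omega))
  obtain ⟨η₂, hη₂, h2⟩ : ∃ r > 0, ∀ i < n + 1, ∀ i' < n + 1, i + 2 ≤ i' →
      Disjoint (Metric.cthickening r (drawnStrip n R θ f c d t₀ i))
        (Metric.cthickening r (drawnStrip n R θ f c d t₀ i')) := by
    refine exists_pos_le_of_forall (fun i r s h hs i' hi' hii => (h i' hi' hii).mono
      (Metric.cthickening_mono hs _) (Metric.cthickening_mono hs _)) ?_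
    intro i hi
    refine exists_pos_le_of_forall (fun i' r s h hs hii => (h hii).mono
      (Metric.cthickening_mono hs _) (Metric.cthickening_mono hs _)) ?_
    intro i' hi'
    by_cases hii : i + 2 ≤ i'
    · obtain ⟨r, hr, h3⟩ := (hdraw.strips i i' hii (by omega)).exists_cthickenings
        (hcompact i (by omega)) (hcompact i' (by omega)).isClosed
      exact ⟨r, hr, fun _ => h3⟩
    · exact ⟨1, one_pos, fun h => absurd h hii⟩
  obtain ⟨η₃, hη₃, h3⟩ : ∃ r > 0, ∀ i < n + 2, r * (‖U i‖ + ‖D i‖) ≤ η₂ := by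
    refine exists_pos_le_of_forall (fun i r s h hs =>
      (mul_le_mul_of_nonneg_right hs (by positivity)).trans h) ?_
    intro i _
    refine ⟨η₂ / (‖U i‖ + ‖D i‖ + 1), by positivity, ?_⟩
    rw [div_mul_eq_mul_div, div_le_iff₀ (by positivity)]
    nlinarith [norm_nonneg (U i), norm_nonneg (D i)]
  refine ⟨min η₁ η₃, lt_min hη₁ hη₃, ?_⟩
  intro m j₀ x y hxy happ
  have hrung : ∀ i ≤ n, ∀ j ≤ m + 1, 0 < rung n R.angles R.len x y i j := by
    intro i hi j hj
    rcases hj.eq_or_lt with rfl | hj'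
    · obtain ⟨t, ht, -, -, h4, h5⟩ := happ m le_rfl
      exact h1 i (by omega) t ht _ _ (h4.trans (min_le_left _ _)) (h5.trans (min_le_left _ _))
    · obtain ⟨t, ht, h4, h5, -, -⟩ := happ j (by omega)
      exact h1 i (by omega) t ht _ _ (h4.trans (min_le_left _ _)) (h5.trans (min_le_left _ _))
  refine ⟨?_, hrung⟩
  have hpanel : ∀ i ≤ n, ∀ j ≤ m, panel (mesh (drawnVertex R) U D x y) i j ⊆
      Metric.cthickening η₂ (drawnStrip n R θ f c d t₀ i) := by
    intro i hi j hj
    obtain ⟨t, ht, e1, e2, e3, e4⟩ := happ j hj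
    have hseg : segment ℝ (drawnColumn n R θ f t₀ i t) (drawnColumn n R θ f t₀ (i + 1) t) ⊆
        drawnStrip n R θ f c d t₀ i := fun z hz => ⟨t, ht, hz⟩
    refine Set.Subset.trans ?_ (Metric.cthickening_subset_of_subset η₂ hseg)
    refine convexHull_min ?_ ((convex_segment _ _).cthickening _)
    have hcl : ∀ i' < n + 2, ∀ j', |x j' - X t| ≤ min η₁ η₃ → |y j' - Y t| ≤ min η₁ η₃ →
        drawnColumn n R θ f t₀ i' t ∈
          segment ℝ (drawnColumn n R θ f t₀ i t) (drawnColumn n R θ f t₀ (i + 1) t) →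
        mesh (drawnVertex R) U D x y i' j' ∈ Metric.cthickening η₂
          (segment ℝ (drawnColumn n R θ f t₀ i t) (drawnColumn n R θ f t₀ (i + 1) t)) := by
      intro i' hi' j' hx hy hmem
      refine Metric.mem_cthickening_of_dist_le _ _ _ _ hmem ?_
      rw [hcol i' (by omega)]
      exact (abs_sub_smul_le _ _ _ (hx.trans (min_le_right _ _))
        (hy.trans (min_le_right _ _))).trans (h3 i' hi')
    rintro _ ⟨k, hk, rfl⟩
    simp only [corners, Set.mem_insert_iff, Set.mem_singleton_iff] at hk
    rcases hk with rfl | rfl | rfl | rfl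
    · exact hcl i (by omega) j e1 e2 (left_mem_segment _ _ _)
    · exact hcl (i + 1) (by omega) j e1 e2 (right_mem_segment _ _ _)
    · exact hcl (i + 1) (by omega) (j + 1) e3 e4 (right_mem_segment _ _ _)
    · exact hcl i (by omega) (j + 1) e3 e4 (left_mem_segment _ _ _)
  refine hM.isCreasedPaper hxy hrung ?_ ?_ ?_ ?_
  · intro i hi
    rcases Nat.eq_zero_or_pos i with rfl | h0
    · have h4 := hσ.nw 1 ⟨le_rfl, hn⟩
      simp only [hU, drawnUpper, clampIdx_zero]
      rw [planeDet_smul_right, planeDet_unitVec, scale_one, one_mul]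
      simp only [drawnRowAngle]
      refine Real.sin_pos_of_mem_Ioo ⟨?_, ?_⟩ <;> linarith [h4.1, h4.2]
    · have h4 := hσ.ne i ⟨h0, hi⟩
      simp only [hU, drawnUpper, clampIdx_of_mem (show i ∈ Set.Icc 1 n from ⟨h0, hi⟩)]
      rw [planeDet_smul_right, planeDet_unitVec]
      refine mul_pos (hσ.scale_upper_pos hi) (Real.sin_pos_of_mem_Ioo ?_)
      rwa [add_sub_cancel_left]
  · intro i hi
    rcases Nat.eq_zero_or_pos i with rfl | h0
    · have h4 := hσ.sw 1 ⟨le_rfl, hn⟩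
      have h5 := hdev 1 ⟨le_rfl, hn⟩
      simp only [hD, drawnLower, clampIdx_zero]
      rw [planeDet_smul_right, planeDet_unitVec, scale_one, one_mul]
      simp only [drawnRowAngle]
      refine Real.sin_neg_of_neg_of_neg_pi_lt ?_ ?_ <;> linarith [h4.1, h4.2]
    · have h4 := hσ.se i ⟨h0, hi⟩
      simp only [hD, drawnLower, clampIdx_of_mem (show i ∈ Set.Icc 1 n from ⟨h0, hi⟩)]
      rw [planeDet_smul_right, planeDet_unitVec]
      refine mul_neg_of_pos_of_neg (hσ.scale_lower_pos hi)
        (Real.sin_neg_of_neg_of_neg_pi_lt ?_ ?_) <;> linarith [h4.1, h4.2]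
  · intro i hi heq
    have h4 := hσ (i + 1) ⟨by omega, hi⟩
    have h5 := hdev (i + 1) ⟨by omega, hi⟩
    have h6 := congrArg (fun v => inner ℝ v (unitVec (drawnRowAngle R.angles i))) heq
    simp only [inner_neg_left, inner_unitVec, sub_self, Real.cos_zero] at h6
    have h7 : drawnRowAngle R.angles (i + 1) - drawnRowAngle R.angles i =
        Real.pi - (R.angles.ne (i + 1) + R.angles.nw (i + 1)) := by
      simp only [drawnRowAngle]; ring
    rw [h7, Real.cos_pi_sub, neg_inj, Real.cos_eq_one_iff_of_lt_of_lt] at h6 <;>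
      linarith [h4.1.1, h4.2.1.1, h4.2.2.1.1, h4.2.2.2.1]
  · intro i i' hii hi' j hj j' hj'
    exact (h2 i (by omega) i' (by omega) hii).mono (hpanel i (by omega) j hj)
      (hpanel i' (by omega) j' hj')

/-! ### Vectors of space with prescribed inner products -/

theorem inner_coord (v w : Space) : inner ℝ v w = v 0 * w 0 + v 1 * w 1 + v 2 * w 2 := by
  simp [PiLp.inner_apply, Fin.sum_univ_three, mul_comm]

/-- The determinant of three vectors of space. -/
def triple (a b c : Space) : ℝ :=
  a 0 * (b 1 * c 2 - b 2 * c 1) - a 1 * (b 0 * c 2 - b 2 * c 0) + a 2 * (b 0 * c 1 - b 1 * c 0)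

theorem triple_smul_right (a b c : Space) (r : ℝ) : triple a b (r • c) = r * triple a b c := by
  simp [triple]; ring

theorem triple_neg_right (a b c : Space) : triple a b (-c) = -triple a b c := by
  simp [triple]; ring

theorem triple_sub_right (a b c c' : Space) :
    triple a b (c - c') = triple a b c - triple a b c' := by
  simp [triple]; ring

/-- The product of two determinants with two common vectors is a determinant of inner products. -/
theorem triple_mul_triple (a b c c' : Space) :
    triple a b c * triple a b c' =
      inner ℝ a a * (inner ℝ b b * inner ℝ c c' - inner ℝ b c' * inner ℝ c b) -
        inner ℝ a b * (inner ℝ a b * inner ℝ c c' - inner ℝ b c' * inner ℝ c a) +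
        inner ℝ a c' * (inner ℝ a b * inner ℝ c b - inner ℝ b b * inner ℝ c a) := by
  simp only [inner_coord, triple]; ring

theorem triple_eq_zero_of_gram {a b : Space}
    (h : inner ℝ a a * inner ℝ b b - inner ℝ a b ^ 2 = 0) (c : Space) : triple a b c = 0 := by
  set x := a 1 * b 2 - a 2 * b 1 with hx
  set y := a 2 * b 0 - a 0 * b 2 with hy
  set z := a 0 * b 1 - a 1 * b 0 with hz
  have h1 : x ^ 2 + y ^ 2 + z ^ 2 = 0 := by
    rw [← h]; simp only [inner_coord, hx, hy, hz]; ring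
  have hx0 : x = 0 := by nlinarith [sq_nonneg x, sq_nonneg y, sq_nonneg z]
  have hy0 : y = 0 := by nlinarith [sq_nonneg x, sq_nonneg y, sq_nonneg z]
  have hz0 : z = 0 := by nlinarith [sq_nonneg x, sq_nonneg y, sq_nonneg z]
  have : triple a b c = x * c 0 + y * c 1 + z * c 2 := by
    simp only [triple, hx, hy, hz]; ring
  rw [this, hx0, hy0, hz0]; ring

/-- A vector of given length is determined by its inner products with two other vectors and by the side
of their plane on which it lies. -/
theorem eq_of_inner_eq {a b c c' : Space} (hn : ‖c‖ = ‖c'‖) (ha : inner ℝ a c = inner ℝ a c')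
    (hb : inner ℝ b c = inner ℝ b c') (h : 0 < triple a b c * triple a b c') : c = c' := by
  have ha' : inner ℝ c a = inner ℝ c' a := by rw [real_inner_comm, ha, real_inner_comm]
  have hb' : inner ℝ c b = inner ℝ c' b := by rw [real_inner_comm, hb, real_inner_comm]
  have hsq : triple a b c ^ 2 = triple a b c' ^ 2 := by
    rw [sq, sq, triple_mul_triple, triple_mul_triple, ha, hb, ha', hb',
      real_inner_self_eq_norm_sq c, real_inner_self_eq_norm_sq c', hn]
  have heq : triple a b c = triple a b c' := by
    rcases sq_eq_sq_iff_eq_or_eq_neg.1 hsq with h1 | h1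
    · exact h1
    · rw [h1] at h
      nlinarith [sq_nonneg (triple a b c')]
  have h0 : triple a b (c - c') = 0 := by rw [triple_sub_right, heq, sub_self]
  have h1 : inner ℝ a (c - c') = 0 := by rw [inner_sub_right, ha, sub_self]
  have h2 : inner ℝ b (c - c') = 0 := by rw [inner_sub_right, hb, sub_self]
  have h3 := triple_mul_triple a b (c - c') (c - c')
  rw [h0, h1, h2] at h3
  have h4 : (inner ℝ a a * inner ℝ b b - inner ℝ a b ^ 2) * inner ℝ (c - c') (c - c') = 0 := by
    linarith
  rcases mul_eq_zero.1 h4 with h5 | h5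
  · rw [triple_eq_zero_of_gram h5, zero_mul] at h
    exact absurd h (lt_irrefl 0)
  · exact sub_eq_zero.1 (inner_self_eq_zero.1 h5)

/-! ### Dihedral angles -/

section Perp

variable {V : Type*} [NormedAddCommGroup V] [InnerProductSpace ℝ V]

/-- The component of `v` orthogonal to the unit vector `e`. -/
def perp (e v : V) : V := v - inner ℝ e v • e

theorem perp_smul (e v : V) (r : ℝ) : perp e (r • v) = r • perp e v := by
  simp only [perp, real_inner_smul_right]; module

theorem perp_neg (e v : V) : perp e (-v) = -perp e v := by
  simp only [perp, inner_neg_right]; module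

theorem inner_perp {e : V} (he : ‖e‖ = 1) (v w : V) :
    inner ℝ (perp e v) (perp e w) = inner ℝ v w - inner ℝ e v * inner ℝ e w := by
  simp only [perp, inner_sub_left, inner_sub_right, real_inner_smul_left, real_inner_smul_right,
    real_inner_self_eq_norm_sq, he, real_inner_comm e v]
  ring

theorem norm_perp {e v : V} (he : ‖e‖ = 1) (hv : ‖v‖ = 1) {a : ℝ} (ha : a ∈ Set.Ioo 0 Real.pi)
    (h : inner ℝ e v = Real.cos a) : ‖perp e v‖ = Real.sin a := by
  have h1 : ‖perp e v‖ ^ 2 = Real.sin a ^ 2 := by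
    rw [← real_inner_self_eq_norm_sq, inner_perp he, h, real_inner_self_eq_norm_sq, hv,
      Real.sin_sq]
    ring
  exact (sq_eq_sq₀ (norm_nonneg _) (Real.sin_pos_of_mem_Ioo ha).le).1 h1

/-- The law of cosines of the spherical triangle with vertices `e`, `u`, `d`. -/
theorem inner_eq_of_perp_angle {e u d : V} (he : ‖e‖ = 1) (hu : ‖u‖ = 1) (hd : ‖d‖ = 1) {a b : ℝ}
    (ha : a ∈ Set.Ioo 0 Real.pi) (hb : b ∈ Set.Ioo 0 Real.pi) (h : inner ℝ e u = Real.cos a)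
    (h' : inner ℝ e d = Real.cos b) :
    inner ℝ u d = Real.cos a * Real.cos b + Real.sin a * Real.sin b *
      Real.cos (InnerProductGeometry.angle (perp e u) (perp e d)) := by
  have hsa := (Real.sin_pos_of_mem_Ioo ha).ne'
  have hsb := (Real.sin_pos_of_mem_Ioo hb).ne'
  rw [InnerProductGeometry.cos_angle, norm_perp he hu ha h, norm_perp he hd hb h',
    inner_perp he, h, h']
  field_simp
  ring

/-- Two unit vectors in the same half-plane bounded by the line of the unit vector `e` differ, after
scaling to equal height, by a multiple of `e`. -/
theorem panel_relation {e u u' : V} (he : ‖e‖ = 1) (hu : ‖u‖ = 1) (hu' : ‖u'‖ = 1) {a b : ℝ}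
    (ha : a ∈ Set.Ioo 0 Real.pi) (hb : b ∈ Set.Ioo 0 Real.pi) (h : inner ℝ e u = Real.cos a)
    (h' : inner ℝ e u' = -Real.cos b) {x y : ℝ} (hy : 0 < y) (heq : u' = x • e + y • u) :
    Real.sin b • u - Real.sin a • u' = Real.sin (a + b) • e := by
  have hsa := Real.sin_pos_of_mem_Ioo ha
  have hsb := Real.sin_pos_of_mem_Ioo hb
  have h1 : x + y * Real.cos a = -Real.cos b := by
    rw [← h', heq, inner_add_right, real_inner_smul_right, real_inner_smul_right, h,
      real_inner_self_eq_norm_sq, he]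
    ring
  have h2 : x ^ 2 + 2 * x * y * Real.cos a + y ^ 2 = 1 := by
    have h3 : inner ℝ u' u' = (1 : ℝ) := by rw [real_inner_self_eq_norm_sq, hu', one_pow]
    have he' : inner ℝ e e = (1 : ℝ) := by rw [real_inner_self_eq_norm_sq, he, one_pow]
    have hu' : inner ℝ u u = (1 : ℝ) := by rw [real_inner_self_eq_norm_sq, hu, one_pow]
    rw [← h3, heq]
    simp only [inner_add_left, inner_add_right, real_inner_smul_left, real_inner_smul_right,
      he', hu', real_inner_comm e u, h]
    ring
  have h3 : (y * Real.sin a) ^ 2 = Real.sin b ^ 2 := by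
    rw [mul_pow, Real.sin_sq, Real.sin_sq]
    have : x = -Real.cos b - y * Real.cos a := by linarith
    rw [this] at h2
    linarith
  have h4 : y * Real.sin a = Real.sin b :=
    (sq_eq_sq₀ (mul_pos hy hsa).le hsb.le).1 h3
  have h5 : x = -Real.cos b - y * Real.cos a := by linarith
  rw [heq, Real.sin_add, ← h4, h5]
  module

/-- The law of cosines at the other end of the row crease `e`, where the creases `u'`, `d'` lie in the
same half-planes as `u`, `d`. -/
theorem inner_across {e u d u' d' : V} (he : ‖e‖ = 1) {a a' b b' C : ℝ} (hsa : Real.sin a ≠ 0)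
    (hsa' : Real.sin a' ≠ 0) (hu : inner ℝ e u = Real.cos a) (hd : inner ℝ e d = Real.cos a')
    (hud : inner ℝ u d = Real.cos a * Real.cos a' + Real.sin a * Real.sin a' * C)
    (hu' : Real.sin b • u - Real.sin a • u' = Real.sin (a + b) • e)
    (hd' : Real.sin b' • d - Real.sin a' • d' = Real.sin (a' + b') • e) :
    inner ℝ u' d' = Real.cos b * Real.cos b' + Real.sin b * Real.sin b' * C ∧
      inner ℝ u d' = -Real.cos a * Real.cos b' + Real.sin a * Real.sin b' * C ∧
      inner ℝ u' d = -Real.cos b * Real.cos a' + Real.sin b * Real.sin a' * C := by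
  have e1 : Real.sin a • u' = Real.sin b • u - Real.sin (a + b) • e := by rw [← hu']; abel
  have e2 : Real.sin a' • d' = Real.sin b' • d - Real.sin (a' + b') • e := by rw [← hd']; abel
  have hue : inner ℝ u e = Real.cos a := by rw [real_inner_comm, hu]
  have k0 : Real.sin a * Real.sin a' * inner ℝ u' d' =
      Real.sin a * Real.sin a' * (Real.cos b * Real.cos b' + Real.sin b * Real.sin b' * C) := by
    have := congrArg₂ (fun v w => inner ℝ v w) e1 e2
    simp only [inner_sub_left, inner_sub_right, real_inner_smul_left, real_inner_smul_right,
      hud, hue, hd, real_inner_self_eq_norm_sq, he] at this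
    rw [Real.sin_add, Real.sin_add] at this
    linear_combination this
  have k1 : Real.sin a' * inner ℝ u d' =
      Real.sin a' * (-Real.cos a * Real.cos b' + Real.sin a * Real.sin b' * C) := by
    have := congrArg (fun w => inner ℝ u w) e2
    simp only [inner_sub_right, real_inner_smul_right, hud, hue] at this
    rw [Real.sin_add] at this
    linear_combination this
  have k2 : Real.sin a * inner ℝ u' d =
      Real.sin a * (-Real.cos b * Real.cos a' + Real.sin b * Real.sin a' * C) := by
    have := congrArg (fun w => inner ℝ w d) e1
    simp only [inner_sub_left, real_inner_smul_left, hud, hd] at this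
    rw [Real.sin_add] at this
    linear_combination this
  exact ⟨mul_left_cancel₀ (mul_ne_zero hsa hsa') k0, mul_left_cancel₀ hsa' k1,
    mul_left_cancel₀ hsa k2⟩

end Perp

theorem orthPart_smul_add {e : Space} (he : ‖e‖ = 1) {r : ℝ} (hr : r ≠ 0) (s : ℝ) (v : Space) :
    orthPart (r • e) (s • e + v) = perp e v := by
  have h1 : inner ℝ e e = (1 : ℝ) := by rw [real_inner_self_eq_norm_sq, he, one_pow]
  have h2 : inner ℝ (s • e + v) (r • e) / inner ℝ (r • e) (r • e) * r = s + inner ℝ e v := by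
    simp only [inner_add_left, real_inner_smul_left, real_inner_smul_right, h1,
      real_inner_comm e v]
    field_simp
  rw [orthPart, smul_smul, h2, perp]
  module

/-! ### The datum row in its final state -/

/-- The unit direction of the edge `i`. -/
def Row.dir (R : Row) (i : ℕ) : Space := (R.len i)⁻¹ • R.edge i

/-- The dihedral angle at the second edge of the row. -/
def Row.fold (R : Row) : ℝ := dihedral (R.A 1) (R.A 2) (R.A 1 + R.u 1) (R.A 1 + R.d 1)

theorem Row.norm_edge (R : Row) (i : ℕ) : ‖R.edge i‖ = R.len i := by
  rw [Row.len, dist_comm, dist_eq_norm]; rfl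

section Datum

variable {n : ℕ} {R : Row}

theorem IsDatumRow.len_pos (h : IsDatumRow n R) (hn : 1 ≤ n) {i : ℕ} (hi : i ≤ n) :
    0 < R.len i := by
  rw [Row.len, dist_pos]
  intro heq
  rcases Nat.eq_zero_or_pos i with rfl | h0
  · refine h.noncollinear 1 ⟨le_rfl, hn⟩ ?_
    rw [show 1 - 1 = 0 from rfl, heq, Set.insert_eq_of_mem (by simp)]
    exact collinear_pair ℝ _ _
  · refine h.noncollinear i ⟨h0, hi⟩ ?_
    rw [heq, Set.insert_eq_of_mem (a := R.A (i + 1)) (by simp)]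
    exact collinear_pair ℝ _ _

theorem IsDatumRow.edge_eq (h : IsDatumRow n R) (hn : 1 ≤ n) {i : ℕ} (hi : i ≤ n) :
    R.edge i = R.len i • R.dir i := by
  rw [Row.dir, smul_inv_smul₀ (h.len_pos hn hi).ne']

theorem IsDatumRow.norm_dir (h : IsDatumRow n R) (hn : 1 ≤ n) {i : ℕ} (hi : i ≤ n) :
    ‖R.dir i‖ = 1 := by
  have hl := h.len_pos hn hi
  rw [Row.dir, norm_smul, R.norm_edge, norm_inv, Real.norm_of_nonneg hl.le, inv_mul_cancel₀ hl.ne']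

theorem IsDatumRow.dir_ne (h : IsDatumRow n R) {i : ℕ} (hi : i < n) :
    R.dir (i + 1) ≠ R.dir i ∧ R.dir (i + 1) ≠ -R.dir i := by
  have hn : 1 ≤ n := by omega
  have key : ∀ r : ℝ, R.dir (i + 1) ≠ r • R.dir i := by
    intro r heq
    refine h.noncollinear (i + 1) ⟨by omega, hi⟩ ?_
    rw [collinear_iff_of_mem (p₀ := R.A (i + 1)) (by simp)]
    refine ⟨R.dir i, ?_⟩
    have e1 := h.edge_eq hn (i := i) hi.le
    have e2 := h.edge_eq hn (i := i + 1) hi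
    rw [heq, smul_smul] at e2
    simp only [Row.edge] at e1 e2
    intro p hp
    simp only [Set.mem_insert_iff, Set.mem_singleton_iff, Nat.add_sub_cancel] at hp
    rcases hp with rfl | rfl | rfl
    · refine ⟨-R.len i, ?_⟩
      rw [neg_smul, ← e1, vadd_eq_add]; abel
    · exact ⟨0, by simp⟩
    · refine ⟨R.len (i + 1) * r, ?_⟩
      rw [← e2, vadd_eq_add]; abel
  exact ⟨by simpa using key 1, by simpa using key (-1)⟩

theorem inner_eq_cos_angle {v w : Space} {r : ℝ} (hr : 0 < r) (hv : ‖v‖ = 1) (hw : ‖w‖ = 1) :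
    inner ℝ v w = Real.cos (InnerProductGeometry.angle (r • v) w) := by
  rw [InnerProductGeometry.angle_smul_left_of_pos _ _ hr, InnerProductGeometry.cos_angle, hv, hw]
  simp

theorem IsDatumRow.inner_ne (h : IsDatumRow n R) {i : ℕ} (hi : i ∈ Set.Icc 1 n) :
    inner ℝ (R.dir i) (R.u i) = Real.cos (R.angles.ne i) := by
  have hn : 1 ≤ n := hi.1.trans hi.2
  rw [inner_eq_cos_angle (h.len_pos hn hi.2) (h.norm_dir hn hi.2) (h.unit_u i hi),
    ← h.edge_eq hn hi.2]
  rfl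

theorem IsDatumRow.inner_se (h : IsDatumRow n R) {i : ℕ} (hi : i ∈ Set.Icc 1 n) :
    inner ℝ (R.dir i) (R.d i) = Real.cos (R.angles.se i) := by
  have hn : 1 ≤ n := hi.1.trans hi.2
  rw [inner_eq_cos_angle (h.len_pos hn hi.2) (h.norm_dir hn hi.2) (h.unit_d i hi),
    ← h.edge_eq hn hi.2]
  rfl

theorem IsDatumRow.inner_nw (h : IsDatumRow n R) {i : ℕ} (hi : i < n) :
    inner ℝ (R.dir i) (R.u (i + 1)) = -Real.cos (R.angles.nw (i + 1)) := by
  have hn : 1 ≤ n := by omega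
  rw [← neg_neg (R.dir i), inner_neg_left, inner_eq_cos_angle (h.len_pos hn hi.le)
    (by rw [norm_neg]; exact h.norm_dir hn hi.le) (h.unit_u _ ⟨by omega, hi⟩), smul_neg,
    ← h.edge_eq hn hi.le]
  rfl

theorem IsDatumRow.inner_sw (h : IsDatumRow n R) {i : ℕ} (hi : i < n) :
    inner ℝ (R.dir i) (R.d (i + 1)) = -Real.cos (R.angles.sw (i + 1)) := by
  have hn : 1 ≤ n := by omega
  rw [← neg_neg (R.dir i), inner_neg_left, inner_eq_cos_angle (h.len_pos hn hi.le)
    (by rw [norm_neg]; exact h.norm_dir hn hi.le) (h.unit_d _ ⟨by omega, hi⟩), smul_neg,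
    ← h.edge_eq hn hi.le]
  rfl

theorem IsDatumRow.anglesMem (h : IsDatumRow n R) : AnglesMem n R.angles := h.mem_Ioo

theorem IsDatumRow.upper_relation (h : IsDatumRow n R) {i : ℕ} (h1 : 1 ≤ i) (h2 : i + 1 ≤ n) :
    Real.sin (R.angles.nw (i + 1)) • R.u i - Real.sin (R.angles.ne i) • R.u (i + 1) =
      Real.sin (R.angles.ne i + R.angles.nw (i + 1)) • R.dir i := by
  have hn : 1 ≤ n := by omega
  obtain ⟨x, y, hy, heq⟩ := h.upper_panel i h1 h2
  rw [h.edge_eq hn (by omega : i ≤ n), smul_smul] at heq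
  exact panel_relation (h.norm_dir hn (by omega)) (h.unit_u i ⟨h1, by omega⟩)
    (h.unit_u _ ⟨by omega, h2⟩) (h.anglesMem.ne i ⟨h1, by omega⟩)
    (h.anglesMem.nw _ ⟨by omega, h2⟩) (h.inner_ne ⟨h1, by omega⟩) (h.inner_nw h2) hy heq

theorem IsDatumRow.lower_relation (h : IsDatumRow n R) {i : ℕ} (h1 : 1 ≤ i) (h2 : i + 1 ≤ n) :
    Real.sin (R.angles.sw (i + 1)) • R.d i - Real.sin (R.angles.se i) • R.d (i + 1) =
      Real.sin (R.angles.se i + R.angles.sw (i + 1)) • R.dir i := by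
  have hn : 1 ≤ n := by omega
  obtain ⟨x, y, hy, heq⟩ := h.lower_panel i h1 h2
  rw [h.edge_eq hn (by omega : i ≤ n), smul_smul] at heq
  exact panel_relation (h.norm_dir hn (by omega)) (h.unit_d i ⟨h1, by omega⟩)
    (h.unit_d _ ⟨by omega, h2⟩) (h.anglesMem.se i ⟨h1, by omega⟩)
    (h.anglesMem.sw _ ⟨by omega, h2⟩) (h.inner_se ⟨h1, by omega⟩) (h.inner_sw h2) hy heq

/-- The scaled upper creases of the row in space. -/
def Row.upper (n : ℕ) (R : Row) (i : ℕ) : Space :=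
  scale R.angles.ne R.angles.nw (clampIdx n i) • R.u (clampIdx n i)

/-- The scaled lower creases of the row in space. -/
def Row.lower (n : ℕ) (R : Row) (i : ℕ) : Space :=
  scale R.angles.se R.angles.sw (clampIdx n i) • R.d (clampIdx n i)

theorem IsDatumRow.isRowModel (h : IsDatumRow n R) (hn : 1 ≤ n) :
    IsRowModel n R.angles R.len R.A R.dir (R.upper n) (R.lower n) where
  succ i hi := by
    rw [← h.edge_eq hn hi, Row.edge]; abel
  unit i hi := h.norm_dir hn hi
  upper := IsCreaseChain.of_unit hn h.anglesMem.ne h.anglesMem.nw h.unit_u (h.inner_nw hn)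
    (fun i hi => h.inner_ne hi) (fun i h1 h2 => h.upper_relation h1 h2)
  lower := IsCreaseChain.of_unit hn h.anglesMem.se h.anglesMem.sw h.unit_d (h.inner_sw hn)
    (fun i hi => h.inner_se hi) (fun i h1 h2 => h.lower_relation h1 h2)

theorem IsDatumRow.developable (h : IsDatumRow n R) {i : ℕ} (hi : i ∈ Set.Icc 1 n) :
    R.angles.ne i + R.angles.nw i + R.angles.sw i + R.angles.se i = 2 * Real.pi := by
  rcases eq_or_lt_of_le hi.1 with rfl | h1
  · linarith [h.straight.1, h.straight.2]
  · have := h.flat_foldable i ⟨h1, hi.2⟩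
    linarith [this.1, this.2]

theorem IsDatumRow.fold_mem (h : IsDatumRow n R) : R.fold ∈ Set.Ioo 0 Real.pi := h.right_fold

theorem IsDatumRow.inner_first_left (h : IsDatumRow n R) (hn : 1 ≤ n) :
    inner ℝ (R.u 1) (R.d 1) = Real.cos (R.angles.nw 1) * Real.cos (R.angles.sw 1) +
      Real.sin (R.angles.nw 1) * Real.sin (R.angles.sw 1) := by
  have h1 : (1 : ℕ) ∈ Set.Icc 1 n := ⟨le_rfl, hn⟩
  have h0 := h.norm_dir hn (Nat.zero_le n)
  have hl := h.left_clash
  have he : R.A 1 - R.A 0 = R.len 0 • R.dir 0 := h.edge_eq hn (Nat.zero_le n)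
  rw [dihedral, add_sub_right_comm, add_sub_right_comm, he,
    orthPart_smul_add h0 (h.len_pos hn (Nat.zero_le n)).ne',
    orthPart_smul_add h0 (h.len_pos hn (Nat.zero_le n)).ne'] at hl
  have h2 := inner_eq_of_perp_angle (e := -R.dir 0) (by rw [norm_neg]; exact h0) (h.unit_u 1 h1)
    (h.unit_d 1 h1) (h.anglesMem.nw 1 h1) (h.anglesMem.sw 1 h1)
    (by rw [inner_neg_left, h.inner_nw hn, neg_neg])
    (by rw [inner_neg_left, h.inner_sw hn, neg_neg])
  have h3 : ∀ v, perp (-R.dir 0) v = perp (R.dir 0) v := fun v => by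
    simp only [perp, inner_neg_left]; module
  rw [h2, h3, h3, hl, Real.cos_zero, mul_one]

/-- The dihedral angle at all inner edges of the row, the first one excepted, is `R.fold`: a
flat-foldable vertex has the same dihedral angle at its two row creases. -/
theorem IsDatumRow.inner_ud (h : IsDatumRow n R) {i : ℕ} (hi : i ∈ Set.Icc 1 n) :
    inner ℝ (R.u i) (R.d i) = Real.cos (R.angles.ne i) * Real.cos (R.angles.se i) +
      Real.sin (R.angles.ne i) * Real.sin (R.angles.se i) * Real.cos R.fold := by
  obtain ⟨hi1, hi2⟩ := hi
  induction i, hi1 using Nat.le_induction with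
  | base =>
    have h1 : (1 : ℕ) ∈ Set.Icc 1 n := ⟨le_rfl, hi2⟩
    have h0 := h.norm_dir hi2 hi2
    have he : R.A 2 - R.A 1 = R.len 1 • R.dir 1 := h.edge_eq hi2 hi2
    rw [Row.fold, dihedral, add_sub_cancel_left, add_sub_cancel_left, he,
      ← zero_add (R.u 1), ← zero_add (R.d 1), ← zero_smul ℝ (R.dir 1),
      orthPart_smul_add h0 (h.len_pos hi2 hi2).ne', orthPart_smul_add h0 (h.len_pos hi2 hi2).ne']
    rw [zero_smul, zero_add, zero_add]
    exact inner_eq_of_perp_angle h0 (h.unit_u 1 h1) (h.unit_d 1 h1) (h.anglesMem.ne 1 h1)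
      (h.anglesMem.se 1 h1) (h.inner_ne h1) (h.inner_se h1)
  | succ i hi1 ih =>
    have hn : 1 ≤ n := by omega
    have hi : i ∈ Set.Icc 1 n := ⟨hi1, by omega⟩
    have hi' : i + 1 ∈ Set.Icc 1 n := ⟨by omega, hi2⟩
    have hf := h.flat_foldable (i + 1) ⟨by omega, hi2⟩
    rw [(inner_across (h.norm_dir hn hi.2)
      (Real.sin_pos_of_mem_Ioo (h.anglesMem.ne i hi)).ne'
      (Real.sin_pos_of_mem_Ioo (h.anglesMem.se i hi)).ne' (h.inner_ne hi) (h.inner_se hi)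
      (ih hi.2) (h.upper_relation hi1 hi2) (h.lower_relation hi1 hi2)).1,
      show R.angles.ne (i + 1) = Real.pi - R.angles.sw (i + 1) by linarith [hf.1],
      show R.angles.se (i + 1) = Real.pi - R.angles.nw (i + 1) by linarith [hf.2]]
    simp only [Real.cos_pi_sub, Real.sin_pi_sub]
    ring

/-- The folding angles of the two row creases at the straight-line vertex: its left crease is folded
completely, so that its right one has the half dihedral angle given here. -/
theorem IsDatumRow.sin_nw_first (h : IsDatumRow n R) (hn : 1 ≤ n) :
    Real.sin (R.angles.nw 1) = Real.sin (R.angles.ne 1) * Real.cos (R.fold / 2) := by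
  have h1 : (1 : ℕ) ∈ Set.Icc 1 n := ⟨le_rfl, hn⟩
  have e1 := h.inner_first_left hn
  rw [h.inner_ud h1, show R.angles.se 1 = Real.pi - R.angles.ne 1 by linarith [h.straight.1],
    show R.angles.sw 1 = Real.pi - R.angles.nw 1 by linarith [h.straight.2]] at e1
  simp only [Real.cos_pi_sub, Real.sin_pi_sub] at e1
  have hf := h.fold_mem
  have hc : 0 < Real.cos (R.fold / 2) :=
    Real.cos_pos_of_mem_Ioo ⟨by linarith [hf.1, Real.pi_pos], by linarith [hf.2]⟩
  have e2 : Real.cos R.fold = 2 * Real.cos (R.fold / 2) ^ 2 - 1 := by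
    rw [← Real.cos_two_mul]; congr 1; ring
  have s1 := Real.sin_sq_add_cos_sq (R.angles.nw 1)
  have s2 := Real.sin_sq_add_cos_sq (R.angles.ne 1)
  refine (sq_eq_sq₀ (Real.sin_pos_of_mem_Ioo (h.anglesMem.nw 1 h1)).le
    (mul_pos (Real.sin_pos_of_mem_Ioo (h.anglesMem.ne 1 h1)) hc).le).1 ?_
  rw [e2] at e1
  linear_combination (-1 / 2 : ℝ) * e1 + (1 / 2 : ℝ) * s1 - (1 / 2 : ℝ) * s2

theorem IsDatumRow.sin_nw_lt (h : IsDatumRow n R) (hn : 1 ≤ n) :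
    Real.sin (R.angles.nw 1) < Real.sin (R.angles.ne 1) := by
  have h1 : (1 : ℕ) ∈ Set.Icc 1 n := ⟨le_rfl, hn⟩
  have hf := h.fold_mem
  rw [h.sin_nw_first hn]
  refine mul_lt_of_lt_one_right (Real.sin_pos_of_mem_Ioo (h.anglesMem.ne 1 h1)) ?_
  rw [← Real.cos_zero]
  exact Real.cos_lt_cos_of_nonneg_of_le_pi_div_two le_rfl (by linarith [hf.2]) (by linarith [hf.1])

end Datum

/-! ### The column planes of the datum row -/

section Columns

variable {n : ℕ} {R : Row}

theorem IsDatumRow.inner_ud_left (h : IsDatumRow n R) {i : ℕ} (hi1 : 1 ≤ i) (hi2 : i + 1 ≤ n) :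
    inner ℝ (R.u (i + 1)) (R.d (i + 1)) =
      Real.cos (R.angles.nw (i + 1)) * Real.cos (R.angles.sw (i + 1)) +
        Real.sin (R.angles.nw (i + 1)) * Real.sin (R.angles.sw (i + 1)) * Real.cos R.fold ∧
    inner ℝ (R.u i) (R.d (i + 1)) =
      -Real.cos (R.angles.ne i) * Real.cos (R.angles.sw (i + 1)) +
        Real.sin (R.angles.ne i) * Real.sin (R.angles.sw (i + 1)) * Real.cos R.fold ∧
    inner ℝ (R.u (i + 1)) (R.d i) =
      -Real.cos (R.angles.nw (i + 1)) * Real.cos (R.angles.se i) +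
        Real.sin (R.angles.nw (i + 1)) * Real.sin (R.angles.se i) * Real.cos R.fold := by
  have hn : 1 ≤ n := by omega
  have hi : i ∈ Set.Icc 1 n := ⟨hi1, by omega⟩
  exact inner_across (h.norm_dir hn hi.2)
    (Real.sin_pos_of_mem_Ioo (h.anglesMem.ne i hi)).ne'
    (Real.sin_pos_of_mem_Ioo (h.anglesMem.se i hi)).ne' (h.inner_ne hi) (h.inner_se hi)
    (h.inner_ud hi) (h.upper_relation hi1 hi2) (h.lower_relation hi1 hi2)

theorem IsDatumRow.inner_uu (h : IsDatumRow n R) {i : ℕ} (hi1 : 1 ≤ i) (hi2 : i + 1 ≤ n) :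
    inner ℝ (R.u i) (R.u (i + 1)) =
      -Real.cos (R.angles.ne i + R.angles.nw (i + 1)) := by
  have hi : i ∈ Set.Icc 1 n := ⟨hi1, by omega⟩
  have hs := (Real.sin_pos_of_mem_Ioo (h.anglesMem.ne i hi)).ne'
  have e1 := congrArg (fun v => inner ℝ (R.u i) v) (h.upper_relation hi1 hi2)
  simp only [inner_sub_right, real_inner_smul_right, real_inner_self_eq_norm_sq, h.unit_u i hi,
    real_inner_comm (R.dir i) (R.u i), h.inner_ne hi] at e1
  refine mul_left_cancel₀ hs ?_
  rw [Real.sin_add] at e1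
  rw [Real.cos_add]
  linear_combination -e1 - Real.sin (R.angles.nw (i + 1)) *
    Real.sin_sq_add_cos_sq (R.angles.ne i)

theorem IsDatumRow.inner_dd (h : IsDatumRow n R) {i : ℕ} (hi1 : 1 ≤ i) (hi2 : i + 1 ≤ n) :
    inner ℝ (R.d i) (R.d (i + 1)) =
      -Real.cos (R.angles.se i + R.angles.sw (i + 1)) := by
  have hi : i ∈ Set.Icc 1 n := ⟨hi1, by omega⟩
  have hs := (Real.sin_pos_of_mem_Ioo (h.anglesMem.se i hi)).ne'
  have e1 := congrArg (fun v => inner ℝ (R.d i) v) (h.lower_relation hi1 hi2)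
  simp only [inner_sub_right, real_inner_smul_right, real_inner_self_eq_norm_sq, h.unit_d i hi,
    real_inner_comm (R.dir i) (R.d i), h.inner_se hi] at e1
  refine mul_left_cancel₀ hs ?_
  rw [Real.sin_add] at e1
  rw [Real.cos_add]
  linear_combination -e1 - Real.sin (R.angles.sw (i + 1)) *
    Real.sin_sq_add_cos_sq (R.angles.se i)

theorem IsDatumRow.inner_eq_cos (h : IsDatumRow n R) {i : ℕ} (hi : i ∈ Set.Icc 1 n) :
    inner ℝ (R.u i) (R.d i) = Real.cos (InnerProductGeometry.angle (R.u i) (R.d i)) := by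
  rw [InnerProductGeometry.cos_angle, h.unit_u i hi, h.unit_d i hi]
  simp

theorem angle_eq_arccos {v w : Space} (hv : ‖v‖ = 1) (hw : ‖w‖ = 1) :
    InnerProductGeometry.angle v w = Real.arccos (inner ℝ v w) := by
  rw [InnerProductGeometry.angle, hv, hw]
  simp

theorem IsDatumRow.angle_ud (h : IsDatumRow n R) {i : ℕ} (hi : i ∈ Set.Icc 1 n) :
    InnerProductGeometry.angle (R.u i) (R.d i) = R.angles.xi i := by
  obtain ⟨hi1, hi2⟩ := hi
  induction i, hi1 using Nat.le_induction with
  | base =>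
    have h1 : (1 : ℕ) ∈ Set.Icc 1 n := ⟨le_rfl, hi2⟩
    have h2 := h.anglesMem.nw 1 h1
    have h3 : inner ℝ (R.u 1) (R.d 1) = Real.cos |2 * R.angles.nw 1 - Real.pi| := by
      rw [Real.cos_abs, Real.cos_sub_pi, h.inner_first_left hi2,
        show R.angles.sw 1 = Real.pi - R.angles.nw 1 by linarith [h.straight.2],
        Real.cos_pi_sub, Real.sin_pi_sub, Real.cos_two_mul']
      ring
    rw [angle_eq_arccos (h.unit_u 1 h1) (h.unit_d 1 h1), h3, Real.arccos_cos (abs_nonneg _)]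
    · rfl
    · rw [abs_le]; constructor <;> linarith [h2.1, h2.2]
  | succ i hi1 ih =>
    have hi : i ∈ Set.Icc 1 n := ⟨hi1, by omega⟩
    have hi' : i + 1 ∈ Set.Icc 1 n := ⟨by omega, hi2⟩
    have hs1 := (Real.sin_pos_of_mem_Ioo (h.anglesMem.ne i hi)).ne'
    have hs2 := (Real.sin_pos_of_mem_Ioo (h.anglesMem.se i hi)).ne'
    have h1 := ih hi.2
    obtain ⟨k, rfl⟩ : ∃ k, i = k + 1 := ⟨i - 1, by omega⟩
    rw [angle_eq_arccos (h.unit_u _ hi') (h.unit_d _ hi'), (h.inner_ud_left hi1 hi2).1,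
      SectorAngles.xi, ← h1, ← h.inner_eq_cos hi, h.inner_ud hi]
    congr 2
    field_simp
    ring

theorem IsDatumRow.inner_eq_cos_xi (h : IsDatumRow n R) {i : ℕ} (hi : i ∈ Set.Icc 1 n) :
    inner ℝ (R.u i) (R.d i) = Real.cos (R.angles.xi i) := by
  rw [h.inner_eq_cos hi, h.angle_ud hi]

theorem IsDatumRow.sin_xi_pos (h : IsDatumRow n R) {i : ℕ} (hi : i ∈ Set.Icc 1 n) :
    0 < Real.sin (R.angles.xi i) := by
  have h0 : 0 ≤ Real.sin (R.angles.xi i) := by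
    rw [← h.angle_ud hi]
    exact InnerProductGeometry.sin_angle_nonneg _ _
  refine lt_of_le_of_ne h0 fun heq => ?_
  have h1 := Real.sin_sq_add_cos_sq (R.angles.xi i)
  rw [← heq, ← h.inner_eq_cos_xi hi, h.inner_ud hi] at h1
  have h2 := Real.sin_sq_add_cos_sq (R.angles.ne i)
  have h3 := Real.sin_sq_add_cos_sq (R.angles.se i)
  have h4 := Real.sin_sq_add_cos_sq R.fold
  have h5 : (Real.sin (R.angles.ne i) * Real.cos (R.angles.se i) -
      Real.cos (R.angles.ne i) * Real.sin (R.angles.se i) * Real.cos R.fold) ^ 2 +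
      (Real.sin (R.angles.se i) * Real.sin R.fold) ^ 2 = 0 := by
    generalize Real.sin (R.angles.ne i) = a at *
    generalize Real.cos (R.angles.ne i) = a' at *
    generalize Real.sin (R.angles.se i) = b at *
    generalize Real.cos (R.angles.se i) = b' at *
    generalize Real.sin R.fold = c at *
    generalize Real.cos R.fold = c' at *
    linear_combination -h1 + (b' ^ 2 + b ^ 2 * c' ^ 2) * h2 + h3 + b ^ 2 * h4
  have h6 : 0 < (Real.sin (R.angles.se i) * Real.sin R.fold) ^ 2 :=
    pow_pos (mul_pos (Real.sin_pos_of_mem_Ioo (h.anglesMem.se i hi))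
      (Real.sin_pos_of_mem_Ioo h.fold_mem)) 2
  nlinarith [sq_nonneg (Real.sin (R.angles.ne i) * Real.cos (R.angles.se i) -
      Real.cos (R.angles.ne i) * Real.sin (R.angles.se i) * Real.cos R.fold)]

theorem affineMatrix_mulVec (ξ θ : ℝ) (v : Fin 2 → ℝ) :
    (affineMatrix ξ θ).mulVec v 0 = (Real.cos θ * v 0 + Real.sin θ * v 1) -
        Real.cos ξ / Real.sin ξ * (-Real.sin θ * v 0 + Real.cos θ * v 1) ∧
      (affineMatrix ξ θ).mulVec v 1 =
        1 / Real.sin ξ * (-Real.sin θ * v 0 + Real.cos θ * v 1) := by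
  simp only [affineMatrix, Real.tan_eq_sin_div_cos, one_div_div]
  constructor <;> simp [Matrix.mulVec, dotProduct, Matrix.mul_apply, Fin.sum_univ_two] <;> ring

theorem affineMatrix_det {ξ : ℝ} (θ : ℝ) (h : Real.sin ξ ≠ 0) :
    IsUnit (affineMatrix ξ θ).det := by
  rw [affineMatrix, Matrix.det_mul, Matrix.det_fin_two_of, Matrix.det_fin_two_of, isUnit_iff_ne_zero]
  have : Real.cos θ * Real.cos θ - Real.sin θ * -Real.sin θ = 1 := by
    linear_combination Real.sin_sq_add_cos_sq θ
  rw [this]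
  simp [h]

theorem IsDatumRow.norm_place (h : IsDatumRow n R) (θ : ℝ) {i : ℕ} (hi : i ∈ Set.Icc 1 n)
    (v : Plane) : ‖place R θ i v‖ = ‖v‖ := by
  have hs := (h.sin_xi_pos hi).ne'
  obtain ⟨h1, h2⟩ := affineMatrix_mulVec (R.angles.xi i) θ v.ofLp
  have h3 : ‖place R θ i v‖ ^ 2 = ‖v‖ ^ 2 := by
    rw [place, h1, h2, norm_add_sq_real, norm_smul, norm_smul, h.unit_u i hi, h.unit_d i hi,
      real_inner_smul_left, real_inner_smul_right, h.inner_eq_cos_xi hi, EuclideanSpace.norm_sq_eq,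
      Fin.sum_univ_two]
    simp only [Real.norm_eq_abs, mul_one, sq_abs]
    have e1 := Real.sin_sq_add_cos_sq (R.angles.xi i)
    have e2 := Real.sin_sq_add_cos_sq θ
    set p := Real.cos θ * v 0 + Real.sin θ * v 1 with hp
    set q := -Real.sin θ * v 0 + Real.cos θ * v 1 with hq
    have e3 : v 0 ^ 2 + v 1 ^ 2 = p ^ 2 + q ^ 2 := by
      rw [hp, hq]; linear_combination -(v 0 ^ 2 + v 1 ^ 2) * e2
    rw [e3]
    field_simp
    linear_combination -q ^ 2 * e1
  exact (sq_eq_sq₀ (norm_nonneg _) (norm_nonneg _)).1 h3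

theorem IsDatumRow.targetCurve_first (h : IsDatumRow n R) (hn : 1 ≤ n) (θ : ℝ) (f : ℝ → Plane) :
    R.angles.targetCurve θ f 1 = f := by
  funext t
  have hu := affineMatrix_det θ (h.sin_xi_pos (i := 1) ⟨le_rfl, hn⟩).ne'
  rw [SectorAngles.targetCurve, SectorAngles.columnMatrix, Nat.sub_self, SectorAngles.diagProd,
    mul_one, Matrix.nonsing_inv_mul _ hu, Matrix.one_mulVec]

/-- In terms of the creases, the placed curve of the column `i` has the coordinates of the first one,
scaled. -/
theorem IsDatumRow.placedCurve_eq (h : IsDatumRow n R) (θ : ℝ) (f : ℝ → Plane) (t₀ t : ℝ) {i : ℕ}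
    (hi : i ∈ Set.Icc 1 n) :
    placedCurve R θ f t₀ i t =
      offset R θ f t₀ t 0 • R.upper n i + offset R θ f t₀ t 1 • R.lower n i := by
  have hu := affineMatrix_det θ (h.sin_xi_pos hi).ne'
  have h1 : i - 1 + 1 = i := Nat.sub_add_cancel hi.1
  have key : (affineMatrix (R.angles.xi i) θ).mulVec
      (R.angles.targetCurve θ f i t - R.angles.targetCurve θ f i t₀).ofLp =
      (R.angles.diagProd (i - 1)).mulVec (offset R θ f t₀ t) := by
    rw [WithLp.ofLp_sub, SectorAngles.targetCurve, SectorAngles.targetCurve, ← Matrix.mulVec_sub,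
      Matrix.mulVec_mulVec, SectorAngles.columnMatrix, ← mul_assoc, ← mul_assoc,
      Matrix.mul_nonsing_inv _ hu, one_mul, ← Matrix.mulVec_mulVec, Matrix.mulVec_sub]
    rfl
  obtain ⟨h2, h3⟩ := diagProd_mulVec R.angles (i - 1) (offset R θ f t₀ t)
  rw [h1] at h2 h3
  rw [placedCurve, place, key, h2, h3, Row.upper, Row.lower, clampIdx_of_mem hi, smul_smul,
    smul_smul, mul_comm, mul_comm (scale _ _ _)]

theorem inner_columnNormal (R : Row) (i j : ℕ) :
    inner ℝ (columnNormal R i) (columnNormal R j) =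
      inner ℝ (R.u i) (R.u j) * inner ℝ (R.d i) (R.d j) -
        inner ℝ (R.u i) (R.d j) * inner ℝ (R.u j) (R.d i) := by
  simp only [inner_coord, columnNormal, cross_apply, Matrix.cons_val_zero, Matrix.cons_val_one,
    Matrix.cons_val_two, Matrix.tail_cons, Matrix.head_cons]
  ring

theorem IsDatumRow.norm_columnNormal (h : IsDatumRow n R) {i : ℕ} (hi : i ∈ Set.Icc 1 n) :
    ‖columnNormal R i‖ = Real.sin (R.angles.xi i) := by
  have h1 : ‖columnNormal R i‖ ^ 2 = Real.sin (R.angles.xi i) ^ 2 := by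
    rw [← real_inner_self_eq_norm_sq, inner_columnNormal, real_inner_self_eq_norm_sq,
      real_inner_self_eq_norm_sq, h.unit_u i hi, h.unit_d i hi, h.inner_eq_cos_xi hi, Real.sin_sq]
    ring
  exact (sq_eq_sq₀ (norm_nonneg _) (h.sin_xi_pos hi).le).1 h1

/-- Cosine and sine of an angle of a spherical triangle, from the sides `a`, `b` and the angle `ρ`
between them; `ξ` is the third side. -/
theorem cos_sin_arccos_triangle {a b ρ ξ : ℝ} (ha : a ∈ Set.Ioo 0 Real.pi)
    (hb : b ∈ Set.Ioo 0 Real.pi) (hρ : ρ ∈ Set.Ioo 0 Real.pi) (hξ : 0 < Real.sin ξ)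
    (h : Real.cos ξ = Real.cos a * Real.cos b + Real.sin a * Real.sin b * Real.cos ρ) :
    Real.cos (Real.arccos ((Real.cos b - Real.cos a * Real.cos ξ) / (Real.sin a * Real.sin ξ))) =
        (Real.sin a * Real.cos b - Real.cos a * Real.sin b * Real.cos ρ) / Real.sin ξ ∧
      Real.sin (Real.arccos ((Real.cos b - Real.cos a * Real.cos ξ) / (Real.sin a * Real.sin ξ))) =
        Real.sin b * Real.sin ρ / Real.sin ξ := by
  have hsa := Real.sin_pos_of_mem_Ioo ha
  have hsb := Real.sin_pos_of_mem_Ioo hb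
  have hsρ := Real.sin_pos_of_mem_Ioo hρ
  have e1 := Real.sin_sq_add_cos_sq a
  have e2 := Real.sin_sq_add_cos_sq b
  have e3 := Real.sin_sq_add_cos_sq ρ
  have e4 := Real.sin_sq_add_cos_sq ξ
  have hq : (Real.cos b - Real.cos a * Real.cos ξ) / (Real.sin a * Real.sin ξ) =
      (Real.sin a * Real.cos b - Real.cos a * Real.sin b * Real.cos ρ) / Real.sin ξ := by
    rw [h]
    field_simp
    linear_combination -Real.cos b * e1
  have hsq : ((Real.sin a * Real.cos b - Real.cos a * Real.sin b * Real.cos ρ) / Real.sin ξ) ^ 2 +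
      (Real.sin b * Real.sin ρ / Real.sin ξ) ^ 2 = 1 := by
    have : (Real.sin a * Real.cos b - Real.cos a * Real.sin b * Real.cos ρ) ^ 2 +
        (Real.sin b * Real.sin ρ) ^ 2 = Real.sin ξ ^ 2 := by
      rw [h] at e4
      generalize Real.sin a = x at *
      generalize Real.cos a = x' at *
      generalize Real.sin b = y at *
      generalize Real.cos b = y' at *
      generalize Real.sin ρ = c at *
      generalize Real.cos ρ = c' at *
      linear_combination -e4 + (y' ^ 2 + y ^ 2 * c' ^ 2) * e1 + e2 + y ^ 2 * e3
    rw [div_pow, div_pow, ← add_div, this, div_self (pow_pos hξ 2).ne']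
  have hpos : 0 < Real.sin b * Real.sin ρ / Real.sin ξ := by positivity
  rw [hq]
  refine ⟨Real.cos_arccos ?_ ?_, ?_⟩
  · nlinarith
  · nlinarith
  · rw [Real.sin_arccos, ← Real.sqrt_sq hpos.le]
    congr 1
    linarith

theorem IsDatumRow.cos_angle_columnNormal (h : IsDatumRow n R) {i : ℕ} (hi1 : 1 ≤ i)
    (hi2 : i + 1 ≤ n) :
    Real.cos (InnerProductGeometry.angle (columnNormal R i) (columnNormal R (i + 1))) =
      R.angles.cosPhi i := by
  have hi : i ∈ Set.Icc 1 n := ⟨hi1, by omega⟩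
  have hi' : i + 1 ∈ Set.Icc 1 n := ⟨by omega, hi2⟩
  have hs := h.sin_xi_pos hi
  have hs' := h.sin_xi_pos hi'
  obtain ⟨k1, k2, k3⟩ := h.inner_ud_left hi1 hi2
  obtain ⟨c1, s1⟩ := cos_sin_arccos_triangle (h.anglesMem.ne i hi) (h.anglesMem.se i hi) h.fold_mem
    hs (by rw [← h.inner_eq_cos_xi hi, h.inner_ud hi])
  obtain ⟨c2, s2⟩ := cos_sin_arccos_triangle (h.anglesMem.nw _ hi') (h.anglesMem.sw _ hi')
    h.fold_mem hs' (by rw [← h.inner_eq_cos_xi hi', k1])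
  rw [InnerProductGeometry.cos_angle, h.norm_columnNormal hi, h.norm_columnNormal hi',
    inner_columnNormal, h.inner_uu hi1 hi2, h.inner_dd hi1 hi2, k2, k3, SectorAngles.cosPhi,
    SectorAngles.eta₁, SectorAngles.eta₂, c1, s1, c2, s2, Real.cos_add, Real.cos_add]
  have e3 := Real.sin_sq_add_cos_sq R.fold
  field_simp
  generalize Real.sin (R.angles.ne i) = S1
  generalize Real.cos (R.angles.ne i) = C1
  generalize Real.sin (R.angles.se i) = S2
  generalize Real.cos (R.angles.se i) = C2
  generalize Real.sin (R.angles.nw (i + 1)) = S3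
  generalize Real.cos (R.angles.nw (i + 1)) = C3
  generalize Real.sin (R.angles.sw (i + 1)) = S4
  generalize Real.cos (R.angles.sw (i + 1)) = C4
  generalize Real.sin R.fold = s at *
  generalize Real.cos R.fold = c at *
  linear_combination (S2 * S4 * C1 * C3 - S1 * S2 * S3 * S4) * e3

/-- If the angles of an inner vertex agree in pairs across its column creases, then its row creases are
opposite or equal, which a datum row excludes. -/
theorem IsDatumRow.not_cross (h : IsDatumRow n R) {i : ℕ} (hi : i ∈ Set.Icc 1 n) :
    ¬ (R.angles.ne i + R.angles.nw i = Real.pi ∧ R.angles.ne i + R.angles.se i = Real.pi) := by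
  rintro ⟨h1, h2⟩
  rcases eq_or_lt_of_le hi.1 with rfl | h3
  · have := h.sin_nw_lt hi.2
    rw [show R.angles.nw 1 = Real.pi - R.angles.ne 1 by linarith, Real.sin_pi_sub] at this
    exact lt_irrefl _ this
  · have hf := h.flat_foldable i ⟨h3, hi.2⟩
    obtain ⟨k, rfl⟩ : ∃ k, i = k + 1 := ⟨i - 1, by omega⟩
    have hk : k < n := hi.2
    have hn : 1 ≤ n := by omega
    have a1 : R.angles.ne (k + 1) = Real.pi / 2 := by linarith [hf.1, hf.2]
    have a2 : R.angles.nw (k + 1) = Real.pi / 2 := by linarith [hf.1, hf.2]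
    have a3 : R.angles.se (k + 1) = Real.pi / 2 := by linarith [hf.1, hf.2]
    have a4 : R.angles.sw (k + 1) = Real.pi / 2 := by linarith [hf.1, hf.2]
    have b1 := h.inner_ne hi
    have b2 := h.inner_se hi
    have b3 := h.inner_nw hk
    have b4 := h.inner_sw hk
    rw [a1, Real.cos_pi_div_two, real_inner_comm] at b1
    rw [a3, Real.cos_pi_div_two, real_inner_comm] at b2
    rw [a2, Real.cos_pi_div_two, neg_zero, real_inner_comm] at b3
    rw [a4, Real.cos_pi_div_two, neg_zero, real_inner_comm] at b4
    have hg : 0 < 1 - inner ℝ (R.u (k + 1)) (R.d (k + 1)) ^ 2 := by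
      rw [h.inner_eq_cos_xi hi]
      nlinarith [Real.sin_sq_add_cos_sq (R.angles.xi (k + 1)), h.sin_xi_pos hi]
    have ht : ∀ e : Space, ‖e‖ = 1 → inner ℝ (R.u (k + 1)) e = 0 → inner ℝ (R.d (k + 1)) e = 0 →
        triple (R.u (k + 1)) (R.d (k + 1)) e ≠ 0 := by
      intro e he hu hd h0
      have := triple_mul_triple (R.u (k + 1)) (R.d (k + 1)) e e
      rw [h0, hu, hd, real_inner_self_eq_norm_sq, real_inner_self_eq_norm_sq,
        real_inner_self_eq_norm_sq, he, h.unit_u _ hi, h.unit_d _ hi] at this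
      nlinarith
    have t1 := ht _ (h.norm_dir hn hi.2) b1 b2
    have t2 := ht _ (h.norm_dir hn hk.le) b3 b4
    rcases lt_or_gt_of_ne (mul_ne_zero t1 t2) with h5 | h5
    · refine (h.dir_ne hk).2 (eq_of_inner_eq (a := R.u (k + 1)) (b := R.d (k + 1)) ?_ ?_ ?_ ?_)
      · rw [norm_neg, h.norm_dir hn hi.2, h.norm_dir hn hk.le]
      · rw [inner_neg_right, b1, b3, neg_zero]
      · rw [inner_neg_right, b2, b4, neg_zero]
      · rw [triple_neg_right]; linarith
    · refine (h.dir_ne hk).1 (eq_of_inner_eq (a := R.u (k + 1)) (b := R.d (k + 1)) ?_ ?_ ?_ h5)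
      · rw [h.norm_dir hn hi.2, h.norm_dir hn hk.le]
      · rw [b1, b3]
      · rw [b2, b4]

end Columns

/-! ### Frames carried along the row creases -/

/-- Three vectors of space, meant to be orthonormal: the direction `e` of a row crease, the bisector
`m` of the half-planes of its upper and its lower panel, and the vector `k` orthogonal to both. -/
structure Frame where
  e : Space
  m : Space
  k : Space

namespace Frame

/-- The three vectors of the frame are orthonormal. -/
structure IsOrtho (F : Frame) : Prop where
  inner_ee : inner ℝ F.e F.e = (1 : ℝ)
  inner_mm : inner ℝ F.m F.m = (1 : ℝ)
  inner_kk : inner ℝ F.k F.k = (1 : ℝ)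
  inner_em : inner ℝ F.e F.m = (0 : ℝ)
  inner_ek : inner ℝ F.e F.k = (0 : ℝ)
  inner_mk : inner ℝ F.m F.k = (0 : ℝ)

/-- The vector with given coordinates in a frame. -/
def comb (F : Frame) (x y z : ℝ) : Space := x • F.e + y • F.m + z • F.k

theorem IsOrtho.inner_comb {F : Frame} (h : F.IsOrtho) (x y z x' y' z' : ℝ) :
    inner ℝ (F.comb x y z) (F.comb x' y' z') = x * x' + y * y' + z * z' := by
  simp only [comb, inner_add_left, inner_add_right, real_inner_smul_left, real_inner_smul_right,
    h.inner_ee, h.inner_mm, h.inner_kk, h.inner_em, h.inner_ek, h.inner_mk, real_inner_comm F.e F.m, real_inner_comm F.e F.k,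
    real_inner_comm F.m F.k]
  ring

/-- The unit vector at the angle `α` to the row crease, in the half-plane at half the dihedral angle
from the bisector; `c`, `s` are the cosine and the sine of this half angle, with `s` negative for the
lower panel. -/
def crease (F : Frame) (α c s : ℝ) : Space :=
  F.comb (Real.cos α) (Real.sin α * c) (Real.sin α * s)

theorem e_eq_comb (F : Frame) : F.e = F.comb 1 0 0 := by simp [comb]

theorem IsOrtho.norm_e {F : Frame} (h : F.IsOrtho) : ‖F.e‖ = 1 := by
  have := h.inner_ee
  rw [real_inner_self_eq_norm_sq] at this
  exact (pow_eq_one_iff_of_nonneg (norm_nonneg _) two_ne_zero).1 this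

theorem IsOrtho.inner_e_crease {F : Frame} (h : F.IsOrtho) (α c s : ℝ) :
    inner ℝ F.e (F.crease α c s) = Real.cos α := by
  rw [crease, e_eq_comb F, h.inner_comb]; simp

theorem IsOrtho.norm_crease {F : Frame} (h : F.IsOrtho) {c s : ℝ} (hcs : c ^ 2 + s ^ 2 = 1)
    (α : ℝ) : ‖F.crease α c s‖ = 1 := by
  have h1 : ‖F.crease α c s‖ ^ 2 = 1 := by
    rw [← real_inner_self_eq_norm_sq, crease, h.inner_comb]
    linear_combination Real.sin_sq_add_cos_sq α + Real.sin α ^ 2 * hcs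
  exact (pow_eq_one_iff_of_nonneg (norm_nonneg _) two_ne_zero).1 h1

theorem crease_relation (F : Frame) (a b c s : ℝ) :
    Real.sin b • F.crease a c s - Real.sin a • F.crease (Real.pi - b) c s =
      Real.sin (a + b) • F.e := by
  simp only [crease, comb, Real.cos_pi_sub, Real.sin_pi_sub, Real.sin_add]
  module

theorem IsOrtho.inner_crease_crease {F : Frame} (h : F.IsOrtho) (a b c s : ℝ) :
    inner ℝ (F.crease a c s) (F.crease b c (-s)) =
      Real.cos a * Real.cos b + Real.sin a * Real.sin b * (c ^ 2 - s ^ 2) := by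
  rw [crease, crease, h.inner_comb]; ring

/-- The common denominator of the coordinates in `step`. -/
def stepDenom (a b ε c s : ℝ) : ℝ :=
  (1 - ε * Real.cos (a + b)) * s ^ 2 + (1 - ε * Real.cos (a - b)) * c ^ 2

/-- The frame at the right row crease of a flat-foldable vertex in terms of the one at its left row
crease: `a`, `b` are the sector angles next to the left row crease, `c`, `s` are cosine and sine of half
the dihedral angle of both row creases, and `ε = 1`, `ε = -1` distinguish the two ways of folding the
vertex. Numerators and denominator are polynomials, so that the flat state `c = 0` is no exception. -/
def step (a b ε c s : ℝ) (F : Frame) : Frame where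
  e := (stepDenom a b ε c s)⁻¹ • F.comb
    (Real.cos (a - b) * (1 - ε * Real.cos (a + b)) * s ^ 2 +
      Real.cos (a + b) * (1 - ε * Real.cos (a - b)) * c ^ 2)
    (-Real.sin (a + b) * (1 - ε * Real.cos (a - b)) * c)
    (-Real.sin (a - b) * (1 - ε * Real.cos (a + b)) * s)
  m := (stepDenom a b ε c s)⁻¹ • F.comb
    (-Real.sin (a + b) * (1 - ε * Real.cos (a - b)) * c)
    (ε * (1 - ε * Real.cos (a + b)) * s ^ 2 -
      Real.cos (a + b) * (1 - ε * Real.cos (a - b)) * c ^ 2)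
    (-ε * Real.sin (a + b) * Real.sin (a - b) * c * s)
  k := (stepDenom a b ε c s)⁻¹ • F.comb
    (Real.sin (a - b) * (1 - ε * Real.cos (a + b)) * s)
    (ε * Real.sin (a + b) * Real.sin (a - b) * c * s)
    (Real.cos (a - b) * (1 - ε * Real.cos (a + b)) * s ^ 2 -
      ε * (1 - ε * Real.cos (a - b)) * c ^ 2)

section Step

variable {F : Frame} {a b ε c s : ℝ}

theorem stepDenom_pos (hε : ε ^ 2 = 1) (hs : 0 < s) (hq : 0 < 1 - ε * Real.cos (a + b)) :
    0 < stepDenom a b ε c s := by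
  have h1 : 0 ≤ 1 - ε * Real.cos (a - b) := by
    rcases sq_eq_sq_iff_eq_or_eq_neg.1 (hε.trans (one_pow 2).symm) with rfl | rfl
    · linarith [Real.cos_le_one (a - b)]
    · linarith [Real.neg_one_le_cos (a - b)]
  exact add_pos_of_pos_of_nonneg (mul_pos hq (pow_pos hs 2)) (mul_nonneg h1 (sq_nonneg c))

theorem IsOrtho.step (h : F.IsOrtho) (hε : ε ^ 2 = 1) (hcs : c ^ 2 + s ^ 2 = 1)
    (hD : stepDenom a b ε c s ≠ 0) : (F.step a b ε c s).IsOrtho := by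
  have h1 := Real.sin_sq_add_cos_sq (a + b)
  have h2 := Real.sin_sq_add_cos_sq (a - b)
  have hd : stepDenom a b ε c s =
    (1 - ε * Real.cos (a + b)) * s ^ 2 + (1 - ε * Real.cos (a - b)) * c ^ 2 := rfl
  constructor <;>
    simp only [Frame.step, real_inner_smul_left, real_inner_smul_right, h.inner_comb] <;>
    generalize stepDenom a b ε c s = D at * <;>
    generalize Real.sin (a + b) = Sp at * <;> generalize Real.cos (a + b) = Q at * <;>
    generalize Real.sin (a - b) = Sm at * <;> generalize Real.cos (a - b) = P at * <;>
    field_simp <;> grind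

/-- The upper crease of the vertex, seen from its two row creases. -/
theorem step_crease_upper (F : Frame) (hε : ε ^ 2 = 1) (hcs : c ^ 2 + s ^ 2 = 1)
    (hD : stepDenom a b ε c s ≠ 0) :
    (F.step a b ε c s).crease (Real.pi - b) c s = F.crease (Real.pi - a) c s := by
  have h1 := Real.sin_sq_add_cos_sq a
  have h2 := Real.sin_sq_add_cos_sq b
  have hd : stepDenom a b ε c s =
    (1 - ε * Real.cos (a + b)) * s ^ 2 + (1 - ε * Real.cos (a - b)) * c ^ 2 := rfl
  rw [← smul_right_injective _ hD |>.eq_iff]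
  simp only [crease, Frame.step, comb, Real.cos_pi_sub, Real.sin_pi_sub, smul_add, smul_smul]
  rw [Real.sin_add, Real.cos_add, Real.sin_sub, Real.cos_sub]
  rw [Real.cos_add, Real.cos_sub] at hd
  generalize stepDenom a b ε c s = D at *
  generalize Real.sin a = sa at *
  generalize Real.cos a = ca at *
  generalize Real.sin b = sb at *
  generalize Real.cos b = cb at *
  match_scalars <;> field_simp <;> grind

/-- The lower crease of the vertex, seen from its two row creases. -/
theorem step_crease_lower (F : Frame) (hε : ε ^ 2 = 1) (hcs : c ^ 2 + s ^ 2 = 1)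
    (hD : stepDenom a b ε c s ≠ 0) :
    (F.step a b ε c s).crease (Real.pi - a) c (-s) = F.crease (Real.pi - b) c (-s) := by
  have h1 := Real.sin_sq_add_cos_sq a
  have h2 := Real.sin_sq_add_cos_sq b
  have hd : stepDenom a b ε c s =
    (1 - ε * Real.cos (a + b)) * s ^ 2 + (1 - ε * Real.cos (a - b)) * c ^ 2 := rfl
  rw [← smul_right_injective _ hD |>.eq_iff]
  simp only [crease, Frame.step, comb, Real.cos_pi_sub, Real.sin_pi_sub, smul_add, smul_smul]
  rw [Real.sin_add, Real.cos_add, Real.sin_sub, Real.cos_sub]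
  rw [Real.cos_add, Real.cos_sub] at hd
  generalize stepDenom a b ε c s = D at *
  generalize Real.sin a = sa at *
  generalize Real.cos a = ca at *
  generalize Real.sin b = sb at *
  generalize Real.cos b = cb at *
  match_scalars <;> field_simp <;> grind

theorem IsOrtho.inner_e_step (h : F.IsOrtho) :
    inner ℝ F.e (F.step a b ε c s).e = (stepDenom a b ε c s)⁻¹ *
      (Real.cos (a - b) * (1 - ε * Real.cos (a + b)) * s ^ 2 +
        Real.cos (a + b) * (1 - ε * Real.cos (a - b)) * c ^ 2) := by
  rw [Frame.step, real_inner_smul_right, e_eq_comb F, h.inner_comb]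
  ring

/-- No column crease of a flat-foldable vertex is folded completely while its row creases are not. -/
theorem IsOrtho.lt_inner_e_step (h : F.IsOrtho) (hε : ε ^ 2 = 1) (hs : 0 < s)
    (hq : 0 < 1 - ε * Real.cos (a + b)) (ha : a ∈ Set.Ioo 0 Real.pi) (hb : b ∈ Set.Ioo 0 Real.pi) :
    Real.cos (a + b) < inner ℝ F.e (F.step a b ε c s).e := by
  have hD := stepDenom_pos (c := c) hε hs hq
  rw [h.inner_e_step, inv_mul_eq_div, lt_div_iff₀ hD]
  have h1 : 0 < Real.cos (a - b) - Real.cos (a + b) := by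
    rw [Real.cos_sub, Real.cos_add]
    nlinarith [mul_pos (Real.sin_pos_of_mem_Ioo ha) (Real.sin_pos_of_mem_Ioo hb)]
  have h2 := mul_pos h1 (mul_pos hq (pow_pos hs 2))
  rw [stepDenom]
  linarith

/-- The two ways of folding a vertex differ in the sides of the plane of its column creases on which
the row creases lie. -/
theorem IsOrtho.triple_step (h : F.IsOrtho) (hε : ε ^ 2 = 1) (hcs : c ^ 2 + s ^ 2 = 1)
    (hD : stepDenom a b ε c s ≠ 0) :
    triple (F.crease (Real.pi - a) c s) (F.crease (Real.pi - b) c (-s)) F.e *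
      triple (F.crease (Real.pi - a) c s) (F.crease (Real.pi - b) c (-s)) (F.step a b ε c s).e =
      ε * (2 * Real.sin a * Real.sin b * c * s) ^ 2 := by
  have hcs' : c ^ 2 + (-s) ^ 2 = 1 := by rw [neg_sq, hcs]
  have hF := h.step hε hcs hD
  have e1 : inner ℝ (F.crease (Real.pi - a) c s) (F.step a b ε c s).e = -Real.cos b := by
    rw [← step_crease_upper F hε hcs hD, real_inner_comm, hF.inner_e_crease, Real.cos_pi_sub]
  have e2 : inner ℝ (F.crease (Real.pi - b) c (-s)) (F.step a b ε c s).e = -Real.cos a := by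
    rw [← step_crease_lower F hε hcs hD, real_inner_comm, hF.inner_e_crease, Real.cos_pi_sub]
  rw [triple_mul_triple, e1, e2, h.inner_e_crease, h.inner_e_crease, h.inner_crease_crease,
    h.inner_e_step, real_inner_self_eq_norm_sq, real_inner_self_eq_norm_sq, h.norm_crease hcs,
    h.norm_crease hcs', Real.cos_pi_sub, Real.cos_pi_sub, Real.sin_pi_sub, Real.sin_pi_sub]
  have h1 := Real.sin_sq_add_cos_sq a
  have h2 := Real.sin_sq_add_cos_sq b
  have hd : stepDenom a b ε c s =
    (1 - ε * Real.cos (a + b)) * s ^ 2 + (1 - ε * Real.cos (a - b)) * c ^ 2 := rfl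
  rw [Real.cos_add, Real.cos_sub] at hd ⊢
  generalize stepDenom a b ε c s = D at *
  generalize Real.sin a = sa at *
  generalize Real.cos a = ca at *
  generalize Real.sin b = sb at *
  generalize Real.cos b = cb at *
  field_simp
  grind

end Step

end Frame

/-! ### The folding motion of a row -/

/-- Properties of the sector angles, and of the choice `ε i = ±1` of a way of folding each
flat-foldable vertex, under which the row folds with one degree of freedom: the straight-line vertex
closes its left row crease first, and no vertex whose column creases form a straight line in the plane
is folded along that line. -/
structure IsFoldable (n : ℕ) (σ : SectorAngles) (ε : ℕ → ℝ) : Prop where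
  one_le : 1 ≤ n
  angles : AnglesMem n σ
  straight_right : σ.ne 1 + σ.se 1 = Real.pi
  straight_left : σ.nw 1 + σ.sw 1 = Real.pi
  sin_lt : Real.sin (σ.nw 1) < Real.sin (σ.ne 1)
  flat : ∀ i ∈ Set.Icc 2 n, σ.ne i + σ.sw i = Real.pi ∧ σ.nw i + σ.se i = Real.pi
  mode_sq : ∀ i ∈ Set.Icc 2 n, ε i ^ 2 = 1
  mode_pos : ∀ i ∈ Set.Icc 2 n, 0 < 1 - ε i * Real.cos (σ.nw i + σ.sw i)

/-- Cosine of the angle between a row crease of the straight-line vertex, inclined by `α` to the column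
creases, and the difference of the unit vectors along these. Half the length of their sum is `h`. -/
def tilt (α h : ℝ) : ℝ := Real.cos α / √(1 - h ^ 2)

section Tilt

variable {α h : ℝ}

theorem sqrt_pos_of_lt_sin (h0 : 0 ≤ h) (h1 : h < 1) : 0 < √(1 - h ^ 2) :=
  Real.sqrt_pos.2 (by nlinarith)

theorem tilt_mul (h0 : 0 ≤ h) (h1 : h < 1) (α : ℝ) : tilt α h * √(1 - h ^ 2) = Real.cos α :=
  div_mul_cancel₀ _ (sqrt_pos_of_lt_sin h0 h1).ne'

theorem tilt_sq_le (h0 : 0 ≤ h) (h1 : h < 1) (hα : h ≤ Real.sin α) : tilt α h ^ 2 ≤ 1 := by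
  have hp : 0 < 1 - h ^ 2 := by nlinarith
  rw [tilt, div_pow, Real.sq_sqrt hp.le, div_le_one hp]
  nlinarith [Real.sin_sq_add_cos_sq α]

theorem sq_sqrt_tilt (h0 : 0 ≤ h) (h1 : h < 1) (hα : h ≤ Real.sin α) :
    (√(1 - h ^ 2) * √(1 - tilt α h ^ 2)) ^ 2 = Real.sin α ^ 2 - h ^ 2 := by
  have hp : 0 < 1 - h ^ 2 := by nlinarith
  have e1 := tilt_mul h0 h1 α
  have e2 := Real.sq_sqrt hp.le
  rw [mul_pow, e2, Real.sq_sqrt (sub_nonneg.2 (tilt_sq_le h0 h1 hα)), Real.sin_sq, ← e1, mul_pow,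
    e2]
  ring

end Tilt

namespace Frame

/-- The frame at the right row crease of the straight-line vertex, in terms of a fixed frame `B` whose
vectors `m` and `e` are the directions of the sum and the difference of the column creases. -/
def first (B : Frame) (α h : ℝ) : Frame where
  e := B.comb (tilt α h) 0 (-√(1 - tilt α h ^ 2))
  m := B.m
  k := B.comb (√(1 - tilt α h ^ 2)) 0 (tilt α h)

/-- The direction, from left to right, of the left row crease of the straight-line vertex. -/
def leftDir (B : Frame) (a h : ℝ) : Space := -B.comb (tilt a h) 0 (√(1 - tilt a h ^ 2))

theorem m_eq_comb (B : Frame) : B.m = B.comb 0 1 0 := by simp [comb]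

theorem IsOrtho.first {B : Frame} (hB : B.IsOrtho) {α h : ℝ} (h0 : 0 ≤ h) (h1 : h < 1)
    (hα : h ≤ Real.sin α) : (B.first α h).IsOrtho := by
  have e1 := Real.sq_sqrt (sub_nonneg.2 (tilt_sq_le h0 h1 hα))
  have hm := m_eq_comb B
  constructor <;> simp only [Frame.first] <;> try rw [hm]
  all_goals rw [hB.inner_comb]; linarith

end Frame

/-- Cosine of half the dihedral angle at the row creases right of the straight-line vertex. -/
def foldCos (σ : SectorAngles) (h : ℝ) : ℝ := h / Real.sin (σ.ne 1)

/-- Sine of half the dihedral angle at the row creases right of the straight-line vertex. -/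
def foldSin (σ : SectorAngles) (h : ℝ) : ℝ := √(1 - foldCos σ h ^ 2)

/-- The frame at the row crease `i + 1`. -/
def foldFrame (σ : SectorAngles) (ε : ℕ → ℝ) (B : Frame) (h : ℝ) : ℕ → Frame
  | 0 => B.first (σ.ne 1) h
  | (i + 1) => (foldFrame σ ε B h i).step (σ.nw (i + 2)) (σ.sw (i + 2)) (ε (i + 2))
      (foldCos σ h) (foldSin σ h)

/-- The direction of the row crease `i`. -/
def foldDir (σ : SectorAngles) (ε : ℕ → ℝ) (B : Frame) (h : ℝ) (i : ℕ) : Space :=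
  if i = 0 then B.leftDir (σ.nw 1) h else (foldFrame σ ε B h (i - 1)).e

/-- The direction of the upper crease of the column `i`. -/
def foldUp (σ : SectorAngles) (ε : ℕ → ℝ) (B : Frame) (h : ℝ) (i : ℕ) : Space :=
  (foldFrame σ ε B h (i - 1)).crease (σ.ne i) (foldCos σ h) (foldSin σ h)

/-- The direction of the lower crease of the column `i`. -/
def foldDown (σ : SectorAngles) (ε : ℕ → ℝ) (B : Frame) (h : ℝ) (i : ℕ) : Space :=
  (foldFrame σ ε B h (i - 1)).crease (σ.se i) (foldCos σ h) (-foldSin σ h)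

/-- The upper column creases, scaled; the border columns copy their neighbours. -/
def foldUpper (n : ℕ) (σ : SectorAngles) (ε : ℕ → ℝ) (B : Frame) (h : ℝ) (i : ℕ) : Space :=
  scale σ.ne σ.nw (clampIdx n i) • foldUp σ ε B h (clampIdx n i)

/-- The lower column creases, scaled; the border columns copy their neighbours. -/
def foldLower (n : ℕ) (σ : SectorAngles) (ε : ℕ → ℝ) (B : Frame) (h : ℝ) (i : ℕ) : Space :=
  scale σ.se σ.sw (clampIdx n i) • foldDown σ ε B h (clampIdx n i)

/-- The vertices of a row with edge lengths `L`, edge directions `e` and vertex `1` at `O`. -/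
def pathVertex (O : Space) (L : ℕ → ℝ) (e : ℕ → Space) (i : ℕ) : Space :=
  O - L 0 • e 0 + ∑ k ∈ Finset.range i, L k • e k

theorem pathVertex_one (O : Space) (L : ℕ → ℝ) (e : ℕ → Space) : pathVertex O L e 1 = O := by
  simp [pathVertex]

section Fold

variable {n : ℕ} {σ : SectorAngles} {ε : ℕ → ℝ} {B : Frame} {h : ℝ}

theorem IsFoldable.bounds (hf : IsFoldable n σ ε) (hh : h ≤ Real.sin (σ.nw 1)) :
    h < 1 ∧ h < Real.sin (σ.ne 1) ∧ 0 < Real.sin (σ.ne 1) := by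
  have h1 := Real.sin_pos_of_mem_Ioo (hf.angles.ne 1 ⟨le_rfl, hf.one_le⟩)
  have h2 := hh.trans_lt hf.sin_lt
  exact ⟨h2.trans_le (Real.sin_le_one _), h2, h1⟩

theorem IsFoldable.foldCos_nonneg (hf : IsFoldable n σ ε) (h0 : 0 ≤ h)
    (hh : h ≤ Real.sin (σ.nw 1)) : 0 ≤ foldCos σ h :=
  div_nonneg h0 (hf.bounds hh).2.2.le

theorem IsFoldable.foldCos_lt_one (hf : IsFoldable n σ ε)
    (hh : h ≤ Real.sin (σ.nw 1)) : foldCos σ h < 1 :=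
  (div_lt_one (hf.bounds hh).2.2).2 (hf.bounds hh).2.1

theorem IsFoldable.foldSin_pos (hf : IsFoldable n σ ε) (h0 : 0 ≤ h)
    (hh : h ≤ Real.sin (σ.nw 1)) : 0 < foldSin σ h := by
  have h1 := hf.foldCos_nonneg h0 hh
  have h2 := hf.foldCos_lt_one hh
  exact Real.sqrt_pos.2 (by nlinarith)

theorem IsFoldable.fold_sq (hf : IsFoldable n σ ε) (h0 : 0 ≤ h)
    (hh : h ≤ Real.sin (σ.nw 1)) : foldCos σ h ^ 2 + foldSin σ h ^ 2 = 1 := by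
  have h1 := hf.foldCos_nonneg h0 hh
  have h2 := hf.foldCos_lt_one hh
  rw [foldSin, Real.sq_sqrt (by nlinarith)]
  ring

theorem IsFoldable.stepDenom_pos (hf : IsFoldable n σ ε) (h0 : 0 ≤ h)
    (hh : h ≤ Real.sin (σ.nw 1)) {i : ℕ} (hi : i ∈ Set.Icc 2 n) :
    0 < Frame.stepDenom (σ.nw i) (σ.sw i) (ε i) (foldCos σ h) (foldSin σ h) :=
  Frame.stepDenom_pos (hf.mode_sq i hi) (hf.foldSin_pos h0 hh) (hf.mode_pos i hi)

theorem IsFoldable.isOrtho_foldFrame (hf : IsFoldable n σ ε) (hB : B.IsOrtho) (h0 : 0 ≤ h)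
    (hh : h ≤ Real.sin (σ.nw 1)) {i : ℕ} (hi : i < n) : (foldFrame σ ε B h i).IsOrtho := by
  induction i with
  | zero => exact hB.first h0 (hf.bounds hh).1 (hf.bounds hh).2.1.le
  | succ i ih =>
    have hi' : i + 2 ∈ Set.Icc 2 n := ⟨by omega, hi⟩
    exact (ih (by omega)).step (hf.mode_sq _ hi') (hf.fold_sq h0 hh) (hf.stepDenom_pos h0 hh hi').ne'

theorem IsFoldable.sin_mul_foldSin (hf : IsFoldable n σ ε) (h0 : 0 ≤ h)
    (hh : h ≤ Real.sin (σ.nw 1)) :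
    √(1 - h ^ 2) * √(1 - tilt (σ.ne 1) h ^ 2) = Real.sin (σ.ne 1) * foldSin σ h := by
  obtain ⟨b1, b2, b3⟩ := hf.bounds hh
  have e1 := sq_sqrt_tilt h0 b1 b2.le
  have e2 := hf.fold_sq h0 hh
  have e3 := hf.foldSin_pos h0 hh
  refine (sq_eq_sq₀ (by positivity) (by positivity)).1 ?_
  rw [e1, mul_pow, eq_sub_of_add_eq' e2, foldCos]
  field_simp

/-- The upper column crease of the straight-line vertex. -/
theorem IsFoldable.foldUp_one (hf : IsFoldable n σ ε) (h0 : 0 ≤ h)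
    (hh : h ≤ Real.sin (σ.nw 1)) : foldUp σ ε B h 1 = B.comb (√(1 - h ^ 2)) h 0 := by
  obtain ⟨b1, b2, b3⟩ := hf.bounds hh
  have e1 := hf.sin_mul_foldSin h0 hh
  have e2 := tilt_mul h0 b1 (σ.ne 1)
  have e3 := Real.sq_sqrt (sub_nonneg.2 (tilt_sq_le h0 b1 b2.le))
  have e4 : Real.sin (σ.ne 1) * foldCos σ h = h := by rw [foldCos]; field_simp
  simp only [foldUp, Nat.sub_self, foldFrame, Frame.first, Frame.crease, Frame.comb]
  rw [e4, ← e1, ← e2]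
  match_scalars
  · simp only [mul_one]
    linear_combination √(1 - h ^ 2) * e3
  · ring
  · ring

/-- The lower column crease of the straight-line vertex. -/
theorem IsFoldable.foldDown_one (hf : IsFoldable n σ ε) (h0 : 0 ≤ h)
    (hh : h ≤ Real.sin (σ.nw 1)) : foldDown σ ε B h 1 = B.comb (-√(1 - h ^ 2)) h 0 := by
  obtain ⟨b1, b2, b3⟩ := hf.bounds hh
  have e1 := hf.sin_mul_foldSin h0 hh
  have e2 := tilt_mul h0 b1 (σ.ne 1)
  have e3 := Real.sq_sqrt (sub_nonneg.2 (tilt_sq_le h0 b1 b2.le))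
  have e4 : Real.sin (σ.ne 1) * foldCos σ h = h := by rw [foldCos]; field_simp
  have e5 : σ.se 1 = Real.pi - σ.ne 1 := by linarith [hf.straight_right]
  simp only [foldDown, Nat.sub_self, foldFrame, Frame.first, Frame.crease, Frame.comb, e5,
    Real.cos_pi_sub, Real.sin_pi_sub]
  rw [e4, mul_neg, ← e1, ← e2]
  match_scalars
  · simp only [mul_one]
    linear_combination -√(1 - h ^ 2) * e3
  · ring
  · ring

/-- The upper crease of a flat-foldable vertex, seen from its left row crease. -/
theorem IsFoldable.foldUp_succ (hf : IsFoldable n σ ε) (h0 : 0 ≤ h)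
    (hh : h ≤ Real.sin (σ.nw 1)) {i : ℕ} (hi1 : 1 ≤ i) (hi2 : i + 1 ≤ n) :
    foldUp σ ε B h (i + 1) = (foldFrame σ ε B h (i - 1)).crease (Real.pi - σ.nw (i + 1))
      (foldCos σ h) (foldSin σ h) := by
  obtain ⟨k, rfl⟩ : ∃ k, i = k + 1 := ⟨i - 1, by omega⟩
  have hk : k + 2 ∈ Set.Icc 2 n := ⟨by omega, hi2⟩
  rw [← Frame.step_crease_upper _ (hf.mode_sq _ hk) (hf.fold_sq h0 hh)
    (hf.stepDenom_pos h0 hh hk).ne', foldUp]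
  rw [show σ.ne (k + 1 + 1) = Real.pi - σ.sw (k + 1 + 1) by linarith [(hf.flat _ hk).1]]
  rfl

/-- The lower crease of a flat-foldable vertex, seen from its left row crease. -/
theorem IsFoldable.foldDown_succ (hf : IsFoldable n σ ε) (h0 : 0 ≤ h)
    (hh : h ≤ Real.sin (σ.nw 1)) {i : ℕ} (hi1 : 1 ≤ i) (hi2 : i + 1 ≤ n) :
    foldDown σ ε B h (i + 1) = (foldFrame σ ε B h (i - 1)).crease (Real.pi - σ.sw (i + 1))
      (foldCos σ h) (-foldSin σ h) := by
  obtain ⟨k, rfl⟩ : ∃ k, i = k + 1 := ⟨i - 1, by omega⟩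
  have hk : k + 2 ∈ Set.Icc 2 n := ⟨by omega, hi2⟩
  rw [← Frame.step_crease_lower _ (hf.mode_sq _ hk) (hf.fold_sq h0 hh)
    (hf.stepDenom_pos h0 hh hk).ne', foldDown]
  rw [show σ.se (k + 1 + 1) = Real.pi - σ.nw (k + 1 + 1) by linarith [(hf.flat _ hk).2]]
  rfl

theorem IsFoldable.norm_leftDir (hf : IsFoldable n σ ε) (hB : B.IsOrtho) (h0 : 0 ≤ h)
    (hh : h ≤ Real.sin (σ.nw 1)) : ‖B.leftDir (σ.nw 1) h‖ = 1 := by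
  have e3 := Real.sq_sqrt (sub_nonneg.2 (tilt_sq_le h0 (hf.bounds hh).1 hh))
  have h1 : ‖B.leftDir (σ.nw 1) h‖ ^ 2 = 1 := by
    rw [Frame.leftDir, norm_neg, ← real_inner_self_eq_norm_sq, hB.inner_comb]
    linear_combination e3
  exact (pow_eq_one_iff_of_nonneg (norm_nonneg _) two_ne_zero).1 h1

theorem IsFoldable.norm_foldUp (hf : IsFoldable n σ ε) (hB : B.IsOrtho) (h0 : 0 ≤ h)
    (hh : h ≤ Real.sin (σ.nw 1)) {i : ℕ} (hi : i ∈ Set.Icc 1 n) : ‖foldUp σ ε B h i‖ = 1 :=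
  (hf.isOrtho_foldFrame hB h0 hh (by have := hi.1; have := hi.2; omega)).norm_crease
    (hf.fold_sq h0 hh) _

theorem IsFoldable.norm_foldDown (hf : IsFoldable n σ ε) (hB : B.IsOrtho) (h0 : 0 ≤ h)
    (hh : h ≤ Real.sin (σ.nw 1)) {i : ℕ} (hi : i ∈ Set.Icc 1 n) : ‖foldDown σ ε B h i‖ = 1 :=
  (hf.isOrtho_foldFrame hB h0 hh (by have := hi.1; have := hi.2; omega)).norm_crease
    (by rw [neg_sq, hf.fold_sq h0 hh]) _

theorem IsFoldable.isRowModel (hf : IsFoldable n σ ε) (hB : B.IsOrtho) (h0 : 0 ≤ h)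
    (hh : h ≤ Real.sin (σ.nw 1)) (O : Space) (L : ℕ → ℝ) :
    IsRowModel n σ L (pathVertex O L (foldDir σ ε B h)) (foldDir σ ε B h)
      (foldUpper n σ ε B h) (foldLower n σ ε B h) where
  succ i _ := by
    simp only [pathVertex, Finset.sum_range_succ]; abel
  unit i hi := by
    rcases Nat.eq_zero_or_pos i with rfl | hi0
    · rw [foldDir, if_pos rfl]
      exact hf.norm_leftDir hB h0 hh
    · rw [foldDir, if_neg hi0.ne']
      exact (hf.isOrtho_foldFrame hB h0 hh (by omega)).norm_e
  upper := by
    refine IsCreaseChain.of_unit hf.one_le hf.angles.ne hf.angles.nw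
      (fun i hi => hf.norm_foldUp hB h0 hh hi) ?_ ?_ ?_
    · rw [foldDir, if_pos rfl, hf.foldUp_one h0 hh, Frame.leftDir, inner_neg_left, hB.inner_comb,
        tilt_mul h0 (hf.bounds hh).1]
      simp
    · intro i hi
      rw [foldDir, if_neg (by have := hi.1; omega)]
      exact (hf.isOrtho_foldFrame hB h0 hh
        (by have := hi.1; have := hi.2; omega)).inner_e_crease _ _ _
    · intro i h1 h2
      rw [hf.foldUp_succ h0 hh h1 h2, foldDir, if_neg (by omega), foldUp, Frame.crease_relation]
  lower := by
    refine IsCreaseChain.of_unit hf.one_le hf.angles.se hf.angles.sw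
      (fun i hi => hf.norm_foldDown hB h0 hh hi) ?_ ?_ ?_
    · rw [foldDir, if_pos rfl, hf.foldDown_one h0 hh, Frame.leftDir, inner_neg_left, hB.inner_comb,
        mul_neg, tilt_mul h0 (hf.bounds hh).1,
        show σ.sw 1 = Real.pi - σ.nw 1 by linarith [hf.straight_left], Real.cos_pi_sub]
      simp
    · intro i hi
      rw [foldDir, if_neg (by have := hi.1; omega)]
      exact (hf.isOrtho_foldFrame hB h0 hh
        (by have := hi.1; have := hi.2; omega)).inner_e_crease _ _ _
    · intro i h1 h2
      rw [hf.foldDown_succ h0 hh h1 h2, foldDir, if_neg (by omega), foldDown,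
        Frame.crease_relation]

/-! ### Dihedral angles during the motion -/

theorem IsFoldable.inner_up_down (hf : IsFoldable n σ ε) (hB : B.IsOrtho) (h0 : 0 ≤ h)
    (hh : h ≤ Real.sin (σ.nw 1)) {i : ℕ} (hi : i ∈ Set.Icc 1 n) :
    inner ℝ (foldUp σ ε B h i) (foldDown σ ε B h i) =
      Real.cos (σ.ne i) * Real.cos (σ.se i) +
        Real.sin (σ.ne i) * Real.sin (σ.se i) * (foldCos σ h ^ 2 - foldSin σ h ^ 2) :=
  (hf.isOrtho_foldFrame hB h0 hh (by have := hi.1; have := hi.2; omega)).inner_crease_crease _ _ _ _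

theorem IsFoldable.inner_up_down_first (hf : IsFoldable n σ ε) (hB : B.IsOrtho) (h0 : 0 ≤ h)
    (hh : h ≤ Real.sin (σ.nw 1)) :
    inner ℝ (foldUp σ ε B h 1) (foldDown σ ε B h 1) = 2 * h ^ 2 - 1 := by
  have hp : (0 : ℝ) ≤ 1 - h ^ 2 := by nlinarith [(hf.bounds hh).1]
  rw [hf.foldUp_one h0 hh, hf.foldDown_one h0 hh, hB.inner_comb]
  linear_combination -Real.sq_sqrt hp

/-- The inner product of the directions of the two row creases of the straight-line vertex. -/
theorem IsFoldable.inner_first (hf : IsFoldable n σ ε) (hB : B.IsOrtho) (h0 : 0 ≤ h)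
    (hh : h ≤ Real.sin (σ.nw 1)) :
    -Real.cos (σ.ne 1 - σ.nw 1) < inner ℝ (foldDir σ ε B h 0) (foldDir σ ε B h 1) ∧
      (0 < h → inner ℝ (foldDir σ ε B h 0) (foldDir σ ε B h 1) < -Real.cos (σ.ne 1 + σ.nw 1)) := by
  obtain ⟨b1, b2, b3⟩ := hf.bounds hh
  have hp : (0 : ℝ) < 1 - h ^ 2 := by nlinarith
  have e1 := sq_sqrt_tilt h0 b1 b2.le
  have e2 := sq_sqrt_tilt h0 b1 hh
  have e3 := tilt_mul h0 b1 (σ.ne 1)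
  have e4 := tilt_mul h0 b1 (σ.nw 1)
  have e5 := Real.sq_sqrt hp.le
  have e6 : inner ℝ (foldDir σ ε B h 0) (foldDir σ ε B h 1) =
      -(tilt (σ.ne 1) h * tilt (σ.nw 1) h -
        √(1 - tilt (σ.ne 1) h ^ 2) * √(1 - tilt (σ.nw 1) h ^ 2)) := by
    simp only [foldDir, if_pos, one_ne_zero, if_false, Nat.sub_self, foldFrame, Frame.first,
      Frame.leftDir, inner_neg_left, hB.inner_comb]
    ring
  rw [e6]
  set R := √(1 - h ^ 2) * √(1 - tilt (σ.ne 1) h ^ 2) with hR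
  set R' := √(1 - h ^ 2) * √(1 - tilt (σ.nw 1) h ^ 2) with hR'
  have hR0 : 0 ≤ R := by positivity
  have hR0' : 0 ≤ R' := by positivity
  set x := tilt (σ.ne 1) h * tilt (σ.nw 1) h -
    √(1 - tilt (σ.ne 1) h ^ 2) * √(1 - tilt (σ.nw 1) h ^ 2) with hx
  -- multiplied by `1 - h ^ 2`, the inner product has no denominators
  have e7 : (1 - h ^ 2) * x = Real.cos (σ.ne 1) * Real.cos (σ.nw 1) - R * R' := by
    rw [← e3, ← e4, hx, hR, hR']
    linear_combination -(tilt (σ.ne 1) h * tilt (σ.nw 1) h -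
      √(1 - tilt (σ.ne 1) h ^ 2) * √(1 - tilt (σ.nw 1) h ^ 2)) * e5
  have hsa : 0 < Real.sin (σ.nw 1) :=
    Real.sin_pos_of_mem_Ioo (hf.angles.nw 1 ⟨le_rfl, hf.one_le⟩)
  have hlt := hf.sin_lt
  have hss : h ^ 2 < Real.sin (σ.ne 1) * Real.sin (σ.nw 1) := by nlinarith
  constructor
  · rw [neg_lt_neg_iff]
    refine lt_of_mul_lt_mul_left ?_ hp.le
    rw [e7]
    have h1 := Real.cos_le_one (σ.ne 1 - σ.nw 1)
    rw [Real.cos_sub] at h1 ⊢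
    nlinarith [mul_nonneg hR0 hR0', mul_le_mul_of_nonneg_left h1 (sq_nonneg h)]
  · intro hpos
    rw [neg_lt_neg_iff]
    refine lt_of_mul_lt_mul_left ?_ hp.le
    rw [e7]
    have hne : Real.sin (σ.ne 1 + σ.nw 1) ≠ 0 := by
      intro h2
      have a1 := hf.angles.ne 1 ⟨le_rfl, hf.one_le⟩
      have a2 := hf.angles.nw 1 ⟨le_rfl, hf.one_le⟩
      have h3 : Real.sin (σ.ne 1 + σ.nw 1 - Real.pi) = 0 := by rw [Real.sin_sub_pi, h2, neg_zero]
      rw [Real.sin_eq_zero_iff_of_lt_of_lt (by linarith [a1.1, a2.1]) (by linarith [a1.2, a2.2])]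
        at h3
      rw [show σ.nw 1 = Real.pi - σ.ne 1 by linarith, Real.sin_pi_sub] at hlt
      exact lt_irrefl _ hlt
    set T := Real.sin (σ.ne 1) * Real.sin (σ.nw 1) - h ^ 2 *
      (Real.sin (σ.ne 1) * Real.sin (σ.nw 1) - Real.cos (σ.ne 1) * Real.cos (σ.nw 1)) with hT
    have hT0 : 0 < T := by
      have h1 := Real.neg_one_le_cos (σ.ne 1 + σ.nw 1)
      rw [Real.cos_add] at h1
      nlinarith [mul_le_mul_of_nonneg_left h1 (sq_nonneg h)]
    have hsq : (R * R') ^ 2 < T ^ 2 := by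
      have h1 : T ^ 2 - (R * R') ^ 2 = h ^ 2 * (1 - h ^ 2) * Real.sin (σ.ne 1 + σ.nw 1) ^ 2 := by
        rw [mul_pow, e1, e2, hT, Real.sin_add]
        have s1 := Real.sin_sq_add_cos_sq (σ.ne 1)
        have s2 := Real.sin_sq_add_cos_sq (σ.nw 1)
        generalize Real.sin (σ.ne 1) = S at *
        generalize Real.cos (σ.ne 1) = C at *
        generalize Real.sin (σ.nw 1) = S' at *
        generalize Real.cos (σ.nw 1) = C' at *
        grind
      have h2 : 0 < h ^ 2 * (1 - h ^ 2) * Real.sin (σ.ne 1 + σ.nw 1) ^ 2 :=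
        mul_pos (mul_pos (pow_pos hpos 2) hp) (by positivity)
      linarith
    have h3 := lt_of_pow_lt_pow_left₀ 2 hT0.le hsq
    rw [Real.cos_add]
    linarith

/-- No column crease is folded completely. -/
theorem IsFoldable.inner_dir_gt (hf : IsFoldable n σ ε) (hB : B.IsOrtho) (h0 : 0 ≤ h)
    (hh : h ≤ Real.sin (σ.nw 1)) {i : ℕ} (hi : i < n) :
    -Real.cos (σ.ne (i + 1) - σ.nw (i + 1)) < inner ℝ (foldDir σ ε B h i) (foldDir σ ε B h (i + 1)) ∧
    -Real.cos (σ.se (i + 1) - σ.sw (i + 1)) <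
      inner ℝ (foldDir σ ε B h i) (foldDir σ ε B h (i + 1)) := by
  rcases Nat.eq_zero_or_pos i with rfl | hi0
  · have h1 := (hf.inner_first hB h0 hh).1
    refine ⟨h1, ?_⟩
    rw [zero_add, show σ.se 1 - σ.sw 1 = -(σ.ne 1 - σ.nw 1) by
      linarith [hf.straight_left, hf.straight_right], Real.cos_neg]
    exact h1
  · obtain ⟨k, rfl⟩ : ∃ k, i = k + 1 := ⟨i - 1, by omega⟩
    have hk : k + 1 + 1 ∈ Set.Icc 2 n := ⟨by omega, hi⟩
    have hk1 : k + 1 + 1 ∈ Set.Icc 1 n := ⟨by omega, hi⟩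
    have h1 := (hf.isOrtho_foldFrame hB h0 hh (i := k) (by omega)).lt_inner_e_step
      (c := foldCos σ h) (hf.mode_sq _ hk) (hf.foldSin_pos h0 hh) (hf.mode_pos _ hk)
      (hf.angles.nw _ hk1) (hf.angles.sw _ hk1)
    have h2 := hf.flat _ hk
    rw [show σ.ne (k + 1 + 1) - σ.nw (k + 1 + 1) =
        Real.pi - (σ.nw (k + 1 + 1) + σ.sw (k + 1 + 1)) by linarith [h2.1],
      show σ.se (k + 1 + 1) - σ.sw (k + 1 + 1) =
        Real.pi - (σ.nw (k + 1 + 1) + σ.sw (k + 1 + 1)) by linarith [h2.2],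
      Real.cos_pi_sub, neg_neg, and_self]
    simpa [foldDir, foldFrame] using h1

theorem triple_ne_zero_of_gram {a b c : Space} {α β x : ℝ} (ha : ‖a‖ = 1) (hb : ‖b‖ = 1)
    (hc : ‖c‖ = 1) (hac : inner ℝ a c = -Real.cos α) (hbc : inner ℝ b c = Real.cos β)
    (hab : inner ℝ a b = x) (h1 : -Real.cos (β - α) < x) (h2 : x < -Real.cos (β + α)) :
    triple a b c ≠ 0 := by
  intro h0
  have h3 := triple_mul_triple a b c c
  rw [h0, real_inner_comm a c, real_inner_comm b c, hac, hbc, hab, real_inner_self_eq_norm_sq,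
    real_inner_self_eq_norm_sq, real_inner_self_eq_norm_sq, ha, hb, hc] at h3
  rw [Real.cos_sub] at h1
  rw [Real.cos_add] at h2
  have h4 : 0 < (x + Real.cos β * Real.cos α + Real.sin β * Real.sin α) *
      (Real.sin β * Real.sin α - (x + Real.cos β * Real.cos α)) :=
    mul_pos (by linarith) (by linarith)
  have s1 := Real.sin_sq_add_cos_sq α
  have s2 := Real.sin_sq_add_cos_sq β
  have h5 : (x + Real.cos β * Real.cos α + Real.sin β * Real.sin α) *
      (Real.sin β * Real.sin α - (x + Real.cos β * Real.cos α)) = 0 := by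
    generalize Real.sin α = S at *
    generalize Real.cos α = C at *
    generalize Real.sin β = S' at *
    generalize Real.cos β = C' at *
    grind
  linarith

/-- The row creases of the straight-line vertex lie on different sides of the plane of its column
creases. -/
theorem IsFoldable.triple_first (hf : IsFoldable n σ ε) (hB : B.IsOrtho) (h0 : 0 < h)
    (hh : h < Real.sin (σ.nw 1)) :
    0 < triple (foldUp σ ε B h 1) (foldDown σ ε B h 1) (foldDir σ ε B h 0) *
      triple (foldUp σ ε B h 1) (foldDown σ ε B h 1) (foldDir σ ε B h 1) := by
  obtain ⟨b1, b2, b3⟩ := hf.bounds hh.le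
  have hp : (0 : ℝ) < 1 - h ^ 2 := by nlinarith
  have e1 := sq_sqrt_tilt h0.le b1 b2.le
  have e2 := sq_sqrt_tilt h0.le b1 hh.le
  rw [triple_mul_triple, hf.foldUp_one h0.le hh.le, hf.foldDown_one h0.le hh.le]
  simp only [foldDir, if_pos, one_ne_zero, if_false, Nat.sub_self, foldFrame, Frame.first,
    Frame.leftDir, inner_neg_left, hB.inner_comb]
  have g1 : 0 < √(1 - h ^ 2) * √(1 - tilt (σ.ne 1) h ^ 2) :=
    lt_of_le_of_ne (by positivity) fun h3 => by rw [← h3] at e1; nlinarith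
  have g2 : 0 < √(1 - h ^ 2) * √(1 - tilt (σ.nw 1) h ^ 2) :=
    lt_of_le_of_ne (by positivity) fun h3 => by rw [← h3] at e2; nlinarith
  have g3 : 0 < 4 * h ^ 2 * ((√(1 - h ^ 2) * √(1 - tilt (σ.ne 1) h ^ 2)) *
    (√(1 - h ^ 2) * √(1 - tilt (σ.nw 1) h ^ 2))) := by positivity
  refine g3.trans_le (le_of_eq ?_)
  ring

/-- The sign of `ε i` tells whether the row creases of the vertex `i` lie on the same side of the plane
of its column creases. -/
theorem IsFoldable.triple_fold (hf : IsFoldable n σ ε) (hB : B.IsOrtho) (h0 : 0 < h)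
    (hh : h ≤ Real.sin (σ.nw 1)) {i : ℕ} (hi : i ∈ Set.Icc 2 n) :
    ∃ r : ℝ, 0 < r ∧ triple (foldUp σ ε B h i) (foldDown σ ε B h i) (foldDir σ ε B h (i - 1)) *
      triple (foldUp σ ε B h i) (foldDown σ ε B h i) (foldDir σ ε B h i) = ε i * r := by
  obtain ⟨k, rfl⟩ : ∃ k, i = k + 1 + 1 := ⟨i - 2, by have := hi.1; omega⟩
  have hk1 : k + 1 + 1 ∈ Set.Icc 1 n := ⟨by omega, hi.2⟩
  have hk2 : k + 1 + 1 ≤ n := hi.2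
  have h1 := (hf.isOrtho_foldFrame hB h0.le hh (i := k) (by omega)).triple_step
    (hf.mode_sq _ hi) (hf.fold_sq h0.le hh) (hf.stepDenom_pos h0.le hh hi).ne'
  refine ⟨(2 * Real.sin (σ.nw (k + 1 + 1)) * Real.sin (σ.sw (k + 1 + 1)) * foldCos σ h *
    foldSin σ h) ^ 2, ?_, ?_⟩
  rotate_left
  · rw [hf.foldUp_succ h0.le hh (by omega) hk2, hf.foldDown_succ h0.le hh (by omega) hk2]
    simpa [foldDir, foldFrame] using h1
  · have a1 := Real.sin_pos_of_mem_Ioo (hf.angles.nw _ hk1)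
    have a2 := Real.sin_pos_of_mem_Ioo (hf.angles.sw _ hk1)
    have a3 := hf.foldSin_pos h0.le hh
    have a4 : 0 < foldCos σ h := div_pos h0 (hf.bounds hh).2.2
    positivity

end Fold

/-! ### Rigidity: the folded states of a row -/

theorem triple_smul_left (a b c : Space) (r : ℝ) : triple (r • a) b c = r * triple a b c := by
  simp [triple]; ring

theorem triple_smul_mid (a b c : Space) (r : ℝ) : triple a (r • b) c = r * triple a b c := by
  simp [triple]; ring

section Base

variable {n : ℕ} {σ : SectorAngles} {ε : ℕ → ℝ}

/-- The configuration of the four creases of the straight-line vertex is determined up to congruence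
by half the length of the sum of its two column creases, which is at most `sin (σ.nw 1)`. -/
theorem IsFoldable.exists_frame (hf : IsFoldable n σ ε) {u d e₀ e₁ : Space} {h : ℝ}
    (hu : ‖u‖ = 1) (hd : ‖d‖ = 1) (he₀ : ‖e₀‖ = 1) (he₁ : ‖e₁‖ = 1)
    (hu₀ : inner ℝ e₀ u = -Real.cos (σ.nw 1)) (hd₀ : inner ℝ e₀ d = Real.cos (σ.nw 1))
    (hu₁ : inner ℝ e₁ u = Real.cos (σ.ne 1)) (hd₁ : inner ℝ e₁ d = -Real.cos (σ.ne 1))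
    (h0 : 0 < h) (hh : h ≤ Real.sin (σ.nw 1)) (hud : inner ℝ u d = 2 * h ^ 2 - 1)
    (hs : h = Real.sin (σ.nw 1) ∨ h < Real.sin (σ.nw 1) ∧ 0 < triple u d e₀ * triple u d e₁) :
    ∃ B : Frame, B.IsOrtho ∧ foldUp σ ε B h 1 = u ∧ foldDown σ ε B h 1 = d ∧
      foldDir σ ε B h 0 = e₀ ∧ foldDir σ ε B h 1 = e₁ := by
  obtain ⟨b1, b2, b3⟩ := hf.bounds hh
  have hp : (0 : ℝ) < 1 - h ^ 2 := by nlinarith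
  have hg := sqrt_pos_of_lt_sin h0.le b1
  have hg2 := Real.sq_sqrt hp.le
  have ht := tilt_mul h0.le b1 (σ.ne 1)
  have ht' := tilt_mul h0.le b1 (σ.nw 1)
  have hr2 := Real.sq_sqrt (sub_nonneg.2 (tilt_sq_le h0.le b1 b2.le))
  have hr : 0 < √(1 - tilt (σ.ne 1) h ^ 2) := by
    refine lt_of_le_of_ne (Real.sqrt_nonneg _) fun h3 => ?_
    have h4 := sq_sqrt_tilt h0.le b1 b2.le
    rw [← h3] at h4
    nlinarith
  set g := √(1 - h ^ 2)
  set r := √(1 - tilt (σ.ne 1) h ^ 2)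
  set t := tilt (σ.ne 1) h
  have huu : inner ℝ u u = (1 : ℝ) := by rw [real_inner_self_eq_norm_sq, hu, one_pow]
  have hdd : inner ℝ d d = (1 : ℝ) := by rw [real_inner_self_eq_norm_sq, hd, one_pow]
  have h11 : inner ℝ e₁ e₁ = (1 : ℝ) := by rw [real_inner_self_eq_norm_sq, he₁, one_pow]
  have h00 : inner ℝ e₀ e₀ = (1 : ℝ) := by rw [real_inner_self_eq_norm_sq, he₀, one_pow]
  have hdu : inner ℝ d u = 2 * h ^ 2 - 1 := by rw [real_inner_comm, hud]
  have hu1 : inner ℝ u e₁ = Real.cos (σ.ne 1) := by rw [real_inner_comm, hu₁]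
  have hd1 : inner ℝ d e₁ = -Real.cos (σ.ne 1) := by rw [real_inner_comm, hd₁]
  have hu0 : inner ℝ u e₀ = -Real.cos (σ.nw 1) := by rw [real_inner_comm, hu₀]
  have hd0 : inner ℝ d e₀ = Real.cos (σ.nw 1) := by rw [real_inner_comm, hd₀]
  set E : Space := (2 * g)⁻¹ • (u - d) with hE
  set M : Space := (2 * h)⁻¹ • (u + d) with hM
  set K : Space := r⁻¹ • (t • E - e₁) with hK
  have hEE : inner ℝ E E = (1 : ℝ) := by
    simp only [hE, inner_sub_left, inner_sub_right, real_inner_smul_left, real_inner_smul_right,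
      huu, hdd, hud, hdu]
    field_simp
    linear_combination -4 * hg2
  have hMM : inner ℝ M M = (1 : ℝ) := by
    simp only [hM, inner_add_left, inner_add_right, real_inner_smul_left, real_inner_smul_right,
      huu, hdd, hud, hdu]
    field_simp
    ring
  have hEM : inner ℝ E M = (0 : ℝ) := by
    simp only [hE, hM, inner_add_right, inner_sub_left, real_inner_smul_left,
      real_inner_smul_right, huu, hdd, hud, hdu]
    ring
  have hE1 : inner ℝ E e₁ = t := by
    simp only [hE, inner_sub_left, real_inner_smul_left, hu1, hd1, ← ht]
    field_simp
    ring
  have hM1 : inner ℝ M e₁ = (0 : ℝ) := by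
    simp only [hM, inner_add_left, real_inner_smul_left, hu1, hd1]
    ring
  have h1E : inner ℝ e₁ E = t := by rw [real_inner_comm, hE1]
  have hKK : inner ℝ K K = (1 : ℝ) := by
    simp only [hK, inner_sub_left, inner_sub_right, real_inner_smul_left, real_inner_smul_right,
      hEE, hE1, h1E, h11]
    field_simp
    linear_combination -hr2
  have hEK : inner ℝ E K = (0 : ℝ) := by
    simp only [hK, inner_sub_right, real_inner_smul_right, hEE, hE1]
    ring
  have hMK : inner ℝ M K = (0 : ℝ) := by
    simp only [hK, inner_sub_right, real_inner_smul_right, real_inner_comm E M, hEM, hM1]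
    ring
  let B : Frame := ⟨E, M, K⟩
  have hB : B.IsOrtho := ⟨hEE, hMM, hKK, hEM, hEK, hMK⟩
  have kU : foldUp σ ε B h 1 = u := by
    rw [hf.foldUp_one h0.le hh, Frame.comb]
    change g • E + h • M + (0 : ℝ) • K = u
    rw [hE, hM]
    match_scalars <;> field_simp <;> ring
  have kD : foldDown σ ε B h 1 = d := by
    rw [hf.foldDown_one h0.le hh, Frame.comb]
    change (-g) • E + h • M + (0 : ℝ) • K = d
    rw [hE, hM]
    match_scalars <;> field_simp <;> ring
  have k1 : foldDir σ ε B h 1 = e₁ := by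
    change t • E + (0 : ℝ) • M + (-r) • K = e₁
    rw [hK, smul_smul (-r), neg_mul, mul_inv_cancel₀ hr.ne']
    module
  have hm := hf.isRowModel hB h0.le hh 0 0
  have k0n : ‖foldDir σ ε B h 0‖ = 1 := hm.unit 0 (Nat.zero_le n)
  refine ⟨B, hB, kU, kD, ?_, k1⟩
  rcases hs with hs | ⟨hs, hT⟩
  · -- the left row crease is folded completely and lies in the plane of the column creases
    have h1 : tilt (σ.nw 1) h ^ 2 = 1 := by
      have h2 : tilt (σ.nw 1) h ^ 2 * g ^ 2 = g ^ 2 := by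
        rw [← mul_pow, ht', hg2, hs]
        linarith [Real.sin_sq_add_cos_sq (σ.nw 1)]
      exact mul_right_cancel₀ (pow_pos hg 2).ne' (h2.trans (one_mul _).symm)
    have h2 : foldDir σ ε B h 0 = -(tilt (σ.nw 1) h • E) := by
      change -(tilt (σ.nw 1) h • E + (0 : ℝ) • M + √(1 - tilt (σ.nw 1) h ^ 2) • K) = _
      rw [h1, sub_self, Real.sqrt_zero]
      module
    have h3 : inner ℝ e₀ E = -tilt (σ.nw 1) h := by
      simp only [hE, inner_sub_right, real_inner_smul_right, hu₀, hd₀, ← ht']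
      field_simp
      ring
    rw [h2, eq_comm, ← sub_eq_zero, ← inner_self_eq_zero (𝕜 := ℝ)]
    simp only [inner_sub_left, inner_sub_right, inner_neg_left, inner_neg_right,
      real_inner_smul_left, real_inner_smul_right, h00, hEE, h3, real_inner_comm e₀ E]
    linear_combination -h1
  · have h1 := hf.triple_first hB h0 hs
    rw [kU, kD, k1] at h1
    have i1 := hf.inner_up_down_first hB h0.le hh
    have e0 := hm.upper.inner_eq 0 (Nat.zero_le n)
    have e0' := hm.lower.inner_eq 0 (Nat.zero_le n)
    have c1 : clampIdx n 0 = 1 := clampIdx_zero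
    have h4 : σ.sw 1 = Real.pi - σ.nw 1 := by linarith [hf.straight_left]
    simp only [foldUpper, foldLower, c1, scale_zero, scale_one, one_smul, one_mul, startAngle,
      if_pos, Real.cos_pi_sub, kU, kD, h4, neg_neg] at e0 e0'
    refine eq_of_inner_eq (a := u) (b := d) (by rw [k0n, he₀]) ?_ ?_ ?_
    · rw [real_inner_comm, e0, hu0]
    · rw [real_inner_comm, e0', hd0]
    · exact pos_of_mul_pos_right ((mul_pos h1 hT).trans_eq (by ring)) (sq_nonneg (triple u d e₁))

/-- A row in space whose straight-line vertex is that of the folding motion, and whose other vertices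
are folded in the ways `ε`, is the row of the folding motion. -/
theorem IsFoldable.rowModel_eq (hf : IsFoldable n σ ε) {B : Frame} (hB : B.IsOrtho) {h : ℝ}
    (h0 : 0 < h) (hh : h ≤ Real.sin (σ.nw 1)) {L : ℕ → ℝ} {A e U D : ℕ → Space}
    (hm : IsRowModel n σ L A e U D) (hU : foldUp σ ε B h 1 = U 1) (hD : foldDown σ ε B h 1 = D 1)
    (he₀ : foldDir σ ε B h 0 = e 0) (he₁ : foldDir σ ε B h 1 = e 1)
    (hε : ∀ i ∈ Set.Icc 2 n,
      0 < ε i * (triple (U i) (D i) (e (i - 1)) * triple (U i) (D i) (e i))) :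
    ∀ i ≤ n, e i = foldDir σ ε B h i := by
  have hm' := hf.isRowModel hB h0.le hh 0 L
  have c1 : clampIdx n 1 = 1 := clampIdx_of_mem ⟨le_rfl, hf.one_le⟩
  have key : ∀ i ∈ Set.Icc 1 n, U i = foldUpper n σ ε B h i ∧ D i = foldLower n σ ε B h i ∧
      e i = foldDir σ ε B h i := by
    rintro i ⟨hi1, hi2⟩
    induction i, hi1 using Nat.le_induction with
    | base => simp [foldUpper, foldLower, c1, scale_one, hU, hD, he₁]
    | succ i hi1 ih =>
      obtain ⟨e1, e2, e3⟩ := ih (by omega)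
      have hi : i ∈ Set.Icc 1 n := ⟨hi1, by omega⟩
      have hi' : i + 1 ∈ Set.Icc 2 n := ⟨by omega, hi2⟩
      have k1 : U (i + 1) = foldUpper n σ ε B h (i + 1) := by
        rw [hm.upper.succ i hi.2, hm'.upper.succ i hi.2, e1, e3]
      have k2 : D (i + 1) = foldLower n σ ε B h (i + 1) := by
        rw [hm.lower.succ i hi.2, hm'.lower.succ i hi.2, e2, e3]
      refine ⟨k1, k2, eq_of_inner_eq (a := U (i + 1)) (b := D (i + 1))
        (by rw [hm.unit _ hi2, hm'.unit _ hi2]) ?_ ?_ ?_⟩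
      · rw [real_inner_comm, hm.upper.inner_eq _ hi2, real_inner_comm, k1, hm'.upper.inner_eq _ hi2]
      · rw [real_inner_comm, hm.lower.inner_eq _ hi2, real_inner_comm, k2, hm'.lower.inner_eq _ hi2]
      · have h1 := hε _ hi'
        obtain ⟨r, hr, h2⟩ := hf.triple_fold hB h0 hh hi'
        have c2 : clampIdx n (i + 1) = i + 1 := clampIdx_of_mem ⟨by omega, hi2⟩
        have s1 := scale_pos hf.angles.ne hf.angles.nw hi2
        have s2 := scale_pos hf.angles.se hf.angles.sw hi2
        have hq := hf.mode_sq _ hi'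
        rw [k1, k2, Nat.add_sub_cancel, e3] at h1
        rw [k1, k2]
        simp only [foldUpper, foldLower, c2, triple_smul_left, triple_smul_mid,
          Nat.add_sub_cancel] at h1 h2 ⊢
        set s := scale σ.ne σ.nw (i + 1)
        set s' := scale σ.se σ.sw (i + 1)
        set T := triple (foldUp σ ε B h (i + 1)) (foldDown σ ε B h (i + 1)) (foldDir σ ε B h i)
        set X := triple (foldUp σ ε B h (i + 1)) (foldDown σ ε B h (i + 1)) (e (i + 1))
        set Y := triple (foldUp σ ε B h (i + 1)) (foldDown σ ε B h (i + 1))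
          (foldDir σ ε B h (i + 1))
        have h3 : 0 < (s * s') ^ 2 * (ε (i + 1) * (T * X)) := h1.trans_eq (by ring)
        have h4 : 0 < ε (i + 1) * (T * X) := pos_of_mul_pos_right h3 (sq_nonneg _)
        have h5 : 0 < ε (i + 1) * (T * Y) := by
          rw [h2, ← mul_assoc, ← sq, hq, one_mul]; exact hr
        have h6 : 0 < (ε (i + 1) * T) ^ 2 * (X * Y) := (mul_pos h4 h5).trans_eq (by ring)
        have h7 : 0 < X * Y := pos_of_mul_pos_right h6 (sq_nonneg _)
        have h8 : 0 < (s * s') ^ 2 * (X * Y) := mul_pos (by positivity) h7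
        exact h8.trans_eq (by ring)
  intro i hi
  rcases Nat.eq_zero_or_pos i with rfl | hi0
  · exact he₀.symm
  · exact (key i ⟨hi0, hi⟩).2.2

end Base

/-! ### The datum row as the final state of the motion -/

/-- `1` if the row passes through the plane of the column creases at vertex `i`, and `-1` if it stays on
one side of that plane. -/
def Row.mode (R : Row) (i : ℕ) : ℝ :=
  if 0 < triple (R.u i) (R.d i) (R.dir (i - 1)) * triple (R.u i) (R.d i) (R.dir i) then 1 else -1

theorem triple_ne_zero_of_fold {u d e : Space} (hu : ‖u‖ = 1) (hd : ‖d‖ = 1) (he : ‖e‖ = 1)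
    {α β ρ : ℝ} (hα : α ∈ Set.Ioo 0 Real.pi) (hβ : β ∈ Set.Ioo 0 Real.pi)
    (hρ : ρ ∈ Set.Ioo 0 Real.pi) (h1 : inner ℝ u e = Real.cos α) (h2 : inner ℝ d e = Real.cos β)
    (h3 : inner ℝ u d = Real.cos α * Real.cos β + Real.sin α * Real.sin β * Real.cos ρ) :
    triple u d e ≠ 0 := by
  intro h0
  have h4 := triple_mul_triple u d e e
  rw [h0, real_inner_comm u e, real_inner_comm d e, h1, h2, h3, real_inner_self_eq_norm_sq,
    real_inner_self_eq_norm_sq, real_inner_self_eq_norm_sq, hu, hd, he] at h4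
  have h5 : (Real.sin α * Real.sin β * Real.sin ρ) ^ 2 = 0 := by
    have s1 := Real.sin_sq_add_cos_sq α
    have s2 := Real.sin_sq_add_cos_sq β
    have s3 := Real.sin_sq_add_cos_sq ρ
    generalize Real.sin α = a at *
    generalize Real.sin β = b at *
    generalize Real.sin ρ = c at *
    grind
  have h6 := mul_pos (mul_pos (Real.sin_pos_of_mem_Ioo hα) (Real.sin_pos_of_mem_Ioo hβ))
    (Real.sin_pos_of_mem_Ioo hρ)
  exact h6.ne' (pow_eq_zero_iff two_ne_zero |>.1 h5)

section Datum

variable {n : ℕ} {R : Row}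

theorem IsDatumRow.triple_right_ne_zero (h : IsDatumRow n R) {i : ℕ} (hi : i ∈ Set.Icc 1 n) :
    triple (R.u i) (R.d i) (R.dir i) ≠ 0 :=
  triple_ne_zero_of_fold (h.unit_u i hi) (h.unit_d i hi) (h.norm_dir (hi.1.trans hi.2) hi.2)
    (h.anglesMem.ne i hi) (h.anglesMem.se i hi) h.fold_mem
    (by rw [real_inner_comm, h.inner_ne hi]) (by rw [real_inner_comm, h.inner_se hi]) (h.inner_ud hi)

theorem IsDatumRow.triple_left_ne_zero (h : IsDatumRow n R) {i : ℕ} (hi1 : 1 ≤ i)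
    (hi2 : i + 1 ≤ n) : triple (R.u (i + 1)) (R.d (i + 1)) (R.dir i) ≠ 0 := by
  have hi : i + 1 ∈ Set.Icc 1 n := ⟨by omega, hi2⟩
  have h1 := triple_ne_zero_of_fold (e := -R.dir i) (h.unit_u _ hi) (h.unit_d _ hi)
    (by rw [norm_neg]; exact h.norm_dir (by omega) (by omega))
    (h.anglesMem.nw _ hi) (h.anglesMem.sw _ hi) h.fold_mem
    (by rw [inner_neg_right, real_inner_comm, h.inner_nw hi2, neg_neg])
    (by rw [inner_neg_right, real_inner_comm, h.inner_sw hi2, neg_neg]) (h.inner_ud_left hi1 hi2).1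
  rw [triple_neg_right] at h1
  exact neg_ne_zero.1 h1

theorem IsDatumRow.mode_mul_pos (h : IsDatumRow n R) {i : ℕ} (hi : i ∈ Set.Icc 2 n) :
    0 < R.mode i *
      (triple (R.u i) (R.d i) (R.dir (i - 1)) * triple (R.u i) (R.d i) (R.dir i)) := by
  obtain ⟨k, rfl⟩ : ∃ k, i = k + 1 := ⟨i - 1, by have := hi.1; omega⟩
  have hk := hi.1
  have h1 := mul_ne_zero (h.triple_left_ne_zero (i := k) (by omega) hi.2)
    (h.triple_right_ne_zero (i := k + 1) ⟨by omega, hi.2⟩)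
  rw [Row.mode]
  split_ifs with h2
  · rw [one_mul]; exact h2
  · have h3 := lt_of_le_of_ne (not_lt.1 h2) h1
    linarith

/-- A datum row can be folded: a vertex with vanishing denominator would have its row creases
on a line or on top of each other. -/
theorem IsDatumRow.isFoldable (h : IsDatumRow n R) (hn : 1 ≤ n) :
    IsFoldable n R.angles R.mode where
  one_le := hn
  angles := h.anglesMem
  straight_right := h.straight.1
  straight_left := h.straight.2
  sin_lt := h.sin_nw_lt hn
  flat := h.flat_foldable
  mode_sq i _ := by rw [Row.mode]; split_ifs <;> norm_num
  mode_pos i hi := by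
    have hi' : i ∈ Set.Icc 1 n := ⟨one_le_two.trans hi.1, hi.2⟩
    have a1 := h.anglesMem.nw i hi'
    have a2 := h.anglesMem.sw i hi'
    rw [Row.mode]
    split_ifs with h2
    · have h3 : Real.cos (R.angles.nw i + R.angles.sw i) ≠ 1 := by
        intro h4
        have := (Real.cos_eq_one_iff_of_lt_of_lt
          (by linarith [a1.1, a2.1, Real.pi_pos]) (by linarith [a1.2, a2.2])).1 h4
        linarith [a1.1, a2.1]
      have := lt_of_le_of_ne (Real.cos_le_one _) h3
      linarith
    · have h3 : Real.cos (R.angles.nw i + R.angles.sw i) ≠ -1 := by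
        intro h4
        have h5 : R.angles.nw i + R.angles.sw i - Real.pi = 0 :=
          (Real.cos_eq_one_iff_of_lt_of_lt (by linarith [a1.1, a2.1, Real.pi_pos])
            (by linarith [a1.2, a2.2, Real.pi_pos])).1 (by rw [Real.cos_sub_pi, h4, neg_neg])
        obtain ⟨k, rfl⟩ : ∃ k, i = k + 1 := ⟨i - 1, by have := hi.1; omega⟩
        have hk : k < n := hi.2
        have hk1 : 1 ≤ k := by have := hi.1; omega
        have hff := h.flat_foldable _ hi
        refine (h.dir_ne hk).2 (eq_of_inner_eq (a := R.u (k + 1)) (b := R.d (k + 1))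
          (by rw [norm_neg, h.norm_dir hn hk, h.norm_dir hn hk.le]) ?_ ?_ ?_)
        · rw [inner_neg_right, real_inner_comm, h.inner_ne hi', real_inner_comm, h.inner_nw hk,
            neg_neg]
          congr 1; linarith [hff.1]
        · rw [inner_neg_right, real_inner_comm, h.inner_se hi', real_inner_comm, h.inner_sw hk,
            neg_neg]
          congr 1; linarith [hff.2]
        · have h6 := lt_of_le_of_ne (not_lt.1 h2) (mul_ne_zero
            (h.triple_left_ne_zero hk1 hk) (h.triple_right_ne_zero hi'))
          rw [Nat.add_sub_cancel] at h6
          rw [triple_neg_right]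
          linarith
      have := lt_of_le_of_ne (Real.neg_one_le_cos _) (Ne.symm h3)
      linarith

/-- The datum row is the final state of the folding motion. -/
theorem IsDatumRow.exists_frame (h : IsDatumRow n R) (hn : 1 ≤ n) :
    ∃ B : Frame, B.IsOrtho ∧
      foldUp R.angles R.mode B (Real.sin (R.angles.nw 1)) 1 = R.u 1 ∧
      foldDown R.angles R.mode B (Real.sin (R.angles.nw 1)) 1 = R.d 1 ∧
      ∀ i ≤ n, R.dir i = foldDir R.angles R.mode B (Real.sin (R.angles.nw 1)) i := by
  have h1 : (1 : ℕ) ∈ Set.Icc 1 n := ⟨le_rfl, hn⟩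
  have hf := h.isFoldable hn
  have h0 := Real.sin_pos_of_mem_Ioo (h.anglesMem.nw 1 h1)
  have c1 : clampIdx n 1 = 1 := clampIdx_of_mem h1
  have hsw : R.angles.sw 1 = Real.pi - R.angles.nw 1 := by linarith [h.straight.2]
  have hse : R.angles.se 1 = Real.pi - R.angles.ne 1 := by linarith [h.straight.1]
  obtain ⟨B, hB, kU, kD, k0, k1⟩ := hf.exists_frame (h.unit_u 1 h1) (h.unit_d 1 h1)
    (h.norm_dir hn (Nat.zero_le n)) (h.norm_dir hn hn) (h.inner_nw hn)
    (by rw [h.inner_sw hn, zero_add, hsw, Real.cos_pi_sub, neg_neg]) (h.inner_ne h1)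
    (by rw [h.inner_se h1, hse, Real.cos_pi_sub]) h0 le_rfl
    (by
      rw [h.inner_first_left hn, hsw, Real.cos_pi_sub, Real.sin_pi_sub]
      linear_combination -Real.sin_sq_add_cos_sq (R.angles.nw 1)) (Or.inl rfl)
  refine ⟨B, hB, kU, kD, hf.rowModel_eq hB h0 le_rfl (h.isRowModel hn) ?_ ?_ k0 k1 ?_⟩
  · rw [Row.upper, c1, scale_one, one_smul, kU]
  · rw [Row.lower, c1, scale_one, one_smul, kD]
  · intro i hi
    have hi' : i ∈ Set.Icc 1 n := ⟨one_le_two.trans hi.1, hi.2⟩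
    have s1 := scale_pos h.anglesMem.ne h.anglesMem.nw hi.2
    have s2 := scale_pos h.anglesMem.se h.anglesMem.sw hi.2
    simp only [Row.upper, Row.lower, clampIdx_of_mem hi', triple_smul_left, triple_smul_mid]
    have h3 := mul_pos (pow_pos (mul_pos s1 s2) 2) (h.mode_mul_pos hi)
    exact h3.trans_eq (by ring)

end Datum

/-! ### Congruent motions -/

/-- Two frames are related by an isometry. -/
theorem Frame.IsOrtho.exists_isometry {B B' : Frame} (hB : B.IsOrtho) (hB' : B'.IsOrtho) :
    ∃ g : Space ≃ₗᵢ[ℝ] Space, g B.e = B'.e ∧ g B.m = B'.m ∧ g B.k = B'.k := by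
  have key : ∀ {F : Frame}, F.IsOrtho → ∃ b : OrthonormalBasis (Fin 3) ℝ Space,
      b 0 = F.e ∧ b 1 = F.m ∧ b 2 = F.k := by
    intro F hF
    have ho : Orthonormal ℝ ![F.e, F.m, F.k] := by
      rw [orthonormal_iff_ite]
      intro i j
      fin_cases i <;> fin_cases j <;>
        simp [hF.inner_ee, hF.inner_mm, hF.inner_kk, hF.inner_em, hF.inner_ek, hF.inner_mk,
          real_inner_comm F.e F.m, real_inner_comm F.e F.k, real_inner_comm F.m F.k,
          -inner_self_eq_norm_sq_to_K]
    let b := basisOfOrthonormalOfCardEqFinrank ho (by simp)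
    have hb : ⇑b = ![F.e, F.m, F.k] := coe_basisOfOrthonormalOfCardEqFinrank ho _
    refine ⟨b.toOrthonormalBasis (by rw [hb]; exact ho), ?_, ?_, ?_⟩ <;>
      simp [hb]
  obtain ⟨b, h0, h1, h2⟩ := key hB
  obtain ⟨b', h0', h1', h2'⟩ := key hB'
  refine ⟨b.equiv b' (Equiv.refl _), ?_, ?_, ?_⟩
  · rw [← h0, ← h0', OrthonormalBasis.equiv_apply_basis]; rfl
  · rw [← h1, ← h1', OrthonormalBasis.equiv_apply_basis]; rfl
  · rw [← h2, ← h2', OrthonormalBasis.equiv_apply_basis]; rfl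

section Congruence

variable (σ : SectorAngles) (ε : ℕ → ℝ) {B B' : Frame} {g : Space ≃ₗᵢ[ℝ] Space}

theorem map_foldFrame (he : g B.e = B'.e) (hm : g B.m = B'.m) (hk : g B.k = B'.k) (h : ℝ) (i : ℕ) :
    g (foldFrame σ ε B h i).e = (foldFrame σ ε B' h i).e ∧
      g (foldFrame σ ε B h i).m = (foldFrame σ ε B' h i).m ∧
      g (foldFrame σ ε B h i).k = (foldFrame σ ε B' h i).k := by
  induction i with
  | zero => simp [foldFrame, Frame.first, Frame.comb, he, hm, hk]
  | succ i ih => simp [foldFrame, Frame.step, Frame.comb, ih.1, ih.2.1, ih.2.2]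

theorem map_fold (he : g B.e = B'.e) (hm : g B.m = B'.m) (hk : g B.k = B'.k) (h : ℝ) (i : ℕ) :
    g (foldDir σ ε B h i) = foldDir σ ε B' h i ∧ g (foldUp σ ε B h i) = foldUp σ ε B' h i ∧
      g (foldDown σ ε B h i) = foldDown σ ε B' h i := by
  have h1 := map_foldFrame σ ε he hm hk h (i - 1)
  refine ⟨?_, ?_, ?_⟩
  · rw [foldDir, foldDir]
    split_ifs
    · simp [Frame.leftDir, Frame.comb, he, hk]
    · exact h1.1
  · simp [foldUp, Frame.crease, Frame.comb, h1.1, h1.2.1, h1.2.2]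
  · simp [foldDown, Frame.crease, Frame.comb, h1.1, h1.2.1, h1.2.2]

end Congruence

/-! ### The folding motion: continuity, the planar state, and clashes -/

/-- The mesh generated by the row of the folding motion with the parameter `h`. -/
def foldMesh (n : ℕ) (σ : SectorAngles) (ε : ℕ → ℝ) (B : Frame) (O : Space) (L x y : ℕ → ℝ) (h : ℝ) :
    ℕ → ℕ → Space :=
  mesh (pathVertex O L (foldDir σ ε B h)) (foldUpper n σ ε B h) (foldLower n σ ε B h) x y

section Continuity

variable {n : ℕ} {σ : SectorAngles} {ε : ℕ → ℝ} {B : Frame}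

theorem continuousOn_comb {F : ℝ → Frame} {S : Set ℝ} {x y z : ℝ → ℝ}
    (hF : ContinuousOn (fun h => (F h).e) S ∧ ContinuousOn (fun h => (F h).m) S ∧
      ContinuousOn (fun h => (F h).k) S)
    (hx : ContinuousOn x S) (hy : ContinuousOn y S) (hz : ContinuousOn z S) :
    ContinuousOn (fun h => (F h).comb (x h) (y h) (z h)) S :=
  ((hx.smul hF.1).add (hy.smul hF.2.1)).add (hz.smul hF.2.2)

theorem IsFoldable.continuousOn_tilt (hf : IsFoldable n σ ε) (α : ℝ) :
    ContinuousOn (tilt α) (Set.Icc 0 (Real.sin (σ.nw 1))) :=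
  continuousOn_const.div (by fun_prop) fun h hh =>
    (sqrt_pos_of_lt_sin hh.1 (hf.bounds hh.2).1).ne'

theorem continuous_foldCos (σ : SectorAngles) : Continuous (foldCos σ) :=
  continuous_id.div_const _

theorem continuous_foldSin (σ : SectorAngles) : Continuous (foldSin σ) :=
  (continuous_const.sub ((continuous_foldCos σ).pow 2)).sqrt

theorem IsFoldable.continuousOn_foldFrame (hf : IsFoldable n σ ε) {i : ℕ} (hi : i < n) :
    ContinuousOn (fun h => (foldFrame σ ε B h i).e) (Set.Icc 0 (Real.sin (σ.nw 1))) ∧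
    ContinuousOn (fun h => (foldFrame σ ε B h i).m) (Set.Icc 0 (Real.sin (σ.nw 1))) ∧
    ContinuousOn (fun h => (foldFrame σ ε B h i).k) (Set.Icc 0 (Real.sin (σ.nw 1))) := by
  induction i with
  | zero =>
    have h1 := hf.continuousOn_tilt (σ.ne 1)
    have h2 : ContinuousOn (fun h => √(1 - tilt (σ.ne 1) h ^ 2)) (Set.Icc 0 (Real.sin (σ.nw 1))) :=
      (continuousOn_const.sub (h1.pow 2)).sqrt
    have hB : ContinuousOn (fun _ : ℝ => B.e) (Set.Icc 0 (Real.sin (σ.nw 1))) ∧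
        ContinuousOn (fun _ : ℝ => B.m) (Set.Icc 0 (Real.sin (σ.nw 1))) ∧
        ContinuousOn (fun _ : ℝ => B.k) (Set.Icc 0 (Real.sin (σ.nw 1))) :=
      ⟨continuousOn_const, continuousOn_const, continuousOn_const⟩
    exact ⟨continuousOn_comb (F := fun _ => B) hB h1 continuousOn_const h2.neg, hB.2.1,
      continuousOn_comb (F := fun _ => B) hB h2 continuousOn_const h1⟩
  | succ i ih =>
    have h1 := ih (by omega)
    have hc := continuous_foldCos σ
    have hs := continuous_foldSin σ
    have hi' : i + 2 ∈ Set.Icc 2 n := ⟨by omega, hi⟩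
    have hD : ContinuousOn (fun h => (Frame.stepDenom (σ.nw (i + 2)) (σ.sw (i + 2)) (ε (i + 2))
        (foldCos σ h) (foldSin σ h))⁻¹) (Set.Icc 0 (Real.sin (σ.nw 1))) := by
      refine ContinuousOn.inv₀ ?_ fun h hh => (hf.stepDenom_pos hh.1 hh.2 hi').ne'
      unfold Frame.stepDenom
      exact Continuous.continuousOn (by fun_prop)
    refine ⟨hD.smul (continuousOn_comb h1 ?_ ?_ ?_), hD.smul (continuousOn_comb h1 ?_ ?_ ?_),
      hD.smul (continuousOn_comb h1 ?_ ?_ ?_)⟩ <;> exact Continuous.continuousOn (by fun_prop)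

theorem IsFoldable.continuousOn_foldDir (hf : IsFoldable n σ ε) {i : ℕ} (hi : i ≤ n) :
    ContinuousOn (fun h => foldDir σ ε B h i) (Set.Icc 0 (Real.sin (σ.nw 1))) := by
  rcases Nat.eq_zero_or_pos i with rfl | hi0
  · have h1 := hf.continuousOn_tilt (σ.nw 1)
    have h2 : ContinuousOn (fun h => √(1 - tilt (σ.nw 1) h ^ 2)) (Set.Icc 0 (Real.sin (σ.nw 1))) :=
      (continuousOn_const.sub (h1.pow 2)).sqrt
    exact (continuousOn_comb (F := fun _ => B)
      ⟨continuousOn_const, continuousOn_const, continuousOn_const⟩ h1 continuousOn_const h2).neg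
  · simp only [foldDir, if_neg hi0.ne']
    exact (hf.continuousOn_foldFrame (by omega)).1

theorem IsFoldable.continuousOn_foldUpper (hf : IsFoldable n σ ε) (i : ℕ) :
    ContinuousOn (fun h => foldUpper n σ ε B h i) (Set.Icc 0 (Real.sin (σ.nw 1))) := by
  have h1 := clampIdx_mem hf.one_le i
  have h2 := h1.1
  have h3 := h1.2
  have hc := (continuous_foldCos σ).continuousOn (s := Set.Icc 0 (Real.sin (σ.nw 1)))
  have hs := (continuous_foldSin σ).continuousOn (s := Set.Icc 0 (Real.sin (σ.nw 1)))
  have hF := hf.continuousOn_foldFrame (B := B) (i := clampIdx n i - 1) (by omega)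
  simp only [foldUpper, foldUp, Frame.crease]
  exact (continuousOn_comb hF continuousOn_const (continuousOn_const.mul hc)
    (continuousOn_const.mul hs)).const_smul (scale σ.ne σ.nw (clampIdx n i))

theorem IsFoldable.continuousOn_foldLower (hf : IsFoldable n σ ε) (i : ℕ) :
    ContinuousOn (fun h => foldLower n σ ε B h i) (Set.Icc 0 (Real.sin (σ.nw 1))) := by
  have h1 := clampIdx_mem hf.one_le i
  have h2 := h1.1
  have h3 := h1.2
  have hc := (continuous_foldCos σ).continuousOn (s := Set.Icc 0 (Real.sin (σ.nw 1)))
  have hs := (continuous_foldSin σ).continuousOn (s := Set.Icc 0 (Real.sin (σ.nw 1)))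
  have hF := hf.continuousOn_foldFrame (B := B) (i := clampIdx n i - 1) (by omega)
  simp only [foldLower, foldDown, Frame.crease]
  exact (continuousOn_comb hF continuousOn_const (continuousOn_const.mul hc)
    (continuousOn_const.mul hs.neg)).const_smul (scale σ.se σ.sw (clampIdx n i))

theorem IsFoldable.continuousOn_foldMesh (hf : IsFoldable n σ ε) (O : Space) (L x y : ℕ → ℝ)
    {i : ℕ} (hi : i ≤ n + 1) (j : ℕ) :
    ContinuousOn (fun h => foldMesh n σ ε B O L x y h i j) (Set.Icc 0 (Real.sin (σ.nw 1))) := by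
  have hA : ContinuousOn (fun h => pathVertex O L (foldDir σ ε B h) i)
      (Set.Icc 0 (Real.sin (σ.nw 1))) := by
    simp only [pathVertex]
    have h0 := (hf.continuousOn_foldDir (B := B) (Nat.zero_le n)).const_smul (L 0)
    refine (continuousOn_const.sub h0).add (continuousOn_finsetSum _ fun k hk => ?_)
    rw [Finset.mem_range] at hk
    exact (hf.continuousOn_foldDir (B := B) (i := k) (by omega)).const_smul (L k)
  have hU := (hf.continuousOn_foldUpper (B := B) i).const_smul (x j)
  have hD := (hf.continuousOn_foldLower (B := B) i).const_smul (y j)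
  simp only [foldMesh, mesh]
  exact (hA.add hU).add hD

end Continuity

/-- The isometric image of the plane, spanned by the vectors `e` and `k` of a frame, in which the
planar state lies; the upper crease of the first vertex is mapped to `e`. -/
def Frame.planeMap (B : Frame) (a : ℝ) : Plane →ₗ[ℝ] Space :=
  (EuclideanSpace.proj (𝕜 := ℝ) (0 : Fin 2)).toLinearMap.smulRight
      (-Real.cos a • B.e - Real.sin a • B.k) +
    (EuclideanSpace.proj (𝕜 := ℝ) (1 : Fin 2)).toLinearMap.smulRight
      (Real.sin a • B.e - Real.cos a • B.k)

theorem Frame.planeMap_apply (B : Frame) (a : ℝ) (v : Plane) : B.planeMap a v =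
    v 0 • (-Real.cos a • B.e - Real.sin a • B.k) + v 1 • (Real.sin a • B.e - Real.cos a • B.k) := rfl

theorem Frame.planeMap_unitVec (B : Frame) (a φ : ℝ) : B.planeMap a (unitVec φ) =
    -Real.cos (φ + a) • B.e - Real.sin (φ + a) • B.k := by
  rw [Frame.planeMap_apply, unitVec_zero, unitVec_one, Real.cos_add, Real.sin_add]
  module

theorem Frame.IsOrtho.norm_planeMap {B : Frame} (hB : B.IsOrtho) (a : ℝ) (v : Plane) :
    ‖B.planeMap a v‖ = ‖v‖ := by
  have h1 : ‖B.planeMap a v‖ ^ 2 = ‖v‖ ^ 2 := by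
    have h2 : B.planeMap a v = B.comb (-Real.cos a * v 0 + Real.sin a * v 1) 0
        (-Real.sin a * v 0 - Real.cos a * v 1) := by
      rw [Frame.planeMap_apply, Frame.comb]; module
    rw [← real_inner_self_eq_norm_sq, h2, hB.inner_comb, EuclideanSpace.norm_sq_eq,
      Fin.sum_univ_two]
    simp only [Real.norm_eq_abs, sq_abs]
    linear_combination (v 0 ^ 2 + v 1 ^ 2) * Real.sin_sq_add_cos_sq a
  exact (sq_eq_sq₀ (norm_nonneg _) (norm_nonneg _)).1 h1

section Planar

variable {n : ℕ} {σ : SectorAngles} {ε : ℕ → ℝ} {B : Frame}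

theorem tilt_flat (α : ℝ) : tilt α 0 = Real.cos α := by simp [tilt]

theorem foldCos_flat (σ : SectorAngles) : foldCos σ 0 = 0 := by simp [foldCos]

theorem foldSin_flat (σ : SectorAngles) : foldSin σ 0 = 1 := by simp [foldSin, foldCos]

theorem sqrt_one_sub_cos_sq {α : ℝ} (hα : α ∈ Set.Ioo 0 Real.pi) :
    √(1 - Real.cos α ^ 2) = Real.sin α := by
  rw [← Real.sin_sq, Real.sqrt_sq (Real.sin_pos_of_mem_Ioo hα).le]

/-- In the planar state the frames lie in a plane and are turned as in the drawing. -/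
theorem IsFoldable.foldFrame_flat (hf : IsFoldable n σ ε) (B : Frame) {i : ℕ} (hi : i < n) :
    (foldFrame σ ε B 0 i).e = B.planeMap (σ.nw 1) (unitVec (drawnRowAngle σ (i + 1))) ∧
      (foldFrame σ ε B 0 i).k =
        Real.sin (drawnRowAngle σ (i + 1) + σ.nw 1) • B.e -
          Real.cos (drawnRowAngle σ (i + 1) + σ.nw 1) • B.k := by
  rw [Frame.planeMap_unitVec]
  induction i with
  | zero =>
    have h1 : drawnRowAngle σ (0 + 1) + σ.nw 1 = Real.pi - σ.ne 1 := by
      simp only [drawnRowAngle, zero_add]; ring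
    rw [h1, Real.cos_pi_sub, Real.sin_pi_sub]
    simp only [foldFrame, Frame.first, Frame.comb, tilt_flat,
      sqrt_one_sub_cos_sq (hf.angles.ne 1 ⟨le_rfl, hf.one_le⟩)]
    constructor <;> module
  | succ i ih =>
    obtain ⟨h1, h2⟩ := ih (by omega)
    have hi' : i + 2 ∈ Set.Icc 2 n := ⟨by omega, hi⟩
    have hq := hf.mode_pos _ hi'
    have h3 : drawnRowAngle σ (i + 1 + 1) + σ.nw 1 =
        drawnRowAngle σ (i + 1) + σ.nw 1 - (σ.nw (i + 2) - σ.sw (i + 2)) := by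
      rw [drawnRowAngle]
      linarith [(hf.flat _ hi').1]
    rw [h3]
    simp only [foldFrame, Frame.step, Frame.stepDenom, Frame.comb, foldCos_flat, foldSin_flat, h1,
      h2]
    set φ := drawnRowAngle σ (i + 1) + σ.nw 1
    rw [Real.cos_sub φ, Real.sin_sub φ]
    generalize Real.cos (σ.nw (i + 2) - σ.sw (i + 2)) = P
    generalize Real.sin (σ.nw (i + 2) - σ.sw (i + 2)) = Q
    have hq' := hq.ne'
    generalize 1 - ε (i + 2) * Real.cos (σ.nw (i + 2) + σ.sw (i + 2)) = q at hq'
    simp only [one_pow, mul_one, ne_eq, OfNat.ofNat_ne_zero, not_false_eq_true, zero_pow, mul_zero,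
      add_zero]
    constructor <;> match_scalars <;> field_simp <;> ring

theorem IsFoldable.foldDir_flat (hf : IsFoldable n σ ε) (B : Frame) {i : ℕ} (hi : i ≤ n) :
    foldDir σ ε B 0 i = B.planeMap (σ.nw 1) (unitVec (drawnRowAngle σ i)) := by
  rcases Nat.eq_zero_or_pos i with rfl | hi0
  · rw [Frame.planeMap_unitVec, foldDir, if_pos rfl, drawnRowAngle, zero_add, Frame.leftDir,
      Frame.comb, tilt_flat, sqrt_one_sub_cos_sq (hf.angles.nw 1 ⟨le_rfl, hf.one_le⟩)]
    module
  · rw [foldDir, if_neg hi0.ne', (hf.foldFrame_flat B (by omega)).1, Nat.sub_add_cancel hi0]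

/-- The state with parameter `0` is an isometric copy of the planar drawing. -/
theorem IsDatumRow.foldMesh_flat {R : Row} (hR : IsDatumRow n R)
    (hf : IsFoldable n R.angles ε) (hB : B.IsOrtho)
    (O : Space) (x y : ℕ → ℝ) {i : ℕ} (hi : i ≤ n + 1) (j : ℕ) :
    foldMesh n R.angles ε B O R.len x y 0 i j = B.planeMap (R.angles.nw 1)
      (mesh (drawnVertex R) (drawnUpper n R.angles) (drawnLower n R.angles) x y i j -
        drawnVertex R 1) + O := by
  have h1 : (1 : ℕ) ∈ Set.Icc 1 n := ⟨le_rfl, hf.one_le⟩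
  have h0 := (Real.sin_pos_of_mem_Ioo (hf.angles.nw 1 h1)).le
  have c1 : clampIdx n 1 = 1 := clampIdx_of_mem h1
  have hd : drawnRowAngle R.angles 1 = Real.pi - R.angles.ne 1 - R.angles.nw 1 := by
    simp only [drawnRowAngle, zero_add]
  have := (isRowModel_drawn hf.one_le R hR.anglesMem fun i hi => hR.developable hi).mesh_map_eq
    (hf.isRowModel hB le_rfl h0 O R.len) (B.planeMap (R.angles.nw 1)) (x := x) (y := y)
    (fun i hi => hf.foldDir_flat B hi) ?_ ?_ hi j
  · rw [pathVertex_one] at this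
    exact this
  · rw [foldUpper, drawnUpper, c1, scale_one, one_smul, one_smul, hf.foldUp_one le_rfl h0,
      Frame.planeMap_unitVec, hd,
      show Real.pi - R.angles.ne 1 - R.angles.nw 1 + R.angles.ne 1 + R.angles.nw 1 = Real.pi by ring]
    simp [Frame.comb]
  · rw [foldLower, drawnLower, c1, scale_one, one_smul, one_smul, hf.foldDown_one le_rfl h0,
      Frame.planeMap_unitVec, hd,
      show Real.pi - R.angles.ne 1 - R.angles.nw 1 - R.angles.se 1 + R.angles.nw 1 = 0 by
        linarith [hf.straight_right]]
    simp [Frame.comb]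

end Planar

theorem dihedral_eq_angle_perp {p p' z z' w v v' : Space} (hw : ‖w‖ = 1) {r s s' : ℝ} (hr : r ≠ 0)
    (hs : 0 < s) (hs' : 0 < s') (h1 : p' - p = r • w) (h2 : z - p = s • v) (h3 : z' - p = s' • v') :
    dihedral p p' z z' = InnerProductGeometry.angle (perp w v) (perp w v') := by
  rw [dihedral, h1, h2, h3, ← zero_add (s • v), ← zero_add (s' • v'), ← zero_smul ℝ w,
    orthPart_smul_add hw hr, orthPart_smul_add hw hr, perp_smul, perp_smul,
    InnerProductGeometry.angle_smul_left_of_pos _ _ hs,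
    InnerProductGeometry.angle_smul_right_of_pos _ _ hs']

theorem angle_perp_ne_zero {e u d : Space} (he : ‖e‖ = 1) (hu : ‖u‖ = 1) (hd : ‖d‖ = 1) {a b : ℝ}
    (ha : a ∈ Set.Ioo 0 Real.pi) (hb : b ∈ Set.Ioo 0 Real.pi) (h : inner ℝ e u = Real.cos a)
    (h' : inner ℝ e d = Real.cos b)
    (hlt : inner ℝ u d < Real.cos a * Real.cos b + Real.sin a * Real.sin b) :
    InnerProductGeometry.angle (perp e u) (perp e d) ≠ 0 := by
  intro h0
  have h1 := inner_eq_of_perp_angle he hu hd ha hb h h'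
  rw [h0, Real.cos_zero, mul_one] at h1
  exact hlt.ne h1

theorem angle_perp_neg (e u d : Space) : InnerProductGeometry.angle (perp e (-d)) (perp e (-u)) =
    InnerProductGeometry.angle (perp e u) (perp e d) := by
  rw [perp_neg, perp_neg, InnerProductGeometry.angle_neg_neg, InnerProductGeometry.angle_comm]

section Clash

variable {n m j₀ : ℕ} {σ : SectorAngles} {ε : ℕ → ℝ} {B : Frame} {h : ℝ} {L x y : ℕ → ℝ}
  {O : Space}

theorem IsFoldable.inner_dir_up (hf : IsFoldable n σ ε) (hB : B.IsOrtho) (h0 : 0 ≤ h)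
    (hh : h ≤ Real.sin (σ.nw 1)) {i : ℕ} (hi : i ∈ Set.Icc 1 n) :
    inner ℝ (foldDir σ ε B h i) (foldUp σ ε B h i) = Real.cos (σ.ne i) ∧
      inner ℝ (foldDir σ ε B h i) (foldDown σ ε B h i) = Real.cos (σ.se i) ∧
      inner ℝ (foldDir σ ε B h (i - 1)) (foldUp σ ε B h i) = -Real.cos (σ.nw i) ∧
      inner ℝ (foldDir σ ε B h (i - 1)) (foldDown σ ε B h i) = -Real.cos (σ.sw i) := by
  have hm := hf.isRowModel hB h0 hh 0 0
  obtain ⟨k, rfl⟩ : ∃ k, i = k + 1 := ⟨i - 1, by have := hi.1; omega⟩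
  have hk : k < n := hi.2
  have s1 := (hf.angles.scale_upper_pos hi.2).ne'
  have s2 := (hf.angles.scale_lower_pos hi.2).ne'
  have e1 := hm.upper.inner_eq _ hi.2
  have e2 := hm.lower.inner_eq _ hi.2
  have e3 := hm.upper.inner_left hm.unit hf.angles.nw hk
  have e4 := hm.lower.inner_left hm.unit hf.angles.sw hk
  simp only [foldUpper, foldLower, clampIdx_of_mem hi, real_inner_smul_right, startAngle,
    Nat.succ_ne_zero, if_false, ← mul_neg] at e1 e2 e3 e4
  exact ⟨mul_left_cancel₀ s1 e1, mul_left_cancel₀ s2 e2, mul_left_cancel₀ s1 e3,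
    mul_left_cancel₀ s2 e4⟩

/-- No two panels clash before the left row crease of the straight-line vertex is closed. -/
theorem IsFoldable.not_clash (hf : IsFoldable n σ ε) (hB : B.IsOrtho) (h0 : 0 ≤ h)
    (hh : h < Real.sin (σ.nw 1)) (hxy : IsStaircase j₀ x y)
    (hrung : ∀ i ≤ n, ∀ j ≤ m + 1, 0 < rung n σ L x y i j) :
    ¬ Clash n m (foldMesh n σ ε B O L x y h) := by
  have hm := hf.isRowModel hB h0 hh.le O L
  rintro (⟨i, hi, j, hj, h1⟩ | ⟨i, hi, j, hj, h1⟩)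
  · obtain ⟨r, r', hr, hr', e1, e2⟩ := hxy.mesh_creases (pathVertex O L (foldDir σ ε B h))
      (foldUpper n σ ε B h) (foldLower n σ ε B h) i hj.1
    have hc := clampIdx_mem hf.one_le i
    have s1 := hf.angles.scale_upper_pos hc.2
    have s2 := hf.angles.scale_lower_pos hc.2
    have key : InnerProductGeometry.angle (perp (foldDir σ ε B h i) (foldUp σ ε B h (clampIdx n i)))
        (perp (foldDir σ ε B h i) (foldDown σ ε B h (clampIdx n i))) ≠ 0 := by
      rcases Nat.eq_zero_or_pos i with rfl | hi0
      · have hi1 : (1 : ℕ) ∈ Set.Icc 1 n := ⟨le_rfl, hf.one_le⟩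
        obtain ⟨-, -, k1, k2⟩ := hf.inner_dir_up hB h0 hh.le hi1
        have a1 := hf.angles.nw 1 hi1
        have a2 := hf.angles.sw 1 hi1
        rw [clampIdx_zero]
        refine angle_perp_ne_zero (hm.unit 0 hi) (hf.norm_foldUp hB h0 hh.le hi1)
          (hf.norm_foldDown hB h0 hh.le hi1) (a := Real.pi - σ.nw 1) (b := Real.pi - σ.sw 1)
          ⟨by linarith [a1.2], by linarith [a1.1]⟩ ⟨by linarith [a2.2], by linarith [a2.1]⟩
          (by rw [Real.cos_pi_sub]; exact k1) (by rw [Real.cos_pi_sub]; exact k2) ?_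
        rw [hf.inner_up_down_first hB h0 hh.le, show σ.sw 1 = Real.pi - σ.nw 1 by
          linarith [hf.straight_left]]
        simp only [sub_sub_cancel, Real.cos_pi_sub, Real.sin_pi_sub]
        nlinarith [Real.sin_sq_add_cos_sq (σ.nw 1)]
      · have hi1 : i ∈ Set.Icc 1 n := ⟨hi0, hi⟩
        obtain ⟨k1, k2, -, -⟩ := hf.inner_dir_up hB h0 hh.le hi1
        have a1 := hf.angles.ne i hi1
        have a2 := hf.angles.se i hi1
        rw [clampIdx_of_mem hi1]
        refine angle_perp_ne_zero (hm.unit i hi) (hf.norm_foldUp hB h0 hh.le hi1)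
          (hf.norm_foldDown hB h0 hh.le hi1) a1 a2 k1 k2 ?_
        rw [hf.inner_up_down hB h0 hh.le hi1]
        have h2 := mul_pos (Real.sin_pos_of_mem_Ioo a1) (Real.sin_pos_of_mem_Ioo a2)
        have h3 : foldCos σ h ^ 2 - foldSin σ h ^ 2 < 1 := by
          have := hf.fold_sq h0 hh.le
          nlinarith [hf.foldSin_pos h0 hh.le]
        nlinarith
    by_cases hjj : Even (j + j₀)
    · rw [if_pos hjj] at e1 e2
      rw [foldUpper, smul_smul] at e1
      rw [foldLower, smul_smul] at e2
      refine key ?_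
      rw [← h1]
      exact (dihedral_eq_angle_perp (hm.unit i hi) (hrung i hi j (hj.2.trans (Nat.le_succ m))).ne'
        (mul_pos hr s1) (mul_pos hr' s2) (hm.mesh_sub_right hi j) e1 e2).symm
    · rw [if_neg hjj] at e1 e2
      rw [foldLower, ← smul_neg, smul_smul] at e1
      rw [foldUpper, ← smul_neg, smul_smul] at e2
      refine key ?_
      rw [← h1, ← angle_perp_neg]
      exact (dihedral_eq_angle_perp (hm.unit i hi) (hrung i hi j (hj.2.trans (Nat.le_succ m))).ne'
        (mul_pos hr s2) (mul_pos hr' s1) (hm.mesh_sub_right hi j) e1 e2).symm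
  · have hi1 : 1 ≤ i := hi.1
    have hi2 : i ≤ n := hi.2
    obtain ⟨k1, k2, k3, k4⟩ := hf.inner_dir_up hB h0 hh.le hi
    have hgt := hf.inner_dir_gt hB h0 hh.le (i := i - 1) (by omega)
    rw [Nat.sub_add_cancel hi1, real_inner_comm] at hgt
    have hn1 : ‖-foldDir σ ε B h (i - 1)‖ = 1 := by rw [norm_neg]; exact hm.unit _ (by omega)
    have e1 := hm.mesh_sub_right (x := x) (y := y) hi2 j
    have e2 := hm.mesh_sub_left (x := x) (y := y) hi j
    have p1 := hrung i hi2 j (hj.trans (Nat.le_succ m))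
    have p2 := hrung (i - 1) (by omega) j (hj.trans (Nat.le_succ m))
    have e3 := mesh_sub_up (pathVertex O L (foldDir σ ε B h)) (foldUpper n σ ε B h)
      (foldLower n σ ε B h) x y i j
    by_cases hjj : Even (j + j₀)
    · rw [rail_even hxy _ _ _ hjj, foldUpper, clampIdx_of_mem hi, smul_smul] at e3
      refine angle_perp_ne_zero (hf.norm_foldUp hB h0 hh.le hi) (hm.unit i hi2) hn1
        (hf.angles.ne i hi) (hf.angles.nw i hi) (by rw [real_inner_comm, k1])
        (by rw [inner_neg_right, real_inner_comm, k3, neg_neg]) ?_ ?_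
      · rw [← Real.cos_sub, inner_neg_right]
        linarith [hgt.1]
      · rw [← h1]
        exact (dihedral_eq_angle_perp (hf.norm_foldUp hB h0 hh.le hi)
          (mul_pos (sub_pos.2 (hxy.even_step j hjj).1) (hf.angles.scale_upper_pos hi2)).ne'
          p1 p2 e3 e1 e2).symm
    · rw [rail_odd hxy _ _ _ hjj, foldLower, clampIdx_of_mem hi, smul_smul] at e3
      refine angle_perp_ne_zero (hf.norm_foldDown hB h0 hh.le hi) (hm.unit i hi2) hn1
        (hf.angles.se i hi) (hf.angles.sw i hi) (by rw [real_inner_comm, k2])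
        (by rw [inner_neg_right, real_inner_comm, k4, neg_neg]) ?_ ?_
      · rw [← Real.cos_sub, inner_neg_right]
        linarith [hgt.2]
      · rw [← h1]
        exact (dihedral_eq_angle_perp (hf.norm_foldDown hB h0 hh.le hi)
          (mul_neg_of_neg_of_pos (sub_neg.2 (hxy.odd_step j hjj).2)
            (hf.angles.scale_lower_pos hi2)).ne
          p1 p2 e3 e1 e2).symm

/-- In the final state the two leftmost panels next to the datum row clash. -/
theorem IsDatumRow.clash {R : Row} (hR : IsDatumRow n R) (hn : 1 ≤ n) (hxy : IsStaircase j₀ x y)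
    (hj : j₀ ∈ Set.Icc 1 m) : Clash n m (mesh R.A (R.upper n) (R.lower n) x y) := by
  refine Or.inl ⟨0, Nat.zero_le n, j₀, hj, ?_⟩
  obtain ⟨r, r', hr, hr', e1, e2⟩ := hxy.mesh_creases R.A (R.upper n) (R.lower n) 0 hj.1
  rw [if_pos (Even.add_self j₀), Row.upper, clampIdx_zero, scale_one, one_smul] at e1
  rw [if_pos (Even.add_self j₀), Row.lower, clampIdx_zero, scale_one, one_smul] at e2
  have h0 := hR.norm_dir hn (Nat.zero_le n)
  have hp := hR.len_pos hn (Nat.zero_le n)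
  have e3 := (hR.isRowModel hn).mesh_sub_right (x := x) (y := y) (Nat.zero_le n) j₀
  rw [rung_zero] at e3
  have hl := hR.left_clash
  have he : R.A 1 - R.A 0 = R.len 0 • R.dir 0 := hR.edge_eq hn (Nat.zero_le n)
  rw [dihedral, add_sub_right_comm, add_sub_right_comm, he, orthPart_smul_add h0 hp.ne',
    orthPart_smul_add h0 hp.ne'] at hl
  rw [← hl]
  exact dihedral_eq_angle_perp h0 hp.ne' hr hr' e3 e1 e2

end Clash

/-! ### Folded states near the motion -/

theorem inner_sub_sub_eq {V W : Type*} [NormedAddCommGroup V] [InnerProductSpace ℝ V]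
    [NormedAddCommGroup W] [InnerProductSpace ℝ W] {a b c : V} {a' b' c' : W}
    (h1 : dist b a = dist b' a') (h2 : dist c a = dist c' a') (h3 : dist b c = dist b' c') :
    inner ℝ (b - a) (c - a) = inner ℝ (b' - a') (c' - a') := by
  rw [dist_eq_norm, dist_eq_norm] at h1 h2 h3
  have e1 := norm_sub_sq_real (b - a) (c - a)
  have e2 := norm_sub_sq_real (b' - a') (c' - a')
  rw [sub_sub_sub_cancel_right] at e1 e2
  rw [h1, h2, h3] at e1
  linarith

section Panels

variable {n m j₀ : ℕ} {σ : SectorAngles} {L x y : ℕ → ℝ} {A E U D : ℕ → Plane}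
  {p : ℕ → ℕ → Space}

theorem IsFoldedState.inner_sub_sub {P : ℕ → ℕ → Plane} (hp : IsFoldedState n m P p) {i j : ℕ}
    (hi : i ≤ n) (hj : j ≤ m) {k l r : ℕ × ℕ} (hk : k ∈ corners i j) (hl : l ∈ corners i j)
    (hr : r ∈ corners i j) :
    inner ℝ (p l.1 l.2 - p k.1 k.2) (p r.1 r.2 - p k.1 k.2) =
      inner ℝ (P l.1 l.2 - P k.1 k.2) (P r.1 r.2 - P k.1 k.2) :=
  inner_sub_sub_eq (hp i hi j hj l hl k hk) (hp i hi j hj r hr k hk) (hp i hi j hj l hl r hr)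

/-- The two row creases bounding a panel remain parallel when the panel is moved rigidly. -/
theorem IsFoldedState.parallel (hp : IsFoldedState n m (mesh A U D x y) p)
    (hm : IsRowModel n σ L A E U D) {i j : ℕ} (hi : i ≤ n) (hj : j ≤ m) :
    rung n σ L x y i j • (p (i + 1) (j + 1) - p i (j + 1)) =
      rung n σ L x y i (j + 1) • (p (i + 1) j - p i j) := by
  have c0 : (i, j) ∈ corners i j := by simp [corners]
  have c1 : (i + 1, j) ∈ corners i j := by simp [corners]
  have c2 : (i + 1, j + 1) ∈ corners i j := by simp [corners]
  have c3 : (i, j + 1) ∈ corners i j := by simp [corners]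
  have g := fun {l r} (hl : l ∈ corners i j) (hr : r ∈ corners i j) =>
    hp.inner_sub_sub hi hj c0 hl hr
  have g11 := g c1 c1
  have g12 := g c1 c2
  have g13 := g c1 c3
  have g21 := g c2 c1
  have g22 := g c2 c2
  have g23 := g c2 c3
  have g31 := g c3 c1
  have g32 := g c3 c2
  have g33 := g c3 c3
  dsimp only at g11 g12 g13 g21 g22 g23 g31 g32 g33
  have hP : rung n σ L x y i j • (mesh A U D x y (i + 1) (j + 1) - mesh A U D x y i j) -
      rung n σ L x y i j • (mesh A U D x y i (j + 1) - mesh A U D x y i j) -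
      rung n σ L x y i (j + 1) • (mesh A U D x y (i + 1) j - mesh A U D x y i j) = 0 := by
    rw [← smul_sub, sub_sub_sub_cancel_right, hm.mesh_sub_right hi, hm.mesh_sub_right hi, smul_smul,
      smul_smul, mul_comm, sub_self]
  have h1 : rung n σ L x y i j • (p (i + 1) (j + 1) - p i j) -
      rung n σ L x y i j • (p i (j + 1) - p i j) -
      rung n σ L x y i (j + 1) • (p (i + 1) j - p i j) = 0 := by
    rw [← inner_self_eq_zero (𝕜 := ℝ)] at hP ⊢
    simp only [inner_sub_left (_ • _), inner_sub_left (_ - _), inner_sub_right _ (_ • _),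
      inner_sub_right _ (_ - _) (_ • _), real_inner_smul_left, real_inner_smul_right] at hP ⊢
    rw [g11, g12, g13, g21, g22, g23, g31, g32, g33]
    exact hP
  rw [← smul_sub, sub_sub_sub_cancel_right] at h1
  exact sub_eq_zero.1 h1

/-- The direction of the row crease `i` of a folded state, measured on the lowest row. -/
def stateDir (n : ℕ) (σ : SectorAngles) (L x y : ℕ → ℝ) (p : ℕ → ℕ → Space) (i : ℕ) : Space :=
  (rung n σ L x y i 0)⁻¹ • (p (i + 1) 0 - p i 0)

/-- The scaled upper, or lower, creases of a folded state, from the one of column `1`. -/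
def stateCrease (n : ℕ) (al be : ℕ → ℝ) (e : ℕ → Space) (u : Space) (i : ℕ) : Space :=
  u - ∑ k ∈ Finset.range i, shear n al be k • e k

theorem stateCrease_succ (n : ℕ) (al be : ℕ → ℝ) (e : ℕ → Space) (u : Space) (i : ℕ) :
    stateCrease n al be e u (i + 1) = stateCrease n al be e u i - shear n al be i • e i := by
  simp only [stateCrease, Finset.sum_range_succ]; abel

theorem stateCrease_one (n : ℕ) (al be : ℕ → ℝ) (e : ℕ → Space) (u : Space) :
    stateCrease n al be e u 1 = u := by
  simp [stateCrease, shear_zero]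

theorem IsFoldedState.sub_right (hp : IsFoldedState n m (mesh A U D x y) p)
    (hm : IsRowModel n σ L A E U D) (hrung : ∀ i ≤ n, ∀ j ≤ m + 1, 0 < rung n σ L x y i j)
    {i j : ℕ} (hi : i ≤ n) (hj : j ≤ m + 1) :
    p (i + 1) j - p i j = rung n σ L x y i j • stateDir n σ L x y p i := by
  induction j with
  | zero => rw [stateDir, smul_inv_smul₀ (hrung i hi 0 (by omega)).ne']
  | succ j ih =>
    have h1 := hp.parallel hm hi (j := j) (by omega)
    have h2 := hrung i hi j (by omega)
    rw [ih (by omega), smul_comm] at h1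
    exact smul_right_injective _ h2.ne' h1

theorem IsFoldedState.norm_stateDir (hp : IsFoldedState n m (mesh A U D x y) p)
    (hm : IsRowModel n σ L A E U D) (hrung : ∀ i ≤ n, ∀ j ≤ m + 1, 0 < rung n σ L x y i j)
    {i : ℕ} (hi : i ≤ n) : ‖stateDir n σ L x y p i‖ = 1 := by
  have h1 := hp i hi 0 (Nat.zero_le m) (i + 1, 0) (by simp [corners]) (i, 0) (by simp [corners])
  have h2 := hrung i hi 0 (by omega)
  dsimp only at h1
  rw [dist_eq_norm, dist_eq_norm, hm.mesh_sub_right hi, norm_smul, hm.unit i hi, mul_one,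
    Real.norm_of_nonneg h2.le] at h1
  rw [stateDir, norm_smul, h1, norm_inv, Real.norm_of_nonneg h2.le, inv_mul_cancel₀ h2.ne']

theorem IsFoldedState.inner_stateDir (hp : IsFoldedState n m (mesh A U D x y) p)
    (hm : IsRowModel n σ L A E U D) (hrung : ∀ i ≤ n, ∀ j ≤ m + 1, 0 < rung n σ L x y i j)
    {i j : ℕ} (hi : i ≤ n) (hj : j ≤ m) :
    inner ℝ (stateDir n σ L x y p i) (p i (j + 1) - p i j) = inner ℝ (E i) (rail U D x y i j) ∧
      inner ℝ (stateDir n σ L x y p i) (p (i + 1) (j + 1) - p (i + 1) j) =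
        inner ℝ (E i) (rail U D x y (i + 1) j) ∧
      ‖p i (j + 1) - p i j‖ = ‖rail U D x y i j‖ ∧
      ‖p (i + 1) (j + 1) - p (i + 1) j‖ = ‖rail U D x y (i + 1) j‖ := by
  have c0 : (i, j) ∈ corners i j := by simp [corners]
  have c1 : (i + 1, j) ∈ corners i j := by simp [corners]
  have c2 : (i + 1, j + 1) ∈ corners i j := by simp [corners]
  have c3 : (i, j + 1) ∈ corners i j := by simp [corners]
  have hr := (hrung i hi j (by omega)).ne'
  have g1 := hp.inner_sub_sub hi hj c0 c1 c3
  have g2 := hp.inner_sub_sub hi hj c1 c0 c2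
  have g3 := hp i hi j hj _ c3 _ c0
  have g4 := hp i hi j hj _ c2 _ c1
  dsimp only at g1 g2 g3 g4
  rw [dist_eq_norm, dist_eq_norm, mesh_sub_up] at g3 g4
  refine ⟨?_, ?_, g3, g4⟩
  · rw [hp.sub_right hm hrung hi (by omega), hm.mesh_sub_right hi, mesh_sub_up,
      real_inner_smul_left, real_inner_smul_left] at g1
    exact mul_left_cancel₀ hr g1
  · rw [← neg_sub, ← neg_sub (mesh A U D x y (i + 1) j), hp.sub_right hm hrung hi (by omega),
      hm.mesh_sub_right hi, mesh_sub_up, inner_neg_left, inner_neg_left, real_inner_smul_left,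
      real_inner_smul_left, neg_inj] at g2
    exact mul_left_cancel₀ hr g2

/-- The edges of the first column that start in rows of equal parity lie on the same side of the plane of
the first two row creases. -/
def SidesAgree (m j₀ : ℕ) (p : ℕ → ℕ → Space) : Prop :=
  ∀ j ≤ m, ∀ k ≤ m, (Even (j + j₀) ↔ Even (k + j₀)) →
    0 < triple (p 1 0 - p 0 0) (p 2 0 - p 1 0) (p 1 (j + 1) - p 1 j) *
      triple (p 1 0 - p 0 0) (p 2 0 - p 1 0) (p 1 (k + 1) - p 1 k)

/-- A vector is determined by its inner products with the directions of the first two row creases and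
the side of their plane on which it lies. -/
theorem IsFoldedState.edge_eq (hp : IsFoldedState n m (mesh A U D x y) p)
    (hm : IsRowModel n σ L A E U D) (hrung : ∀ i ≤ n, ∀ j ≤ m + 1, 0 < rung n σ L x y i j)
    (hn : 1 ≤ n) (hs : SidesAgree m j₀ p) {j k : ℕ} (hj : j ≤ m) (hk : k ≤ m)
    (hjk : Even (j + j₀) ↔ Even (k + j₀)) {r : ℝ} (hr : 0 < r)
    (hrail : rail U D x y 1 j = r • rail U D x y 1 k) :
    p 1 (j + 1) - p 1 j = r • (p 1 (k + 1) - p 1 k) := by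
  have r0 := hrung 0 (Nat.zero_le n) 0 (Nat.zero_le _)
  have r1 := hrung 1 hn 0 (Nat.zero_le _)
  have hj0 := hp.inner_stateDir hm hrung (Nat.zero_le n) hj
  have hk0 := hp.inner_stateDir hm hrung (Nat.zero_le n) hk
  have hj1 := hp.inner_stateDir hm hrung hn hj
  have hk1 := hp.inner_stateDir hm hrung hn hk
  have h1 := hs j hj k hk hjk
  rw [hp.sub_right hm hrung (Nat.zero_le n) (Nat.zero_le _), hp.sub_right hm hrung hn
    (Nat.zero_le _)] at h1
  simp only [triple_smul_left, triple_smul_mid, zero_add] at h1 hj0 hk0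
  refine eq_of_inner_eq (a := stateDir n σ L x y p 0) (b := stateDir n σ L x y p 1) ?_ ?_ ?_ ?_
  · rw [norm_smul, hj1.2.2.1, hk1.2.2.1, hrail, norm_smul]
  · rw [real_inner_smul_right, hj0.2.1, hk0.2.1, hrail, real_inner_smul_right]
  · rw [real_inner_smul_right, hj1.1, hk1.1, hrail, real_inner_smul_right]
  · rw [triple_smul_right]
    set X := triple (stateDir n σ L x y p 0) (stateDir n σ L x y p 1) (p 1 (j + 1) - p 1 j)
    set Y := triple (stateDir n σ L x y p 0) (stateDir n σ L x y p 1) (p 1 (k + 1) - p 1 k)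
    have h2 : 0 < X * Y := pos_of_mul_pos_right (h1.trans_eq (b := _)
      (c := (rung n σ L x y 0 0 * rung n σ L x y 1 0) ^ 2 * (X * Y)) (by ring)) (sq_nonneg _)
    exact (mul_pos hr h2).trans_eq (by ring)

/-- A folded state that lies on the right side at the first column is the mesh generated by a row. -/
theorem IsFoldedState.exists_rowModel (hp : IsFoldedState n m (mesh A U D x y) p)
    (hm : IsRowModel n σ L A E U D) (hrung : ∀ i ≤ n, ∀ j ≤ m + 1, 0 < rung n σ L x y i j)
    (hn : 1 ≤ n) (hs : SidesAgree m j₀ p) (hxy : IsStaircase j₀ x y) (hj : j₀ ∈ Set.Icc 1 m) :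
    ∃ A' e' U' D' : ℕ → Space, IsRowModel n σ L A' e' U' D' ∧
      ∀ i ≤ n + 1, ∀ j ≤ m + 1, p i j = mesh A' U' D' x y i j := by
  obtain ⟨jd, rfl⟩ : ∃ jd, j₀ = jd + 1 := ⟨j₀ - 1, by have := hj.1; omega⟩
  have hj2 := hj.2
  have ev : Even (jd + 1 + (jd + 1)) := ⟨_, rfl⟩
  have od : ¬ Even (jd + (jd + 1)) := by
    rw [← add_assoc, Nat.not_even_iff_odd]; exact ⟨jd, by ring⟩
  have hx0 : 0 < x (jd + 1 + 1) := by
    have := (hxy.even_step (jd + 1) ev).1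
    rwa [hxy.x_zero] at this
  have hy0 : 0 < y jd := by
    have := (hxy.odd_step jd od).2
    rwa [hxy.y_zero] at this
  have hx1 := (hxy.odd_step jd od).1
  have hy1 := (hxy.even_step (jd + 1) ev).2
  rw [hxy.x_zero] at hx1
  rw [hxy.y_zero] at hy1
  set e := stateDir n σ L x y p with he
  set u : Space := (x (jd + 1 + 1))⁻¹ • (p 1 (jd + 1 + 1) - p 1 (jd + 1)) with hu
  set d : Space := (y jd)⁻¹ • (p 1 jd - p 1 (jd + 1)) with hd
  -- all edges of the first column have one of two directions
  have hcol : ∀ j ≤ m, p 1 (j + 1) - p 1 j = (x (j + 1) - x j) • u + (y (j + 1) - y j) • d := by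
    intro j hjm
    by_cases hjj : Even (j + (jd + 1))
    · have h1 := hxy.even_step j hjj
      have h2 := hp.edge_eq hm hrung hn hs hjm hj2 (by simp [hjj, ev])
        (r := (x (j + 1) - x j) * (x (jd + 1 + 1))⁻¹)
        (mul_pos (sub_pos.2 h1.1) (inv_pos.2 hx0)) (by
          rw [rail_even hxy _ _ _ hjj, rail_even hxy _ _ _ ev, hxy.x_zero, sub_zero, smul_smul,
            inv_mul_cancel_right₀ hx0.ne'])
      rw [h2, h1.2, sub_self, zero_smul, add_zero, hu, smul_smul]
    · have h1 := hxy.odd_step j hjj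
      have h2 := hp.edge_eq hm hrung hn hs hjm (by omega : jd ≤ m) (by simp [hjj, od])
        (r := (y j - y (j + 1)) * (y jd)⁻¹)
        (mul_pos (sub_pos.2 h1.2) (inv_pos.2 hy0)) (by
          rw [rail_odd hxy _ _ _ hjj, rail_odd hxy _ _ _ od, hxy.y_zero, zero_sub, smul_smul,
            mul_neg, inv_mul_cancel_right₀ hy0.ne', neg_sub])
      rw [h2, h1.1, sub_self, zero_smul, zero_add, hd, smul_smul, ← neg_sub (p 1 (jd + 1)) (p 1 jd)]
      module
  have hcol' : ∀ j ≤ m + 1, p 1 j = p 1 (jd + 1) + x j • u + y j • d := by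
    have h1 : ∀ j ≤ m + 1, p 1 j - x j • u - y j • d = p 1 0 - x 0 • u - y 0 • d := by
      intro j hjm
      induction j with
      | zero => rfl
      | succ j ih =>
        rw [← ih (by omega), ← sub_eq_zero]
        have h2 := sub_eq_zero.2 (hcol j (by omega))
        rw [← h2]
        module
    intro j hjm
    have h2 := (h1 j hjm).trans (h1 (jd + 1) (by omega)).symm
    rw [hxy.x_zero, hxy.y_zero, zero_smul, zero_smul, sub_zero, sub_zero] at h2
    rw [← h2]
    abel
  have hmesh : ∀ i ≤ n + 1, ∀ j ≤ m + 1, p i j = mesh (fun i => p i (jd + 1))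
      (stateCrease n σ.ne σ.nw e u) (stateCrease n σ.se σ.sw e d) x y i j := by
    intro i hi j hjm
    have hsub : ∀ i ≤ n, ∀ j ≤ m + 1, p (i + 1) j = p i j + rung n σ L x y i j • e i := by
      intro i hi j hjm
      rw [← hp.sub_right hm hrung hi hjm]; abel
    rcases Nat.eq_zero_or_pos i with rfl | hi1
    · have h1 := hsub 0 (Nat.zero_le n) j hjm
      have h2 := hsub 0 (Nat.zero_le n) (jd + 1) (by omega)
      rw [rung_zero, zero_add] at h1 h2
      have h3 := hcol' j hjm
      rw [h1, h2] at h3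
      simp only [mesh, stateCrease, Finset.range_zero, Finset.sum_empty, sub_zero]
      exact add_right_cancel (h3.trans (by abel))
    · induction i, hi1 using Nat.le_induction with
      | base => simp only [mesh, stateCrease_one]; exact hcol' j hjm
      | succ i hi1 ih =>
        rw [hsub i (by omega) j hjm, ih (by omega)]
        simp only [mesh, stateCrease_succ, hsub i (by omega) (jd + 1) (by omega), hxy.rung_base]
        simp only [rung]
        module
  refine ⟨fun i => p i (jd + 1), e, stateCrease n σ.ne σ.nw e u, stateCrease n σ.se σ.sw e d,
    ⟨?_, ?_, ⟨fun i _ => stateCrease_succ .., ?_, ?_⟩, ⟨fun i _ => stateCrease_succ .., ?_, ?_⟩⟩,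
    hmesh⟩
  · intro i hi
    have := hp.sub_right hm hrung hi (j := jd + 1) (by omega)
    rw [hxy.rung_base] at this
    rw [← this]; abel
  · exact fun i hi => hp.norm_stateDir hm hrung hi
  all_goals
    intro i hi
  · have h1 := (hp.inner_stateDir hm hrung hi hj2).2.2.1
    rw [hmesh i (by omega) _ (by omega), hmesh i (by omega) _ (by omega), mesh_sub_up,
      rail_even hxy _ _ _ ev, rail_even hxy _ _ _ ev, norm_smul, norm_smul, hxy.x_zero, sub_zero,
      Real.norm_of_nonneg hx0.le, hm.upper.norm_eq i hi] at h1
    exact mul_left_cancel₀ hx0.ne' h1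
  · have h1 := (hp.inner_stateDir hm hrung hi hj2).1
    rw [hmesh i (by omega) _ (by omega), hmesh i (by omega) _ (by omega), mesh_sub_up,
      rail_even hxy _ _ _ ev, rail_even hxy _ _ _ ev, real_inner_smul_right, real_inner_smul_right,
      hxy.x_zero, sub_zero, hm.upper.inner_eq i hi] at h1
    exact mul_left_cancel₀ hx0.ne' h1
  · have h1 := (hp.inner_stateDir hm hrung hi (j := jd) (by omega)).2.2.1
    rw [hmesh i (by omega) _ (by omega), hmesh i (by omega) _ (by omega), mesh_sub_up,
      rail_odd hxy _ _ _ od, rail_odd hxy _ _ _ od, norm_smul, norm_smul, hxy.y_zero, zero_sub,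
      norm_neg, Real.norm_of_nonneg hy0.le, hm.lower.norm_eq i hi] at h1
    exact mul_left_cancel₀ hy0.ne' h1
  · have h1 := (hp.inner_stateDir hm hrung hi (j := jd) (by omega)).1
    rw [hmesh i (by omega) _ (by omega), hmesh i (by omega) _ (by omega), mesh_sub_up,
      rail_odd hxy _ _ _ od, rail_odd hxy _ _ _ od, real_inner_smul_right, real_inner_smul_right,
      hxy.y_zero, zero_sub, hm.lower.inner_eq i hi] at h1
    exact mul_left_cancel₀ (neg_ne_zero.2 hy0.ne') h1

end Panels

open Filter Topology

/-! ### One degree of freedom -/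

theorem IsStaircase.base_creases {V : Type*} [NormedAddCommGroup V] [InnerProductSpace ℝ V]
    {j₀ : ℕ} {x y : ℕ → ℝ} (h : IsStaircase j₀ x y) (A U D : ℕ → V) (i : ℕ) (hj : 1 ≤ j₀) :
    mesh A U D x y i (j₀ + 1) - mesh A U D x y i j₀ = x (j₀ + 1) • U i ∧
      mesh A U D x y i (j₀ - 1) - mesh A U D x y i j₀ = y (j₀ - 1) • D i ∧
      0 < x (j₀ + 1) ∧ 0 < y (j₀ - 1) := by
  obtain ⟨k, rfl⟩ : ∃ k, j₀ = k + 1 := ⟨j₀ - 1, by omega⟩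
  have h1 := h.even_step (k + 1) ⟨_, rfl⟩
  have h2 := h.odd_step k (by rw [← add_assoc, Nat.not_even_iff_odd]; exact ⟨k, by ring⟩)
  rw [h.x_zero, h.y_zero] at h1 h2
  refine ⟨?_, ?_, h1.1, h2.2⟩
  · simp only [mesh, h1.2, h.x_zero, h.y_zero]; module
  · simp only [mesh, Nat.add_sub_cancel, ← h2.1, h.x_zero, h.y_zero]; module

section Near

variable {n m j₀ : ℕ} {σ : SectorAngles} {ε : ℕ → ℝ} {L x y : ℕ → ℝ}

/-- Finitely many strict inequalities between the vertices of a folded state, satisfied by the states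
of the motion before its end, that make it congruent to one of them. The number `κ` is the product
of the lengths of the two creases of the datum row in the first column. -/
structure IsNear (n m j₀ : ℕ) (σ : SectorAngles) (ε : ℕ → ℝ) (κ : ℝ) (p : ℕ → ℕ → Space) :
    Prop where
  sides : SidesAgree m j₀ p
  first : 0 < triple (p 1 (j₀ + 1) - p 1 j₀) (p 1 (j₀ - 1) - p 1 j₀) (p 1 j₀ - p 0 j₀) *
    triple (p 1 (j₀ + 1) - p 1 j₀) (p 1 (j₀ - 1) - p 1 j₀) (p 2 j₀ - p 1 j₀)
  mode : ∀ i ∈ Set.Icc 2 n, 0 < ε i *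
    (triple (p i (j₀ + 1) - p i j₀) (p i (j₀ - 1) - p i j₀) (p i j₀ - p (i - 1) j₀) *
      triple (p i (j₀ + 1) - p i j₀) (p i (j₀ - 1) - p i j₀) (p (i + 1) j₀ - p i j₀))
  lower : -κ < inner ℝ (p 1 (j₀ + 1) - p 1 j₀) (p 1 (j₀ - 1) - p 1 j₀)
  upper : inner ℝ (p 1 (j₀ + 1) - p 1 j₀) (p 1 (j₀ - 1) - p 1 j₀) <
    κ * (2 * Real.sin (σ.nw 1) ^ 2 - 1)

theorem pos_of_pos_mul {a b : ℝ} (hb : 0 < b) (h : 0 < b * a) : 0 < a :=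
  pos_of_mul_pos_right h hb.le

theorem IsNear.exists_foldMesh {A E U D : ℕ → Plane} {p : ℕ → ℕ → Space}
    (hf : IsFoldable n σ ε) (hp : IsFoldedState n m (mesh A U D x y) p)
    (hm : IsRowModel n σ L A E U D) (hrung : ∀ i ≤ n, ∀ j ≤ m + 1, 0 < rung n σ L x y i j)
    (hxy : IsStaircase j₀ x y) (hj : j₀ ∈ Set.Icc 1 m)
    (hN : IsNear n m j₀ σ ε (x (j₀ + 1) * y (j₀ - 1)) p) :
    ∃ h ∈ Set.Ioo 0 (Real.sin (σ.nw 1)), ∃ B : Frame, B.IsOrtho ∧ ∃ O : Space,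
      ∀ i ≤ n + 1, ∀ j ≤ m + 1, p i j = foldMesh n σ ε B O L x y h i j := by
  have hj1 := hj.1
  have hj2 := hj.2
  have hn := hf.one_le
  obtain ⟨A', e, U', D', hm', hmesh⟩ := hp.exists_rowModel hm hrung hn hN.sides hxy hj
  have hL : ∀ i ≤ n, 0 < L i := fun i hi => by
    have := hrung i hi j₀ (by omega)
    rwa [hxy.rung_base] at this
  have hb := fun i => hxy.base_creases A' U' D' i hj1
  obtain ⟨-, -, hx0, hy0⟩ := hb 0
  have e1 : ∀ i ≤ n + 1, p i (j₀ + 1) - p i j₀ = x (j₀ + 1) • U' i := fun i hi => by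
    rw [hmesh i hi _ (by omega), hmesh i hi _ (by omega), (hb i).1]
  have e2 : ∀ i ≤ n + 1, p i (j₀ - 1) - p i j₀ = y (j₀ - 1) • D' i := fun i hi => by
    rw [hmesh i hi _ (by omega), hmesh i hi _ (by omega), (hb i).2.1]
  have e3 : ∀ i ≤ n, p (i + 1) j₀ - p i j₀ = L i • e i := fun i hi => by
    rw [hmesh _ (by omega) _ (by omega), hmesh i (by omega) _ (by omega), hm'.mesh_sub_right hi,
      hxy.rung_base]
  have s2 := Real.sin_pos_of_mem_Ioo (hf.angles.nw 1 ⟨le_rfl, hn⟩)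
  have hk := mul_pos hx0 hy0
  have h1 := hN.first
  have h2 := hN.lower
  have h3 := hN.upper
  rw [e1 1 (by omega), e2 1 (by omega), real_inner_smul_left, real_inner_smul_right,
    ← mul_assoc] at h2 h3
  have h2' : -1 < inner ℝ (U' 1) (D' 1) := lt_of_mul_lt_mul_left (by linarith) hk.le
  have h3' := lt_of_mul_lt_mul_left h3 hk.le
  rw [e1 1 (by omega), e2 1 (by omega), e3 0 (Nat.zero_le n), e3 1 hn] at h1
  simp only [triple_smul_left, triple_smul_mid, triple_smul_right] at h1
  set h := √((1 + inner ℝ (U' 1) (D' 1)) / 2) with hh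
  have hpos : 0 < h := Real.sqrt_pos.2 (by linarith)
  have hsq : h ^ 2 = (1 + inner ℝ (U' 1) (D' 1)) / 2 := Real.sq_sqrt (by linarith)
  have hlt : h < Real.sin (σ.nw 1) := lt_of_pow_lt_pow_left₀ 2 s2.le (by linarith)
  have hT : 0 < triple (U' 1) (D' 1) (e 0) * triple (U' 1) (D' 1) (e 1) :=
    pos_of_pos_mul (b := x (j₀ + 1) ^ 2 * y (j₀ - 1) ^ 2 * L 0 * L 1)
      (mul_pos (mul_pos (by positivity) (hL 0 (Nat.zero_le n))) (hL 1 hn)) (h1.trans_eq (by ring))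
  have u0 := hm'.upper.inner_left hm'.unit hf.angles.nw (i := 0) hn
  have d0 := hm'.lower.inner_left hm'.unit hf.angles.sw (i := 0) hn
  have u1 := hm'.upper.inner_eq 1 hn
  have d1 := hm'.lower.inner_eq 1 hn
  have un := hm'.upper.norm_eq 1 hn
  have dn := hm'.lower.norm_eq 1 hn
  rw [zero_add, show σ.sw 1 = Real.pi - σ.nw 1 by linarith [hf.straight_left], Real.cos_pi_sub,
    scale_one, one_mul, neg_neg] at d0
  rw [startAngle, if_neg one_ne_zero, show σ.se 1 = Real.pi - σ.ne 1 by
    linarith [hf.straight_right], Real.cos_pi_sub, scale_one, one_mul] at d1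
  rw [zero_add, scale_one, one_mul] at u0
  rw [startAngle, if_neg one_ne_zero, scale_one, one_mul] at u1
  rw [scale_one] at un dn
  obtain ⟨B, hB, kU, kD, k0, k1⟩ := hf.exists_frame un dn (hm'.unit 0 (Nat.zero_le n))
    (hm'.unit 1 hn) u0 d0 u1 d1 hpos hlt.le (by linarith) (Or.inr ⟨hlt, hT⟩)
  refine ⟨h, ⟨hpos, hlt⟩, B, hB, A' 1, ?_⟩
  have hdir := hf.rowModel_eq hB hpos hlt.le hm' kU kD k0 k1 fun i hi => by
    obtain ⟨k, rfl⟩ : ∃ k, i = k + 1 := ⟨i - 1, by have := hi.1; omega⟩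
    have hi2 := hi.2
    have h4 := hN.mode _ hi
    rw [Nat.add_sub_cancel, e1 _ (by omega), e2 _ (by omega), e3 k (by omega), e3 (k + 1) hi2] at h4
    simp only [triple_smul_left, triple_smul_mid, triple_smul_right] at h4
    rw [Nat.add_sub_cancel]
    exact pos_of_pos_mul (b := x (j₀ + 1) ^ 2 * y (j₀ - 1) ^ 2 * L k * L (k + 1))
      (mul_pos (mul_pos (by positivity) (hL k (by omega))) (hL _ hi2)) (h4.trans_eq (by ring))
  have c1 : clampIdx n 1 = 1 := clampIdx_of_mem ⟨le_rfl, hn⟩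
  intro i hi j hjm
  have h5 := hm'.mesh_map_eq (hf.isRowModel hB hpos.le hlt.le (A' 1) L) LinearMap.id (x := x)
    (y := y) (fun i hi => (hdir i hi).symm)
    (by rw [foldUpper, c1, scale_one, one_smul, kU]; rfl)
    (by rw [foldLower, c1, scale_one, one_smul, kD]; rfl) hi j
  rw [pathVertex_one, LinearMap.id_apply, sub_add_cancel] at h5
  rw [hmesh i hi j hjm]
  exact h5.symm

theorem IsFoldable.triple_dir_ne_zero (hf : IsFoldable n σ ε) {B : Frame} (hB : B.IsOrtho) {h : ℝ}
    (h0 : 0 < h) (hh : h < Real.sin (σ.nw 1)) :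
    triple (foldDir σ ε B h 0) (foldDir σ ε B h 1) (foldUp σ ε B h 1) ≠ 0 ∧
      triple (foldDir σ ε B h 0) (foldDir σ ε B h 1) (foldDown σ ε B h 1) ≠ 0 := by
  have hi : (1 : ℕ) ∈ Set.Icc 1 n := ⟨le_rfl, hf.one_le⟩
  have hm := hf.isRowModel hB h0.le hh.le 0 0
  obtain ⟨k1, k2, k3, k4⟩ := hf.inner_dir_up hB h0.le hh.le hi
  have h1 := hf.inner_first hB h0.le hh.le
  have s1 : σ.se 1 = Real.pi - σ.ne 1 := by linarith [hf.straight_right]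
  have s2 : σ.sw 1 = Real.pi - σ.nw 1 := by linarith [hf.straight_left]
  rw [s1, Real.cos_pi_sub] at k2
  rw [s2, Real.cos_pi_sub, neg_neg] at k4
  have hd := hf.norm_foldDown hB h0.le hh.le hi
  refine ⟨triple_ne_zero_of_gram (hm.unit 0 (Nat.zero_le n)) (hm.unit 1 hf.one_le)
    (hf.norm_foldUp hB h0.le hh.le hi) k3 k1 rfl h1.1 (h1.2 h0), ?_⟩
  have h2 := triple_ne_zero_of_gram (c := -foldDown σ ε B h 1) (hm.unit 0 (Nat.zero_le n))
    (hm.unit 1 hf.one_le) (by rw [norm_neg, hd]) (α := σ.nw 1) (β := σ.ne 1)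
    (by rw [inner_neg_right]; exact congrArg Neg.neg k4)
    (by rw [inner_neg_right, k2, neg_neg]) rfl h1.1 (h1.2 h0)
  rw [triple_neg_right] at h2
  exact neg_ne_zero.1 h2

theorem IsFoldable.isNear_foldMesh (hf : IsFoldable n σ ε) {B : Frame} (hB : B.IsOrtho) {h : ℝ}
    (h0 : 0 < h) (hh : h < Real.sin (σ.nw 1))
    (hrung : ∀ i ≤ n, ∀ j ≤ m + 1, 0 < rung n σ L x y i j)
    (hxy : IsStaircase j₀ x y) (hj : j₀ ∈ Set.Icc 1 m) (O : Space) :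
    IsNear n m j₀ σ ε (x (j₀ + 1) * y (j₀ - 1)) (foldMesh n σ ε B O L x y h) := by
  have hn := hf.one_le
  have hj2 := hj.2
  have hm := hf.isRowModel hB h0.le hh.le O L
  have hL : ∀ i ≤ n, 0 < L i := fun i hi => by
    have := hrung i hi j₀ (by omega)
    rwa [hxy.rung_base] at this
  have hb := fun i => hxy.base_creases (pathVertex O L (foldDir σ ε B h)) (foldUpper n σ ε B h)
    (foldLower n σ ε B h) i hj.1
  obtain ⟨-, -, hx0, hy0⟩ := hb 0
  have e1 := fun i => (hb i).1
  have e2 := fun i => (hb i).2.1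
  have e3 : ∀ i ≤ n, foldMesh n σ ε B O L x y h (i + 1) j₀ - foldMesh n σ ε B O L x y h i j₀ =
      L i • foldDir σ ε B h i := fun i hi => by
    rw [foldMesh, hm.mesh_sub_right hi, hxy.rung_base]
  have c1 : clampIdx n 1 = 1 := clampIdx_of_mem ⟨le_rfl, hn⟩
  change ∀ i, foldMesh n σ ε B O L x y h i (j₀ + 1) - foldMesh n σ ε B O L x y h i j₀ = _ at e1
  change ∀ i, foldMesh n σ ε B O L x y h i (j₀ - 1) - foldMesh n σ ε B O L x y h i j₀ = _ at e2
  have hU1 : foldUpper n σ ε B h 1 = foldUp σ ε B h 1 := by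
    rw [foldUpper, c1, scale_one, one_smul]
  have hD1 : foldLower n σ ε B h 1 = foldDown σ ε B h 1 := by
    rw [foldLower, c1, scale_one, one_smul]
  have hk := mul_pos hx0 hy0
  have hud := hf.inner_up_down_first hB h0.le hh.le
  refine ⟨?_, ?_, ?_, ?_, ?_⟩
  · intro j hjm k hkm hjk
    have f0 := hm.mesh_sub_right (x := x) (y := y) (Nat.zero_le n) 0
    have f1 := hm.mesh_sub_right (x := x) (y := y) hn 0
    have r0 := hrung 0 (Nat.zero_le n) 0 (Nat.zero_le _)
    have r1 := hrung 1 hn 0 (Nat.zero_le _)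
    obtain ⟨t1, t2⟩ := hf.triple_dir_ne_zero hB h0 hh
    simp only [zero_add] at f0
    simp only [foldMesh, mesh_sub_up, f0, f1, triple_smul_left, triple_smul_mid]
    by_cases hjj : Even (j + j₀)
    · have a1 := sub_pos.2 (hxy.even_step j hjj).1
      have a2 := sub_pos.2 (hxy.even_step k (hjk.1 hjj)).1
      rw [rail_even hxy _ _ _ hjj, rail_even hxy _ _ _ (hjk.1 hjj), hU1, triple_smul_right,
        triple_smul_right]
      refine (mul_pos (mul_pos (mul_pos a1 a2) (pow_pos (mul_pos r0 r1) 2))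
        (pow_pos (abs_pos.2 t1) 2)).trans_eq ?_
      rw [sq_abs]
      ring
    · have a1 := sub_pos.2 (hxy.odd_step j hjj).2
      have a2 := sub_pos.2 (hxy.odd_step k (mt hjk.2 hjj)).2
      rw [rail_odd hxy _ _ _ hjj, rail_odd hxy _ _ _ (mt hjk.2 hjj), hD1, triple_smul_right,
        triple_smul_right]
      refine (mul_pos (mul_pos (mul_pos a1 a2) (pow_pos (mul_pos r0 r1) 2))
        (pow_pos (abs_pos.2 t2) 2)).trans_eq ?_
      rw [sq_abs]
      ring
  · have f0 := e3 0 (Nat.zero_le n)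
    rw [zero_add] at f0
    rw [e1, e2, f0, e3 1 hn, hU1, hD1]
    simp only [triple_smul_left, triple_smul_mid, triple_smul_right]
    refine (mul_pos (mul_pos (mul_pos (pow_pos hk 2) (hL 0 (Nat.zero_le n))) (hL 1 hn))
      (hf.triple_first hB h0 hh)).trans_eq ?_
    ring
  · intro i hi
    obtain ⟨r, hr, ht⟩ := hf.triple_fold hB h0 hh.le hi
    have hi1 : i ∈ Set.Icc 1 n := ⟨one_le_two.trans hi.1, hi.2⟩
    have hq := hf.mode_sq i hi
    obtain ⟨k, rfl⟩ : ∃ k, i = k + 1 := ⟨i - 1, by have := hi.1; omega⟩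
    have hi2 := hi.2
    have s1 := hf.angles.scale_upper_pos hi2
    have s2 := hf.angles.scale_lower_pos hi2
    rw [Nat.add_sub_cancel] at ht ⊢
    rw [e1, e2, e3 k (by omega), e3 (k + 1) hi2, foldUpper, foldLower, clampIdx_of_mem hi1]
    simp only [triple_smul_left, triple_smul_mid, triple_smul_right]
    have h4 : 0 < ε (k + 1) ^ 2 * r := by rw [hq, one_mul]; exact hr
    refine (mul_pos (mul_pos (mul_pos (mul_pos (pow_pos hk 2) (pow_pos (mul_pos s1 s2) 2))
      (hL k (by omega))) (hL _ hi2)) h4).trans_eq ?_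
    rw [sq (ε _), mul_assoc (ε _), ← ht]
    ring
  · rw [e1, e2, hU1, hD1, real_inner_smul_left, real_inner_smul_right, ← mul_assoc, hud]
    nlinarith [mul_pos hk (pow_pos h0 2)]
  · rw [e1, e2, hU1, hD1, real_inner_smul_left, real_inner_smul_right, ← mul_assoc, hud]
    have : h ^ 2 < Real.sin (σ.nw 1) ^ 2 := pow_lt_pow_left₀ hh h0.le two_ne_zero
    exact mul_lt_mul_of_pos_left (by linarith) hk

theorem tendsto_triple {α : Type*} {l : Filter α} {a b c : α → Space} {a₀ b₀ c₀ : Space}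
    (ha : Tendsto a l (𝓝 a₀)) (hb : Tendsto b l (𝓝 b₀)) (hc : Tendsto c l (𝓝 c₀)) :
    Tendsto (fun p => triple (a p) (b p) (c p)) l (𝓝 (triple a₀ b₀ c₀)) := by
  have h : Continuous fun q : Space × Space × Space => triple q.1 q.2.1 q.2.2 := by
    unfold triple; fun_prop
  exact (h.tendsto (a₀, b₀, c₀)).comp (ha.prodMk_nhds (hb.prodMk_nhds hc))

/-- The conditions of `IsNear` persist under small changes of the vertices. -/
theorem IsNear.exists_nhd {κ : ℝ} {ψ : ℕ → ℕ → Space} (hn : 1 ≤ n) (hj : j₀ ∈ Set.Icc 1 m)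
    (hψ : IsNear n m j₀ σ ε κ ψ) :
    ∃ δ > 0, ∀ p : ℕ → ℕ → Space,
      (∀ i ≤ n + 1, ∀ j ≤ m + 1, dist (p i j) (ψ i j) < δ) → IsNear n m j₀ σ ε κ p := by
  have hj2 := hj.2
  let res : (ℕ → ℕ → Space) → (Fin (n + 2) × Fin (m + 2) → Space) := fun p k => p k.1 k.2
  set l : Filter (ℕ → ℕ → Space) := comap res (𝓝 (res ψ)) with hl
  have ht : ∀ i ≤ n + 1, ∀ j ≤ m + 1, Tendsto (fun p : ℕ → ℕ → Space => p i j) l (𝓝 (ψ i j)) := by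
    intro i hi j hjm
    exact ((continuous_apply ((⟨i, by omega⟩, ⟨j, by omega⟩) : Fin (n + 2) × Fin (m + 2))).tendsto
      (res ψ)).comp tendsto_comap
  have htt : ∀ {i i' j k : ℕ}, i ≤ n + 1 → i' ≤ n + 1 → j ≤ m + 1 → k ≤ m + 1 →
      Tendsto (fun p : ℕ → ℕ → Space => p i j - p i' k) l (𝓝 (ψ i j - ψ i' k)) :=
    fun h1 h2 h3 h4 => (ht _ h1 _ h3).sub (ht _ h2 _ h4)
  have hev : ∀ᶠ p in l, IsNear n m j₀ σ ε κ p := by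
    have c1 : ∀ᶠ p in l, SidesAgree m j₀ p := by
      refine (Filter.eventually_all_finite (Set.finite_Iic m)).2 fun j hjm =>
        (Filter.eventually_all_finite (Set.finite_Iic m)).2 fun k hkm => ?_
      have hjm' : j ≤ m := hjm
      have hkm' : k ≤ m := hkm
      by_cases hjk : Even (j + j₀) ↔ Even (k + j₀)
      · have t0 := htt (i := 1) (i' := 0) (j := 0) (k := 0) (by omega) (by omega) (by omega)
          (by omega)
        have t1 := htt (i := 2) (i' := 1) (j := 0) (k := 0) (by omega) (by omega) (by omega)
          (by omega)
        filter_upwards [((tendsto_triple t0 t1 (htt (i := 1) (i' := 1) (j := j + 1) (k := j)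
            (by omega) (by omega) (by omega) (by omega))).mul (tendsto_triple t0 t1
            (htt (i := 1) (i' := 1) (j := k + 1) (k := k)
            (by omega) (by omega) (by omega) (by omega)))).eventually_const_lt
            (hψ.sides j hjm k hkm hjk)] with p hp _
        exact hp
      · exact Eventually.of_forall fun p h => absurd h hjk
    have tu : ∀ i ≤ n, _ := fun i hi => htt (i := i) (i' := i) (j := j₀ + 1) (k := j₀)
      (by omega) (by omega) (by omega) (by omega)
    have td : ∀ i ≤ n, _ := fun i hi => htt (i := i) (i' := i) (j := j₀ - 1) (k := j₀)
      (by omega) (by omega) (by omega) (by omega)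
    have c2 := ((tendsto_triple (tu 1 hn) (td 1 hn) (htt (i := 1) (i' := 0) (j := j₀) (k := j₀)
      (by omega) (by omega) (by omega) (by omega))).mul (tendsto_triple (tu 1 hn) (td 1 hn)
      (htt (i := 2) (i' := 1) (j := j₀) (k := j₀)
      (by omega) (by omega) (by omega) (by omega)))).eventually_const_lt hψ.first
    have c3 : ∀ᶠ p in l, ∀ i ∈ Set.Icc 2 n, 0 < ε i *
        (triple (p i (j₀ + 1) - p i j₀) (p i (j₀ - 1) - p i j₀) (p i j₀ - p (i - 1) j₀) *
          triple (p i (j₀ + 1) - p i j₀) (p i (j₀ - 1) - p i j₀) (p (i + 1) j₀ - p i j₀)) := by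
      refine (Filter.eventually_all_finite (Set.finite_Icc 2 n)).2 fun i hi => ?_
      have hi2 := hi.2
      exact (((tendsto_triple (tu i hi2) (td i hi2) (htt (i := i) (i' := i - 1) (j := j₀) (k := j₀)
        (by omega) (by omega) (by omega) (by omega))).mul (tendsto_triple (tu i hi2) (td i hi2)
        (htt (i := i + 1) (i' := i) (j := j₀) (k := j₀)
        (by omega) (by omega) (by omega) (by omega)))).const_mul (ε i)).eventually_const_lt
        (hψ.mode i hi)
    have c4 := ((tu 1 hn).inner (td 1 hn) (𝕜 := ℝ)).eventually_const_lt hψ.lower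
    have c5 := ((tu 1 hn).inner (td 1 hn) (𝕜 := ℝ)).eventually_lt_const hψ.upper
    filter_upwards [c1, c2, c3, c4, c5] with p a1 a2 a3 a4 a5
    exact ⟨a1, a2, a3, a4, a5⟩
  obtain ⟨δ, hδ, h1⟩ := ((Metric.nhds_basis_ball (x := res ψ)).comap res).eventually_iff.1 hev
  refine ⟨δ, hδ, fun p hp => h1 ?_⟩
  rw [Set.mem_preimage, Metric.mem_ball, dist_pi_lt_iff hδ]
  exact fun k => hp _ (by omega) _ (by omega)

end Near

/-! ### The datum row folds rigidly -/

/-- The final state of the paper, generated by the datum row, is the end of a rigid folding motion. -/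
theorem IsDatumRow.exists_isFoldingMotion {n m j₀ : ℕ} {R : Row} {x y : ℕ → ℝ} (hR : IsDatumRow n R)
    (hn : 1 ≤ n) (hxy : IsStaircase j₀ x y) (hj : j₀ ∈ Set.Icc 1 m)
    (hrung : ∀ i ≤ n, ∀ j ≤ m + 1, 0 < rung n R.angles R.len x y i j) :
    ∃ ψ : ℝ → ℕ → ℕ → Space, IsFoldingMotion n m
      (mesh (drawnVertex R) (drawnUpper n R.angles) (drawnLower n R.angles) x y)
      (mesh R.A (R.upper n) (R.lower n) x y) ψ := by
  have h1 : (1 : ℕ) ∈ Set.Icc 1 n := ⟨le_rfl, hn⟩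
  have hf := hR.isFoldable hn
  have hsin := Real.sin_pos_of_mem_Ioo (hf.angles.nw 1 h1)
  have c1 : clampIdx n 1 = 1 := clampIdx_of_mem h1
  obtain ⟨B, hB, kU, kD, hdir⟩ := hR.exists_frame hn
  have hP := isRowModel_drawn hn R hR.anglesMem fun i hi => hR.developable hi
  set s := Real.sin (R.angles.nw 1) with hs
  have hrange : ∀ τ ∈ Set.Icc (0 : ℝ) 1, τ * s ∈ Set.Icc 0 s := fun τ hτ =>
    ⟨mul_nonneg hτ.1 hsin.le, mul_le_of_le_one_left hsin.le hτ.2⟩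
  refine ⟨fun τ => foldMesh n R.angles R.mode B (R.A 1) R.len x y (τ * s), ?_, ?_, ?_, ?_, ?_, ?_,
    ?_⟩
  · intro i hi j _
    exact (hf.continuousOn_foldMesh (R.A 1) R.len x y hi j).comp
      (continuous_id.mul continuous_const).continuousOn hrange
  · intro τ hτ i hi j _ k hk l hl
    exact (hf.isRowModel hB (hrange τ hτ).1 (hrange τ hτ).2 (R.A 1) R.len).dist_corners hP hxy hi
      hk hl
  · let g : Plane →ₗᵢ[ℝ] Space := ⟨B.planeMap (R.angles.nw 1), hB.norm_planeMap _⟩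
    refine ⟨(AffineIsometryEquiv.constVAdd ℝ Space (R.A 1 - g (drawnVertex R 1))).toAffineIsometry.comp
      g.toAffineIsometry, fun i hi j _ => ?_⟩
    have h2 := hR.foldMesh_flat hf hB (R.A 1) x y hi j
    simp only [zero_mul]
    rw [h2, map_sub]
    change _ = (R.A 1 - B.planeMap (R.angles.nw 1) (drawnVertex R 1)) + B.planeMap (R.angles.nw 1) _
    abel
  · intro i hi j _
    have h2 := (hR.isRowModel hn).mesh_map_eq (hf.isRowModel hB hsin.le le_rfl (R.A 1) R.len)
      LinearMap.id (x := x) (y := y) (fun i hi => (hdir i hi).symm)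
      (by rw [foldUpper, Row.upper, c1, scale_one, one_smul, one_smul, kU]; rfl)
      (by rw [foldLower, Row.lower, c1, scale_one, one_smul, one_smul, kD]; rfl) hi j
    rw [pathVertex_one, LinearMap.id_apply, sub_add_cancel] at h2
    simp only [one_mul]
    exact h2
  · intro τ hτ
    exact hf.not_clash hB (hrange τ ⟨hτ.1, hτ.2.le⟩).1 (mul_lt_of_lt_one_left hsin hτ.2) hxy hrung
  · exact hR.clash hn hxy hj
  · intro τ hτ
    obtain ⟨δ, hδ, hnear⟩ := (hf.isNear_foldMesh hB (mul_pos hτ.1 hsin)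
      (mul_lt_of_lt_one_left hsin hτ.2) hrung hxy hj (R.A 1)).exists_nhd hn hj
    refine ⟨δ, hδ, fun q' hq' hclose => ?_⟩
    obtain ⟨h, hh, B', hB', O', hq⟩ := (hnear q' hclose).exists_foldMesh hf hq' hP hrung hxy hj
    have hτ' : h / s * s = h := div_mul_cancel₀ _ hsin.ne'
    refine ⟨h / s, ⟨div_pos hh.1 hsin, (div_lt_one hsin).2 hh.2⟩, ?_⟩
    obtain ⟨g, ge, gm, gk⟩ := hB.exists_isometry hB'
    have hg := map_fold R.angles R.mode ge gm gk h
    refine ⟨g.toAffineIsometryEquiv.trans (AffineIsometryEquiv.constVAdd ℝ Space (O' - g (R.A 1))),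
      fun i hi j hjm => ?_⟩
    have h2 := (hf.isRowModel hB hh.1.le hh.2.le (R.A 1) R.len).mesh_map_eq
      (hf.isRowModel hB' hh.1.le hh.2.le O' R.len) g.toLinearEquiv.toLinearMap (x := x) (y := y)
      (fun i _ => (hg i).1.symm)
      (by rw [foldUpper, foldUpper, c1, scale_one, one_smul, one_smul]; exact (hg 1).2.1.symm)
      (by rw [foldLower, foldLower, c1, scale_one, one_smul, one_smul]; exact (hg 1).2.2.symm) hi j
    rw [pathVertex_one, pathVertex_one, map_sub] at h2
    rw [hq i hi j hjm]
    simp only [hτ']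
    refine h2.trans ?_
    change g (foldMesh n R.angles R.mode B (R.A 1) R.len x y h i j) - g (R.A 1) + O' =
      (O' - g (R.A 1)) + g (foldMesh n R.angles R.mode B (R.A 1) R.len x y h i j)
    abel

/-! ### Realization of a design -/

theorem hausdorffEDist_le_ofReal {s t : Set Space} {r : ℝ} (h1 : ∀ v ∈ s, ∃ w ∈ t, dist v w ≤ r)
    (h2 : ∀ w ∈ t, ∃ v ∈ s, dist v w ≤ r) : Metric.hausdorffEDist s t ≤ ENNReal.ofReal r := by
  refine Metric.hausdorffEDist_le_of_mem_edist (fun v hv => ?_) fun w hw => ?_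
  · obtain ⟨w, hw, h⟩ := h1 v hv
    exact ⟨w, hw, by rw [edist_dist]; exact ENNReal.ofReal_le_ofReal h⟩
  · obtain ⟨v, hv, h⟩ := h2 w hw
    exact ⟨v, hv, by rw [edist_comm, edist_dist]; exact ENNReal.ofReal_le_ofReal h⟩

section Design

variable {Γ : ℝ → Space} {a b : ℝ} {f : ℝ → Plane} {c d t₀ θ : ℝ} {n : ℕ} {R : Row} {idx : ℝ → ℕ}
  {ε₁ : ℝ}

theorem ApproximatesDatum.idx_mem (h : ApproximatesDatum Γ a b n R idx ε₁) {u : ℝ}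
    (hu : u ∈ Set.Icc a b) : idx u ∈ Set.Icc 1 n :=
  h.image_eq ▸ Set.mem_image_of_mem idx hu

theorem ApproximatesDatum.exists_idx_eq (h : ApproximatesDatum Γ a b n R idx ε₁) {i : ℕ}
    (hi : i ∈ Set.Icc 1 n) : ∃ u ∈ Set.Icc a b, idx u = i := by
  rw [← h.image_eq] at hi
  exact hi

theorem ApproximatesDatum.one_le (h : ApproximatesDatum Γ a b n R idx ε₁) (hab : a ≤ b) : 1 ≤ n :=
  let h1 := h.idx_mem (Set.left_mem_Icc.2 hab)
  h1.1.trans h1.2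

/-- Consecutive cells of the partition contain parameters that are arbitrarily close. -/
theorem ApproximatesDatum.exists_adjacent (h : ApproximatesDatum Γ a b n R idx ε₁) {i : ℕ}
    (hi1 : 1 ≤ i) (hi2 : i + 1 ≤ n) {ρ : ℝ} (hρ : 0 < ρ) :
    ∃ u ∈ Set.Icc a b, ∃ v ∈ Set.Icc a b, idx u = i ∧ idx v = i + 1 ∧ |u - v| < ρ := by
  obtain ⟨u₀, hu₀, hiu⟩ := h.exists_idx_eq (i := i) ⟨hi1, by omega⟩
  obtain ⟨w, hw, hiw⟩ := h.exists_idx_eq (i := i + 1) ⟨by omega, hi2⟩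
  set S : Set ℝ := {u ∈ Set.Icc a b | idx u ≤ i} with hS
  have hu₀S : u₀ ∈ S := ⟨hu₀, hiu.le⟩
  have hSw : ∀ u ∈ S, u ≤ w := fun u hu => by
    by_contra! hlt
    have := h.monotone hw hu.1 hlt.le
    have := hu.2
    omega
  have hbdd : BddAbove S := ⟨w, hSw⟩
  obtain ⟨u₁, hu₁, hlt⟩ := exists_lt_of_lt_csSup ⟨u₀, hu₀S⟩
    (show sSup S - ρ / 2 < sSup S by linarith)
  have hu₂ : max u₁ u₀ ∈ S := by
    rcases max_choice u₁ u₀ with h1 | h1 <;> rw [h1] <;> assumption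
  have hu₂s := le_csSup hbdd hu₂
  have hsw : sSup S ≤ w := csSup_le ⟨u₀, hu₀S⟩ hSw
  have hi3 : idx (max u₁ u₀) = i := by
    have h1 := h.monotone hu₀ hu₂.1 (le_max_right _ _)
    have h2 := hu₂.2
    omega
  have hu₂l : sSup S - ρ / 2 < max u₁ u₀ := hlt.trans_le (le_max_left _ _)
  rcases lt_or_ge w (sSup S + ρ / 2) with h3 | h3
  · refine ⟨_, hu₂.1, w, hw, hi3, hiw, ?_⟩
    rw [abs_lt]
    constructor <;> linarith
  · have h4 : sSup S + ρ / 2 ∈ Set.Icc a b := by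
      have := hu₂.1.1
      exact ⟨by linarith, h3.trans hw.2⟩
    refine ⟨_, hu₂.1, _, h4, hi3, ?_, ?_⟩
    · have h5 := h.monotone h4 hw h3
      have h6 : ¬ idx (sSup S + ρ / 2) ≤ i := fun h7 => by
        have := le_csSup hbdd (show sSup S + ρ / 2 ∈ S from ⟨h4, h7⟩)
        linarith
      omega
    · rw [abs_lt]
      constructor <;> linarith

/-- Next to each edge of the datum row there are two nearly equal parameters, whose cells are those
of the columns that carry the creases at the ends of the edge. -/
theorem ApproximatesDatum.exists_params (h : ApproximatesDatum Γ a b n R idx ε₁) (hab : a ≤ b) {i : ℕ}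
    (hi : i ≤ n) {ρ : ℝ} (hρ : 0 < ρ) :
    ∃ u ∈ Set.Icc a b, ∃ v ∈ Set.Icc a b, idx u = clampIdx n i ∧ idx v = clampIdx n (i + 1) ∧
      dist (Γ u) (R.A i) ≤ ε₁ ∧ dist (Γ v) (R.A (i + 1)) ≤ ε₁ ∧ |u - v| < ρ := by
  have hn := h.one_le hab
  have ha := Set.left_mem_Icc.2 hab
  have hb := Set.right_mem_Icc.2 hab
  rcases Nat.eq_zero_or_pos i with rfl | hi0
  · have h1 : idx a = 1 := by
      obtain ⟨u, hu, hiu⟩ := h.exists_idx_eq (i := 1) ⟨le_rfl, hn⟩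
      have h2 := h.monotone ha hu hu.1
      have h3 := (h.idx_mem ha).1
      omega
    have h4 := h.dist_le a ha
    rw [h1] at h4
    exact ⟨a, ha, a, ha, by rw [h1, clampIdx_zero],
      by rw [h1, clampIdx_of_mem (i := 0 + 1) ⟨le_rfl, hn⟩], h.dist_left, h4, by simpa using hρ⟩
  rcases eq_or_lt_of_le hi with rfl | hlt
  · have h1 : idx b = i := by
      obtain ⟨u, hu, hiu⟩ := h.exists_idx_eq (i := i) ⟨hn, le_rfl⟩
      have h2 := h.monotone hu hb hu.2
      have h3 := (h.idx_mem hb).2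
      omega
    have h4 := h.dist_le b hb
    rw [h1] at h4
    exact ⟨b, hb, b, hb, by rw [h1, clampIdx_of_mem ⟨hn, le_rfl⟩], by rw [h1, clampIdx_succ hn], h4,
      h.dist_right, by simpa using hρ⟩
  · obtain ⟨u, hu, v, hv, hiu, hiv, huv⟩ := h.exists_adjacent hi0 hlt hρ
    have h1 := h.dist_le u hu
    have h2 := h.dist_le v hv
    rw [hiu] at h1
    rw [hiv] at h2
    exact ⟨u, hu, v, hv, by rw [hiu, clampIdx_of_mem ⟨hi0, hi⟩],
      by rw [hiv, clampIdx_of_mem ⟨by omega, hlt⟩], h1, h2, huv⟩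

/-- The paper of a design and its final state. All vertices of two consecutive rows are close to the
target curves at a common parameter `t`, and every parameter is met in this way by an inner row. -/
theorem IsDesign.exists_realizes (hD : IsDesign Γ a b f c d t₀ θ n R idx ε₁) (hn : 1 ≤ n)
    (hcd : c ≤ d) (hf : ContinuousOn f (Set.Icc c d)) (ht₀ : t₀ ∈ Set.Icc c d) {ε ν : ℝ}
    (hν : 0 < ν) (hνε : ν ≤ ε) (hε : ε₁ ≤ ε) :
    ∃ (m j₀ : ℕ) (P : ℕ → ℕ → Plane) (q : ℕ → ℕ → Space),
      Realizes Γ a b f c d t₀ θ n R m j₀ P q ε ∧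
      (∀ j ≤ m, ∃ t ∈ Set.Icc c d, ∀ i ≤ n + 1,
        dist (q i j) (R.A i + placedCurve R θ f t₀ (clampIdx n i) t) ≤ ν ∧
        dist (q i (j + 1)) (R.A i + placedCurve R θ f t₀ (clampIdx n i) t) ≤ ν) ∧
      (∀ t ∈ Set.Icc c d, ∃ j ∈ Set.Icc 1 m, ∀ i ≤ n + 1,
        dist (q i j) (R.A i + placedCurve R θ f t₀ (clampIdx n i) t) ≤ ν) := by
  have hR := hD.datumRow
  have hdev : ∀ i ∈ Set.Icc 1 n, R.angles.ne i + R.angles.nw i + R.angles.sw i + R.angles.se i =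
    2 * Real.pi := fun i hi => hR.developable hi
  obtain ⟨η₀, hη₀, hpaper⟩ := exists_accuracy_isCreasedPaper hn hR.anglesMem hdev
    (fun i hi => hR.len_pos hn hi) hf hcd hD.drawable
  -- a bound for the change of the vertices per unit of the crease coordinates
  set M : ℝ := 1 + ∑ i ∈ Finset.range (n + 2), (‖R.upper n i‖ + ‖R.lower n i‖) with hM
  have hM0 : ∀ i ∈ Finset.range (n + 2), 0 ≤ ‖R.upper n i‖ + ‖R.lower n i‖ := fun i _ => by positivity
  have hMpos : 0 < M := by
    have := Finset.sum_nonneg hM0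
    linarith
  have hMle : ∀ i ≤ n + 1, ‖R.upper n i‖ + ‖R.lower n i‖ ≤ M := fun i hi => by
    have := Finset.single_le_sum hM0 (Finset.mem_range.2 (by omega : i < n + 2))
    linarith
  set η := min η₀ (ν / M) with hη
  have hηpos : 0 < η := lt_min hη₀ (div_pos hν hMpos)
  obtain ⟨m, j₀, x, y, hj, hxy, hclose, hcover⟩ := exists_staircase ht₀
    (X := fun t => offset R θ f t₀ t 0) (Y := fun t => offset R θ f t₀ t 1)
    (continuousOn_offset hf t₀ 0) (continuousOn_offset hf t₀ 1) (by simp [offset])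
    (by simp [offset]) (fun s hs t ht => by
      have := hD.decreasing s hs t ht
      simp only [offset, Pi.sub_apply, sub_sub_sub_cancel_right]
      exact this) hηpos
  obtain ⟨hP, hrung⟩ := hpaper m j₀ x y hxy fun j hjm => by
    obtain ⟨t, ht, h1, h2, h3, h4⟩ := hclose j hjm
    have h5 := min_le_left η₀ (ν / M)
    exact ⟨t, ht, h1.trans h5, h2.trans h5, h3.trans h5, h4.trans h5⟩
  set q := mesh R.A (R.upper n) (R.lower n) x y with hq
  have hpc : ∀ i t, placedCurve R θ f t₀ (clampIdx n i) t =
      offset R θ f t₀ t 0 • R.upper n i + offset R θ f t₀ t 1 • R.lower n i := fun i t => by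
    have h1 := clampIdx_mem hn i
    rw [hR.placedCurve_eq θ f t₀ t h1]
    simp only [Row.upper, Row.lower, clampIdx_of_mem h1]
  have hdist : ∀ i ≤ n + 1, ∀ j t, |x j - offset R θ f t₀ t 0| ≤ η →
      |y j - offset R θ f t₀ t 1| ≤ η →
      dist (q i j) (R.A i + placedCurve R θ f t₀ (clampIdx n i) t) ≤ ν := by
    intro i hi j t h1 h2
    rw [hpc, ← add_assoc]
    refine (abs_sub_smul_le _ _ _ h1 h2).trans ?_
    calc η * (‖R.upper n i‖ + ‖R.lower n i‖) ≤ ν / M * M :=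
          mul_le_mul (min_le_right _ _) (hMle i hi) (by positivity) (div_pos hν hMpos).le
      _ = ν := div_mul_cancel₀ _ hMpos.ne'
  have hc1 : ∀ j ≤ m, ∃ t ∈ Set.Icc c d, ∀ i ≤ n + 1,
      dist (q i j) (R.A i + placedCurve R θ f t₀ (clampIdx n i) t) ≤ ν ∧
      dist (q i (j + 1)) (R.A i + placedCurve R θ f t₀ (clampIdx n i) t) ≤ ν := fun j hjm => by
    obtain ⟨t, ht, h1, h2, h3, h4⟩ := hclose j hjm
    exact ⟨t, ht, fun i hi => ⟨hdist i hi j t h1 h2, hdist i hi (j + 1) t h3 h4⟩⟩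
  have hc2 : ∀ t ∈ Set.Icc c d, ∃ j ∈ Set.Icc 1 m, ∀ i ≤ n + 1,
      dist (q i j) (R.A i + placedCurve R θ f t₀ (clampIdx n i) t) ≤ ν := fun t ht => by
    obtain ⟨j, hjm, h1, h2⟩ := hcover t ht
    exact ⟨j, hjm, fun i hi => hdist i hi j t h1 h2⟩
  refine ⟨m, j₀, mesh (drawnVertex R) (drawnUpper n R.angles) (drawnLower n R.angles) x y, q,
    ?_, hc1, hc2⟩
  have hA := hD.approximates
  exact
    { paper := hP
      datum_index := hj
      parallelRepeating := (isRowModel_drawn hn R hR.anglesMem hdev).isParallelRepeating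
        hR.anglesMem hdev (fun i hi => hR.not_cross hi) hxy hrung
      motion := hR.exists_isFoldingMotion hn hxy hj hrung
      row := fun i _ => hxy.mesh_base i
      row_close := by
        refine hausdorffEDist_le_ofReal ?_ ?_
        · rintro v ⟨i, hi, rfl⟩
          obtain ⟨u, hu, hiu⟩ := hA.exists_idx_eq hi
          refine ⟨Γ u, Set.mem_image_of_mem Γ hu, ?_⟩
          rw [hq, hxy.mesh_base, dist_comm, ← hiu]
          exact (hA.dist_le u hu).trans hε
        · rintro w ⟨u, hu, rfl⟩
          refine ⟨_, ⟨idx u, hA.idx_mem hu, rfl⟩, ?_⟩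
          rw [hq, hxy.mesh_base, dist_comm]
          exact (hA.dist_le u hu).trans hε
      place_norm := fun i hi v => hR.norm_place θ hi v
      crease_angle := fun i hi => hR.angle_ud hi
      first_curve := hR.targetCurve_first hn θ f
      column_planar := fun i hi j _ => by
        rw [Submodule.mem_span_pair]
        refine ⟨x j * scale R.angles.ne R.angles.nw i, y j * scale R.angles.se R.angles.sw i, ?_⟩
        simp only [hq, mesh, Row.upper, Row.lower, clampIdx_of_mem hi]
        module
      column_close := fun i hi => by
        have hi' : i ≤ n + 1 := hi.2.trans (Nat.le_succ n)
        refine hausdorffEDist_le_ofReal ?_ ?_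
        · rintro v ⟨j, hjm, rfl⟩
          obtain ⟨t, ht, h1⟩ := hc1 j hjm.2
          have h2 := (h1 i hi').1
          rw [clampIdx_of_mem hi] at h2
          exact ⟨_, Set.mem_image_of_mem _ ht, h2.trans hνε⟩
        · rintro w ⟨t, ht, rfl⟩
          obtain ⟨j, hjm, h1⟩ := hc2 t ht
          have h2 := h1 i hi'
          rw [clampIdx_of_mem hi] at h2
          exact ⟨_, ⟨j, hjm, rfl⟩, h2.trans hνε⟩
      plane_angle := fun i hi1 hi2 => hR.cos_angle_columnNormal hi1 hi2 }

variable {m : ℕ} {q : ℕ → ℕ → Space} {ν δ ε : ℝ} {F : ℝ → ℝ → Space}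

/-- If the folded vertices follow the placed curves within `ν`, and these follow `F` within `δ`, the
folded inner vertices are close to the surface. -/
theorem ApproximatesDatum.hausdorffEDist_innerVertices
    (hA : ApproximatesDatum Γ a b n R idx ε₁)
    (hc1 : ∀ j ≤ m, ∃ t ∈ Set.Icc c d, ∀ i ≤ n + 1,
        dist (q i j) (R.A i + placedCurve R θ f t₀ (clampIdx n i) t) ≤ ν ∧
        dist (q i (j + 1)) (R.A i + placedCurve R θ f t₀ (clampIdx n i) t) ≤ ν)
    (hc2 : ∀ t ∈ Set.Icc c d, ∃ j ∈ Set.Icc 1 m, ∀ i ≤ n + 1,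
        dist (q i j) (R.A i + placedCurve R θ f t₀ (clampIdx n i) t) ≤ ν)
    (hF : ∀ u ∈ Set.Icc a b, ∀ t ∈ Set.Icc c d, dist (placedCurve R θ f t₀ (idx u) t) (F u t) ≤ δ)
    (hε : ν + ε₁ + δ ≤ ε) :
    Metric.hausdorffEDist (innerVertices n m q) (surface Γ F a b c d) ≤ ENNReal.ofReal ε := by
  have key : ∀ u ∈ Set.Icc a b, ∀ t ∈ Set.Icc c d, ∀ p : Space,
      dist p (R.A (idx u) + placedCurve R θ f t₀ (clampIdx n (idx u)) t) ≤ ν →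
      dist p (Γ u + F u t) ≤ ε := by
    intro u hu t ht p hp
    rw [clampIdx_of_mem (hA.idx_mem hu)] at hp
    have h1 := dist_triangle p (R.A (idx u) + placedCurve R θ f t₀ (idx u) t) (Γ u + F u t)
    have h2 := dist_add_add_le (R.A (idx u)) (placedCurve R θ f t₀ (idx u) t) (Γ u) (F u t)
    have h3 := hA.dist_le u hu
    rw [dist_comm] at h3
    linarith [hF u hu t ht]
  refine hausdorffEDist_le_ofReal ?_ ?_
  · rintro v ⟨i, hi, j, hj, rfl⟩
    obtain ⟨u, hu, rfl⟩ := hA.exists_idx_eq hi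
    obtain ⟨t, ht, h1⟩ := hc1 j hj.2
    exact ⟨_, ⟨u, hu, t, ht, rfl⟩, key u hu t ht _ (h1 _ (hi.2.trans (Nat.le_succ n))).1⟩
  · rintro w ⟨u, hu, t, ht, rfl⟩
    obtain ⟨j, hj, h1⟩ := hc2 t ht
    have hi := hA.idx_mem hu
    exact ⟨_, ⟨idx u, hi, j, hj, rfl⟩, key u hu t ht _ (h1 _ (hi.2.trans (Nat.le_succ n)))⟩

/-- Under the same conditions, if `Γ` and `F` change by at most `ν` over parameter steps shorter than
`ρ`, the whole folded paper is close to the surface. -/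
theorem ApproximatesDatum.hausdorffEDist_region
    (hA : ApproximatesDatum Γ a b n R idx ε₁) (hab : a ≤ b)
    (hc1 : ∀ j ≤ m, ∃ t ∈ Set.Icc c d, ∀ i ≤ n + 1,
        dist (q i j) (R.A i + placedCurve R θ f t₀ (clampIdx n i) t) ≤ ν ∧
        dist (q i (j + 1)) (R.A i + placedCurve R θ f t₀ (clampIdx n i) t) ≤ ν)
    (hc2 : ∀ t ∈ Set.Icc c d, ∃ j ∈ Set.Icc 1 m, ∀ i ≤ n + 1,
        dist (q i j) (R.A i + placedCurve R θ f t₀ (clampIdx n i) t) ≤ ν)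
    (hF : ∀ u ∈ Set.Icc a b, ∀ t ∈ Set.Icc c d, dist (placedCurve R θ f t₀ (idx u) t) (F u t) ≤ δ)
    {ρ : ℝ} (hρ : 0 < ρ)
    (hunif : ∀ u ∈ Set.Icc a b, ∀ v ∈ Set.Icc a b, |u - v| < ρ → ∀ t ∈ Set.Icc c d,
      dist (Γ u) (Γ v) ≤ ν ∧ dist (F u t) (F v t) ≤ ν)
    (hν : 0 ≤ ν) (hε : 3 * ν + ε₁ + δ ≤ ε) :
    Metric.hausdorffEDist (region n m q) (surface Γ F a b c d) ≤ ENNReal.ofReal ε := by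
  refine hausdorffEDist_le_ofReal ?_ ?_
  · rintro v ⟨i, hi, j, hj, hv⟩
    obtain ⟨t, ht, h1⟩ := hc1 j hj
    obtain ⟨u, hu, w, hw, hiu, hiw, hdu, hdw, huw⟩ := hA.exists_params hab hi hρ
    refine ⟨Γ u + F u t, ⟨u, hu, t, ht, rfl⟩, ?_⟩
    have k1 : ∀ p : Space, dist p (R.A i + placedCurve R θ f t₀ (clampIdx n i) t) ≤ ν →
        dist p (Γ u + F u t) ≤ ε := by
      intro p hp
      have h2 := hF u hu t ht
      rw [hiu] at h2
      rw [dist_comm] at hdu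
      have h3 := dist_triangle p (R.A i + placedCurve R θ f t₀ (clampIdx n i) t) (Γ u + F u t)
      have h4 := dist_add_add_le (R.A i) (placedCurve R θ f t₀ (clampIdx n i) t) (Γ u) (F u t)
      linarith
    have k2 : ∀ p : Space,
        dist p (R.A (i + 1) + placedCurve R θ f t₀ (clampIdx n (i + 1)) t) ≤ ν →
        dist p (Γ u + F u t) ≤ ε := by
      intro p hp
      have h2 := hF w hw t ht
      rw [hiw] at h2
      rw [dist_comm] at hdw
      obtain ⟨g1, g2⟩ := hunif u hu w hw huw t ht
      rw [dist_comm] at g1 g2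
      have h3 := dist_triangle p (R.A (i + 1) + placedCurve R θ f t₀ (clampIdx n (i + 1)) t)
        (Γ u + F u t)
      have h4 := dist_add_add_le (R.A (i + 1)) (placedCurve R θ f t₀ (clampIdx n (i + 1)) t)
        (Γ u) (F u t)
      have h5 := dist_triangle (R.A (i + 1)) (Γ w) (Γ u)
      have h6 := dist_triangle (placedCurve R θ f t₀ (clampIdx n (i + 1)) t) (F w t) (F u t)
      linarith
    have hsub : panel q i j ⊆ Metric.closedBall (Γ u + F u t) ε := by
      refine convexHull_min ?_ (convex_closedBall _ _)
      rintro _ ⟨k, hk, rfl⟩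
      rw [Metric.mem_closedBall]
      simp only [corners, Set.mem_insert_iff, Set.mem_singleton_iff] at hk
      rcases hk with rfl | rfl | rfl | rfl
      · exact k1 _ (h1 i (by omega)).1
      · exact k2 _ (h1 (i + 1) (by omega)).1
      · exact k2 _ (h1 (i + 1) (by omega)).2
      · exact k1 _ (h1 i (by omega)).2
    exact hsub hv
  · rintro w ⟨u, hu, t, ht, rfl⟩
    obtain ⟨j, hj, h1⟩ := hc2 t ht
    have hi := hA.idx_mem hu
    refine ⟨q (idx u) j, ⟨idx u, hi.2, j, hj.2, subset_convexHull ℝ _ ⟨(idx u, j), ?_, rfl⟩⟩, ?_⟩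
    · simp [corners]
    · have h2 := h1 _ (hi.2.trans (Nat.le_succ n))
      rw [clampIdx_of_mem hi] at h2
      have h3 := dist_triangle (q (idx u) j) (R.A (idx u) + placedCurve R θ f t₀ (idx u) t)
        (Γ u + F u t)
      have h4 := dist_add_add_le (R.A (idx u)) (placedCurve R θ f t₀ (idx u) t) (Γ u) (F u t)
      have h5 := hA.dist_le u hu
      rw [dist_comm] at h5
      linarith [hF u hu t ht]

end Design

end ParallelRepeating

end

open ParallelRepeating in
theorem mainTheorem2 (Γ : ℝ → Space) (a b : ℝ) (hab : a ≤ b) (hΓ : ContinuousOn Γ (Set.Icc a b))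
    (f : ℝ → Plane) (c d : ℝ) (hcd : c ≤ d) (hf : ContinuousOn f (Set.Icc c d))
    (t₀ : ℝ) (ht₀ : t₀ ∈ Set.Icc c d) (θ : ℝ) :
    (∀ (ε ε₁ : ℝ) (n : ℕ) (R : Row) (idx : ℝ → ℕ), ε₁ < ε →
      IsDesign Γ a b f c d t₀ θ n R idx ε₁ →
      ∃ (m j₀ : ℕ) (P : ℕ → ℕ → Plane) (q : ℕ → ℕ → Space),
        Realizes Γ a b f c d t₀ θ n R m j₀ P q ε ∧
        Metric.hausdorffEDist (innerVertices n m q)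
          (surface Γ (fun u t => placedCurve R θ f t₀ (idx u) t) a b c d) ≤ ENNReal.ofReal ε) ∧
    (∀ F : ℝ → ℝ → Space,
      ContinuousOn (fun p : ℝ × ℝ => F p.1 p.2) (Set.Icc a b ×ˢ Set.Icc c d) →
      (∀ δ > 0, ∃ (n : ℕ) (R : Row) (idx : ℝ → ℕ), IsDesign Γ a b f c d t₀ θ n R idx δ ∧
        ∀ u ∈ Set.Icc a b, ∀ t ∈ Set.Icc c d,
          dist (placedCurve R θ f t₀ (idx u) t) (F u t) ≤ δ) →
      ∀ ε > 0, ∃ (n : ℕ) (R : Row) (idx : ℝ → ℕ) (m j₀ : ℕ) (P : ℕ → ℕ → Plane)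
          (q : ℕ → ℕ → Space),
        IsDesign Γ a b f c d t₀ θ n R idx ε ∧
        (∀ u ∈ Set.Icc a b, ∀ t ∈ Set.Icc c d,
          dist (placedCurve R θ f t₀ (idx u) t) (F u t) ≤ ε) ∧
        Realizes Γ a b f c d t₀ θ n R m j₀ P q ε ∧
        Metric.hausdorffEDist (innerVertices n m q) (surface Γ F a b c d) ≤ ENNReal.ofReal ε ∧
        Metric.hausdorffEDist (region n m q) (surface Γ F a b c d) ≤ ENNReal.ofReal ε) := by
  constructor
  · intro ε ε₁ n R idx hε hD
    have hA := hD.approximates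
    have h0 : 0 ≤ ε₁ := dist_nonneg.trans hA.dist_left
    obtain ⟨m, j₀, P, q, hreal, hc1, hc2⟩ := hD.exists_realizes (hA.one_le hab) hcd hf ht₀
      (sub_pos.2 hε) (by linarith) hε.le
    exact ⟨m, j₀, P, q, hreal, hA.hausdorffEDist_innerVertices hc1 hc2 (δ := 0)
      (fun u _ t _ => (dist_self _).le) (by linarith)⟩
  · intro F hF hlim ε hε
    have hu1 := isCompact_Icc.uniformContinuousOn_of_continuous hΓ
    have hu2 := (isCompact_Icc.prod isCompact_Icc).uniformContinuousOn_of_continuous hF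
    rw [Metric.uniformContinuousOn_iff_le] at hu1 hu2
    obtain ⟨ρ₁, hρ₁, h1⟩ := hu1 (ε / 8) (by linarith)
    obtain ⟨ρ₂, hρ₂, h2⟩ := hu2 (ε / 8) (by linarith)
    obtain ⟨n, R, idx, hD, happ⟩ := hlim (ε / 8) (by linarith)
    have hA := hD.approximates
    obtain ⟨m, j₀, P, q, hreal, hc1, hc2⟩ := hD.exists_realizes (hA.one_le hab) hcd hf ht₀
      (ε := ε) (ν := ε / 8) (by linarith) (by linarith) (by linarith)
    have hle : ε / 8 ≤ ε := by linarith
    refine ⟨n, R, idx, m, j₀, P, q, ?_, fun u hu t ht => (happ u hu t ht).trans hle, hreal,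
      hA.hausdorffEDist_innerVertices hc1 hc2 happ (by linarith),
      hA.hausdorffEDist_region hab hc1 hc2 happ (ρ := min ρ₁ ρ₂) (lt_min hρ₁ hρ₂) ?_ (by linarith)
        (by linarith)⟩
    · exact ⟨hD.datumRow, ⟨hA.monotone, hA.image_eq, fun u hu => (hA.dist_le u hu).trans hle,
        hA.dist_left.trans hle, hA.dist_right.trans hle⟩, hD.decreasing, hD.drawable⟩
    · intro u hu v hv huv t ht
      rw [lt_min_iff] at huv
      refine ⟨h1 u hu v hv (by rw [Real.dist_eq]; exact huv.1.le),
        h2 (u, t) ⟨hu, ht⟩ (v, t) ⟨hv, ht⟩ ?_⟩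
      rw [Prod.dist_eq, dist_self, Real.dist_eq]
      exact max_le huv.2.le hρ₂.le
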